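/- Let $n\ge 1$ items have scores $\theta^\star\in\mathbb R^n$ with $\sum_i\theta^\star_i=0$, and put $\kappa(\theta^\star)=\max_i e^{\theta^\star_i}/\min_i e^{\theta^\star_i}$. Let the comparison graph $\mathcal G$ be an Erdős–Rényi random graph on $[n]$ with edge probability $p\in[0,1]$. For every edge $(i,j)$ of $\mathcal G$ with $i>j$ one observes $L\ge 1$ outcomes $y_{ji}^{(1)},\dots,y_{ji}^{(L)}\in\{0,1\}$, where $y_{ji}^{(l)}=1$ means that $i$ beats $j$; given $\mathcal G$ all outcomes are independent, and $\mathbb P(y_{ji}^{(l)}=1)=e^{\theta^\star_i}/(e^{\theta^\star_i}+e^{\theta^\star_j})$. The vanilla (unweighted) MLE is $$\widehat\theta=\arg\min_{\theta:\,\sum_i\theta_i=0}\; -\frac1L\sum_{(i,j)\in\mathcal G,\,i>j}\ \sum_{l=1}^L\log\Big(y_{ji}^{(l)}\tfrac{e^{\theta_i}}{e^{\theta_i}+e^{\theta_j}}+(1-y_{ji}^{(l)})\tfrac{e^{\theta_j}}{e^{\theta_i}+e^{\theta_j}}\Big).$$ For every $\kappa_0\ge1$ there are constants $C_1,C_2,C_3>0$,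 depending only on $\kappa_0$, such that the following holds. (i) For all $n,L\ge1$ and $p\in[0,1]$ with $p\ge C_1\frac{\log n}{n}$ and $npL\ge C_2\log^2 n$, and for every $\theta^\star$ with $\sum_i\theta^\star_i=0$ and $\kappa(\theta^\star)\le\kappa_0$, with probability at least $1-n^{-10}$ the vanilla MLE exists, is unique, and satisfies $$\|\widehat\theta-\theta^\star\|_\infty\le C_3\sqrt{\frac{\log n}{npL}}.$$ (ii) This rate is optimal: if $\kappa_0>1$, there is a constant $c>0$, depending only on $\kappa_0$, such that for all $n,L,p$ as in (i) and every estimator $\tilde\theta$ (any $\mathbb R^n$-valued function of the observed graph and outcomes) there is a $\theta^\star$ with $\sum_i\theta^\star_i=0$ and $\kappa(\theta^\star)\le\kappa_0$ for which $$\mathbb P_{\theta^\star}\Big(\|\tilde\theta-\theta^\star\|_\infty\ge c\sqrt{\frac{\log n}{npL}}\Big)\ge\frac12 .$$ -/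

import Mathlib

noncomputable section

namespace BTL

open MeasureTheory ProbabilityTheory

/-- Unordered pairs of distinct items, each represented once as `(i, j)` with `i > j`. -/
abbrev ItemPair (n : ℕ) : Type := {e : Fin n × Fin n // e.2 < e.1}

/-- The Bradley-Terry-Luce probability `e^{θ i} / (e^{θ i} + e^{θ j})` that `i` beats `j`. -/
def winProb {n : ℕ} (θ : Fin n → ℝ) (i j : Fin n) : unitInterval :=
  ⟨Real.exp (θ i) / (Real.exp (θ i) + Real.exp (θ j)), by positivity,
    div_le_one_of_le₀ (le_add_of_nonneg_right (Real.exp_pos _).le) (by positivity)⟩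

/-- The condition number `κ = max_i e^{θ i} / min_i e^{θ i}`. -/
def condNumber {n : ℕ} (θ : Fin n → ℝ) : ℝ :=
  (⨆ i, Real.exp (θ i)) / (⨅ i, Real.exp (θ i))

/-- A comparison graph, together with `L` potential outcomes for every pair `(i, j)`, `i > j`;
the outcome is `true` if `i` beats `j`. -/
abbrev Sample (n L : ℕ) : Type := SimpleGraph (Fin n) × (ItemPair n → Fin L → Bool)

/-- The law of a sample: an Erdős–Rényi comparison graph with edge probability `p` and,
independently of it, independent Bradley-Terry-Luce outcomes with scores `θ`. -/
def sampleLaw {n : ℕ} (L : ℕ) (p : unitInterval) (θ : Fin n → ℝ) : Measure (Sample n L) :=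
  (SimpleGraph.binomialRandom (Fin n) p).prod
    (Measure.pi fun e : ItemPair n => Measure.pi fun _ : Fin L =>
      bernoulliMeasure true false (winProb θ e.1.1 e.1.2))

/-- What the statistician sees: `none` at a pair that is not compared, and the `L` outcomes at a
pair that is an edge of the comparison graph. -/
abbrev Data (n L : ℕ) : Type := ItemPair n → Option (Fin L → Bool)

open Classical in
/-- The data observed in a sample; outcomes off the comparison graph are discarded. -/
def observe {n L : ℕ} (ω : Sample n L) : Data n L :=
  fun e => if ω.1.Adj e.1.1 e.1.2 then some (ω.2 e) else none

/-- The unweighted negative log-likelihood of the observed comparisons, divided by `L`. -/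
def negLogLik {n L : ℕ} (d : Data n L) (θ : Fin n → ℝ) : ℝ :=
  -(1 / (L : ℝ)) * ∑ e : ItemPair n,
    (d e).elim 0 fun y => ∑ l : Fin L,
      Real.log (if y l then Real.exp (θ e.1.1) / (Real.exp (θ e.1.1) + Real.exp (θ e.1.2))
        else Real.exp (θ e.1.2) / (Real.exp (θ e.1.1) + Real.exp (θ e.1.2)))

/-- `θ` is a vanilla maximum likelihood estimate: it minimizes the unweighted negative
log-likelihood over the vectors whose entries sum to zero. -/
def IsMLE {n L : ℕ} (d : Data n L) (θ : Fin n → ℝ) : Prop :=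
  ∑ i, θ i = 0 ∧ ∀ θ' : Fin n → ℝ, ∑ i, θ' i = 0 → negLogLik d θ ≤ negLogLik d θ'

/-- The score vectors under consideration: centered, with condition number at most `κ₀`. -/
def scoreClass (n : ℕ) (κ₀ : ℝ) : Set (Fin n → ℝ) :=
  {θ | ∑ i, θ i = 0 ∧ condNumber θ ≤ κ₀}

/-- The sampling regime `p ≥ C₁ log n / n` and `n p L ≥ C₂ log² n`, with `n, L ≥ 1`. -/
def Regime (C₁ C₂ : ℝ) (n L : ℕ) (p : unitInterval) : Prop :=
  1 ≤ n ∧ 1 ≤ L ∧ C₁ * (Real.log n / n) ≤ (p : ℝ) ∧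
    C₂ * Real.log n ^ 2 ≤ (n : ℝ) * (p : ℝ) * (L : ℝ)

/-- The rate `√(log n / (n p L))`. -/
def rate (n L : ℕ) (p : unitInterval) : ℝ :=
  √(Real.log n / ((n : ℝ) * (p : ℝ) * (L : ℝ)))

end BTL

end

/-! Write `δ = θhat - θ*`, `N = n p`, `R = √(log n / (n p L))`, and let `W` be the adjacency matrix
of the comparison graph. The score equations say that `δ` is the potential of a nonlinear electrical
network: the edge responses are increments of the sigmoid, and the source at `i` is `∑ j, W i j * ε
i j`, with `ε` the centered average outcomes. Outside `[-1, 1]` the response is continued linearly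
(`truncLink`), so that all slopes lie between a constant `c` depending on `κ₀` and `1`. The
truncated equations are then strongly monotone and solvable (`exists_flow_eq`). Once the solution is
shown to be at most `1/2` everywhere, the truncation is inactive, and convexity of the likelihood on
a connected graph makes `θ* + δ` the unique MLE (`isMLE_of_score_eq`).

The uniform bound is a leave-one-out argument (`abs_le_of_leaveOneOut`). Degrees at most `3N` and
cuts at least `N/8` per vertex give, by `cheeger`, a Poincaré inequality of order `N`, which
controls potentials in `ℓ²`. Let `M = |δ m|` be the maximum of `|δ|`. Balance of flow at `m` bounds
`N * M` by the source at `m` plus the sum of `|δ j|` over the neighbours of `m`. Away from `m`, `δ =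
y + v + s`: here `y` is the potential with `m` deleted, `v` is `ℓ²`-small because deletion disturbs
only the equations at neighbours of `m`, and `s` is a constant of order `M / n`. Since `y` does not
depend on which edges are present at `m`, Chernoff bounds its sum over the neighbours by `2p` times
its `ℓ¹` norm plus a logarithmic multiple of its maximum. The resulting terms in `M` are absorbed,
leaving `M` of order `R`.

The required events have high probability by Chernoff bounds for the graph and Hoeffding bounds for
the outcomes.

For the lower bound, take `n` score vectors in which one item is raised by `s = 2cR`. An estimator
can be within `cR` of at most one of them, so the `n` success events are disjoint. Given the graph,
each model differs from fair coins only at the edges of its raised item, with second moment of the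
likelihood ratio at most `√n`. A `χ²` change of measure then makes the average success probability
less than `1/2`. -/

noncomputable section

namespace BTL

open MeasureTheory ProbabilityTheory

/-! ### Strongly monotone maps and nonlinear network flows. -/

section

/-- Zarantonello's theorem: a strongly monotone Lipschitz map of a Hilbert space is surjective. -/
theorem exists_eq_of_stronglyMonotone {E : Type*} [NormedAddCommGroup E] [InnerProductSpace ℝ E]
    [CompleteSpace E] {T : E → E} {K : NNReal} (hT : LipschitzWith K T) {μ : ℝ} (hμ : 0 < μ)
    (hmono : ∀ x y, μ * ‖x - y‖ ^ 2 ≤ inner ℝ (T x - T y) (x - y)) (b : E) : ∃ x, T x = b := by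
  set k : ℝ := max (K : ℝ) μ with hk
  have hk0 : 0 < k := lt_of_lt_of_le hμ (le_max_right _ _)
  have hTk : ∀ x y, ‖T x - T y‖ ≤ k * ‖x - y‖ := fun x y => by
    have h := hT.dist_le_mul x y
    rw [dist_eq_norm, dist_eq_norm] at h
    exact h.trans (mul_le_mul_of_nonneg_right (le_max_left _ _) (norm_nonneg _))
  -- This step size minimizes the bound `1 - 2 τ μ + τ² k²` on the squared contraction factor of `x
  -- ↦ x - τ (T x - b)`, whose fixed points are the solutions. Taking `k ≥ μ` keeps the minimum
  -- nonnegative.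
  set τ : ℝ := μ / k ^ 2 with hτ
  have hτ0 : 0 < τ := by positivity
  have hρ : 0 ≤ 1 - μ ^ 2 / k ^ 2 := by
    have : μ ^ 2 / k ^ 2 ≤ 1 := by
      rw [div_le_one (by positivity)]
      exact pow_le_pow_left₀ hμ.le (le_max_right _ _) 2
    linarith
  have hρ1 : √(1 - μ ^ 2 / k ^ 2) < 1 := by
    rw [Real.sqrt_lt' one_pos]
    have : 0 < μ ^ 2 / k ^ 2 := by positivity
    linarith
  let Φ : E → E := fun x => x - τ • (T x - b)
  have hΦ : ContractingWith ⟨√(1 - μ ^ 2 / k ^ 2), Real.sqrt_nonneg _⟩ Φ := by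
    refine ⟨by exact_mod_cast hρ1, LipschitzWith.of_dist_le_mul fun x y => ?_⟩
    rw [dist_eq_norm, dist_eq_norm]
    change _ ≤ √(1 - μ ^ 2 / k ^ 2) * _
    refine le_of_sq_le_sq ?_ (by positivity)
    rw [mul_pow, Real.sq_sqrt hρ]
    have e : Φ x - Φ y = (x - y) - τ • (T x - T y) := by
      simp only [Φ, smul_sub]; abel
    rw [e, norm_sub_sq_real, inner_smul_right, norm_smul, Real.norm_of_nonneg hτ0.le, mul_pow,
      real_inner_comm]
    have h1 := mul_le_mul_of_nonneg_left (hmono x y) hτ0.le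
    have h2 : ‖T x - T y‖ ^ 2 ≤ k ^ 2 * ‖x - y‖ ^ 2 := by
      rw [← mul_pow]; exact pow_le_pow_left₀ (norm_nonneg _) (hTk x y) 2
    have h3 := mul_le_mul_of_nonneg_left h2 (sq_nonneg τ)
    have e1 : τ ^ 2 * (k ^ 2 * ‖x - y‖ ^ 2) = μ ^ 2 / k ^ 2 * ‖x - y‖ ^ 2 := by
      rw [hτ]; field_simp
    have e2 : τ * (μ * ‖x - y‖ ^ 2) = μ ^ 2 / k ^ 2 * ‖x - y‖ ^ 2 := by
      rw [hτ]; ring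
    linarith
  refine ⟨hΦ.fixedPoint, ?_⟩
  have h : hΦ.fixedPoint - τ • (T hΦ.fixedPoint - b) = hΦ.fixedPoint := hΦ.fixedPoint_isFixedPt
  have h' : τ • (T hΦ.fixedPoint - b) = 0 := by simpa using h
  rcases smul_eq_zero.1 h' with h0 | h0
  · exact absurd h0 hτ0.ne'
  · exact sub_eq_zero.1 h0

variable {V : Type*}

/-- A family of edge responses: antisymmetric in the orientation of the edge, vanishing at `0`,
with all slopes between `c` and `1`. -/
structure IsLink (c : ℝ) (g : V → V → ℝ → ℝ) : Prop where
  antisymm : ∀ i j t, g j i (-t) = -g i j t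
  map_zero : ∀ i j, g i j 0 = 0
  le_slope : ∀ i j s t, s ≤ t → c * (t - s) ≤ g i j t - g i j s
  slope_le : ∀ i j s t, s ≤ t → g i j t - g i j s ≤ t - s

namespace IsLink

variable {c : ℝ} {g : V → V → ℝ → ℝ}

theorem mul_sq_le (hg : IsLink c g) (i j : V) (s t : ℝ) :
    c * (s - t) ^ 2 ≤ (g i j s - g i j t) * (s - t) := by
  rcases le_total s t with h | h
  · nlinarith [hg.le_slope i j s t h]
  · nlinarith [hg.le_slope i j t s h]

theorem abs_sub_le (hg : IsLink c g) (hc : 0 ≤ c) (i j : V) (s t : ℝ) :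
    |g i j s - g i j t| ≤ |s - t| := by
  rcases le_total s t with h | h
  · have h1 := hg.le_slope i j s t h
    have h2 := hg.slope_le i j s t h
    have h3 := mul_nonneg hc (sub_nonneg.2 h)
    rw [abs_sub_comm, abs_sub_comm s, abs_of_nonneg (by linarith), abs_of_nonneg (by linarith)]
    exact h2
  · have h1 := hg.le_slope i j t s h
    have h2 := hg.slope_le i j t s h
    have h3 := mul_nonneg hc (sub_nonneg.2 h)
    rw [abs_of_nonneg (by linarith), abs_of_nonneg (by linarith)]
    exact h2

theorem abs_le (hg : IsLink c g) (hc : 0 ≤ c) (i j : V) (s : ℝ) : |g i j s| ≤ |s| := by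
  simpa [hg.map_zero] using hg.abs_sub_le hc i j s 0

end IsLink

variable [Fintype V]

/-- The net flow out of each vertex of a network with conductances `W`, responses `g` and
potential `x`. -/
def flow (W : V → V → ℝ) (g : V → V → ℝ → ℝ) (x : V → ℝ) (i : V) : ℝ :=
  ∑ j, W i j * g i j (x i - x j)

/-- The Dirichlet energy, each edge counted in both orientations. -/
def energy (W : V → V → ℝ) (x : V → ℝ) : ℝ := ∑ i, ∑ j, W i j * (x i - x j) ^ 2

/-- Discrete integration by parts: exchange `i` and `j` in the double sum. -/
theorem two_mul_sum_mul_antisymm (u : V → ℝ) (h : V → V → ℝ) (hh : ∀ i j, h j i = -h i j) :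
    2 * ∑ i, u i * ∑ j, h i j = ∑ i, ∑ j, h i j * (u i - u j) := by
  have e : ∑ i, ∑ j, h i j * u j = -∑ i, u i * ∑ j, h i j := by
    rw [Finset.sum_comm, ← Finset.sum_neg_distrib]
    refine Finset.sum_congr rfl fun i _ => ?_
    rw [Finset.mul_sum, ← Finset.sum_neg_distrib]
    exact Finset.sum_congr rfl fun j _ => by rw [hh]; ring
  have e' : ∑ i, ∑ j, h i j * (u i - u j) = ∑ i, u i * ∑ j, h i j - ∑ i, ∑ j, h i j * u j := by
    rw [← Finset.sum_sub_distrib]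
    refine Finset.sum_congr rfl fun i _ => ?_
    rw [Finset.mul_sum, ← Finset.sum_sub_distrib]
    exact Finset.sum_congr rfl fun j _ => by ring
  rw [e', e]; ring

namespace IsLink

variable {c : ℝ} {g : V → V → ℝ → ℝ}
-- Strong monotonicity of the flow, measured in energy: integrate by parts and use the slope bound
-- on each edge.
theorem mul_energy_le (hg : IsLink c g) {W : V → V → ℝ} (hW : ∀ i j, W j i = W i j)
    (hW0 : ∀ i j, 0 ≤ W i j) (x y : V → ℝ) :
    c * energy W (x - y) ≤ 2 * ∑ i, (x i - y i) * (flow W g x i - flow W g y i) := by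
  have e : ∀ i, flow W g x i - flow W g y i
      = ∑ j, W i j * (g i j (x i - x j) - g i j (y i - y j)) := fun i => by
    rw [flow, flow, ← Finset.sum_sub_distrib]
    exact Finset.sum_congr rfl fun j _ => by ring
  simp_rw [e]
  rw [two_mul_sum_mul_antisymm (fun i => x i - y i)
    (fun i j => W i j * (g i j (x i - x j) - g i j (y i - y j)))]
  · rw [energy, Finset.mul_sum]
    refine Finset.sum_le_sum fun i _ => ?_
    rw [Finset.mul_sum]
    refine Finset.sum_le_sum fun j _ => ?_
    have h := mul_le_mul_of_nonneg_left (hg.mul_sq_le i j (x i - x j) (y i - y j)) (hW0 i j)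
    simp only [Pi.sub_apply]
    have e1 : x i - y i - (x j - y j) = x i - x j - (y i - y j) := by ring
    rw [e1]
    linarith
  · intro i j
    rw [hW, ← neg_sub (x i), ← neg_sub (y i), hg.antisymm, hg.antisymm]
    ring

theorem sum_flow (hg : IsLink c g) {W : V → V → ℝ} (hW : ∀ i j, W j i = W i j) (x : V → ℝ) :
    ∑ i, flow W g x i = 0 := by
  have := two_mul_sum_mul_antisymm (fun _ => (1 : ℝ)) (fun i j => W i j * g i j (x i - x j))
    (fun i j => by rw [hW, ← neg_sub (x i), hg.antisymm]; ring)
  simpa [flow] using this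

end IsLink

/-- Existence of a potential with prescribed flow on a set `U` of vertices carrying all the
edges. -/
theorem exists_flow_eq [DecidableEq V] {c : ℝ} (hc : 0 < c) {g : V → V → ℝ → ℝ}
    (hg : IsLink c g) {W : V → V → ℝ} (hW : ∀ i j, W j i = W i j) (hW0 : ∀ i j, 0 ≤ W i j)
    (U : Finset V) (hWU : ∀ i j, i ∉ U → W i j = 0) {lam : ℝ} (hlam : 0 < lam)
    (hP : ∀ x : V → ℝ, (∀ i ∉ U, x i = 0) → ∑ i, x i = 0 → lam * ∑ i, x i ^ 2 ≤ energy W x)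
    (ξ : V → ℝ) (hξ : ∑ i ∈ U, ξ i = 0) :
    ∃ x : V → ℝ, (∀ i ∉ U, x i = 0) ∧ ∑ i, x i = 0 ∧ ∀ i ∈ U, flow W g x i = ξ i := by
  -- The flow alone ignores constants on `U` and all values off `U`. Adding `B` makes the operator
  -- coercive in these directions; at the solution `B` vanishes.
  let B : (V → ℝ) → V → ℝ := fun x i => if i ∈ U then ∑ j ∈ U, x j else x i
  let T : EuclideanSpace ℝ V → EuclideanSpace ℝ V := fun x =>
    WithLp.toLp 2 (fun i => flow W g (WithLp.ofLp x) i + B (WithLp.ofLp x) i)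
  obtain ⟨K, hK⟩ : ∃ K, LipschitzWith K T := by
    let K₀ : ℝ := (∑ i, ∑ j, W i j * 2) + Fintype.card V + 1
    have hK₀ : 0 ≤ K₀ := by
      have : 0 ≤ ∑ i, ∑ j, W i j * 2 :=
        Finset.sum_nonneg fun i _ => Finset.sum_nonneg fun j _ => mul_nonneg (hW0 i j) zero_le_two
      positivity
    have h : LipschitzWith ⟨K₀, hK₀⟩ (fun (x : V → ℝ) i => flow W g x i + B x i) := by
      refine LipschitzWith.of_dist_le_mul fun x y => ?_
      change _ ≤ K₀ * _
      refine (dist_pi_le_iff (by positivity)).2 fun i => ?_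
      have hd : ∀ k, |x k - y k| ≤ dist x y := fun k => by
        rw [← Real.dist_eq]; exact dist_le_pi_dist x y k
      have h1 : |flow W g x i - flow W g y i| ≤ (∑ j, W i j * 2) * dist x y := by
        rw [flow, flow, ← Finset.sum_sub_distrib, Finset.sum_mul]
        refine (Finset.abs_sum_le_sum_abs _ _).trans (Finset.sum_le_sum fun j _ => ?_)
        rw [← mul_sub, abs_mul, abs_of_nonneg (hW0 i j), mul_assoc]
        refine mul_le_mul_of_nonneg_left ((hg.abs_sub_le hc.le _ _ _ _).trans ?_) (hW0 i j)
        have : x i - x j - (y i - y j) = (x i - y i) - (x j - y j) := by ring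
        rw [this]
        refine (abs_sub _ _).trans ?_
        linarith [hd i, hd j]
      have h2 : |B x i - B y i| ≤ (Fintype.card V + 1) * dist x y := by
        simp only [B]
        split_ifs with hi
        · rw [← Finset.sum_sub_distrib]
          refine (Finset.abs_sum_le_sum_abs _ _).trans ?_
          refine (Finset.sum_le_card_nsmul _ _ _ fun k _ => hd k).trans ?_
          rw [nsmul_eq_mul]
          refine mul_le_mul_of_nonneg_right ?_ dist_nonneg
          have : (U.card : ℝ) ≤ Fintype.card V := by exact_mod_cast U.card_le_univ
          linarith
        · refine (hd i).trans ?_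
          have : (0 : ℝ) ≤ Fintype.card V * dist x y := by positivity
          linarith
      have h3 : ∑ j, W i j * 2 ≤ ∑ i, ∑ j, W i j * 2 :=
        Finset.single_le_sum (f := fun i => ∑ j, W i j * 2)
          (fun i _ => Finset.sum_nonneg fun j _ => mul_nonneg (hW0 i j) zero_le_two)
          (Finset.mem_univ i)
      have h4 := mul_le_mul_of_nonneg_right h3 (dist_nonneg (x := x) (y := y))
      rw [Real.dist_eq]
      have : flow W g x i + B x i - (flow W g y i + B y i)
          = (flow W g x i - flow W g y i) + (B x i - B y i) := by ring
      rw [this]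
      refine (abs_add_le _ _).trans ?_
      simp only [K₀]
      linarith
    exact ⟨_, (PiLp.lipschitzWith_toLp 2 _).comp (h.comp (PiLp.lipschitzWith_ofLp 2 _))⟩
  have hμ : 0 < min (c * lam / 2) 1 := by positivity
  have hmono : ∀ x y : EuclideanSpace ℝ V,
      min (c * lam / 2) 1 * ‖x - y‖ ^ 2 ≤ inner ℝ (T x - T y) (x - y) := by
    intro x y
    set u : V → ℝ := WithLp.ofLp x - WithLp.ofLp y with hu
    have hn : ‖x - y‖ ^ 2 = ∑ i, u i ^ 2 := by
      rw [EuclideanSpace.real_norm_sq_eq]; rfl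
    have hi : inner ℝ (T x - T y) (x - y) = ∑ i, u i * (flow W g (WithLp.ofLp x) i
        - flow W g (WithLp.ofLp y) i) + ∑ i, u i * B u i := by
      rw [PiLp.inner_apply, ← Finset.sum_add_distrib]
      refine Finset.sum_congr rfl fun i _ => ?_
      have hB : B u i = B (WithLp.ofLp x) i - B (WithLp.ofLp y) i := by
        simp only [B, hu]
        split_ifs <;> simp [Finset.sum_sub_distrib]
      rw [hB]
      simp [T, hu]
      ring
    have hE := hg.mul_energy_le hW hW0 (WithLp.ofLp x) (WithLp.ofLp y)
    rw [← hu] at hE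
    have hBu : ∑ i, u i * B u i = (∑ i ∈ U, u i) ^ 2 + ∑ i ∈ Uᶜ, u i ^ 2 := by
      rw [← Finset.sum_add_sum_compl U]
      congr 1
      · rw [sq, Finset.sum_mul]
        exact Finset.sum_congr rfl fun i hi => by simp [B, hi]
      · exact Finset.sum_congr rfl fun i hi => by simp [B, Finset.mem_compl.1 hi, sq]
    -- On `U`, `u` splits into its mean `s` and the centered part `v`. The energy sees only `v`,
    -- which the Poincaré inequality controls; the mean is controlled by `B`.
    set s : ℝ := (∑ i ∈ U, u i) / U.card with hs
    have hsU : (U.card : ℝ) * s = ∑ i ∈ U, u i := by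
      rcases U.eq_empty_or_nonempty with h | h
      · simp [h]
      · have : (U.card : ℝ) ≠ 0 := by exact_mod_cast h.card_pos.ne'
        rw [hs]; field_simp
    let v : V → ℝ := fun i => if i ∈ U then u i - s else 0
    have hv0 : ∀ i ∉ U, v i = 0 := fun i hi => by simp [v, hi]
    have hvs : ∑ i, v i = 0 := by
      simp only [v, Finset.sum_ite_mem, Finset.univ_inter, Finset.sum_sub_distrib,
        Finset.sum_const, nsmul_eq_mul, hsU, sub_self]
    have hv2 : ∑ i, v i ^ 2 = ∑ i ∈ U, u i ^ 2 - U.card * s ^ 2 := by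
      have : ∑ i, v i ^ 2 = ∑ i ∈ U, (u i - s) ^ 2 := by
        simp only [v, ite_pow, ne_eq, OfNat.ofNat_ne_zero, not_false_eq_true, zero_pow,
          Finset.sum_ite_mem, Finset.univ_inter]
      rw [this]
      have e : ∀ i, (u i - s) ^ 2 = u i ^ 2 - 2 * s * u i + s ^ 2 := fun i => by ring
      simp_rw [e, Finset.sum_add_distrib, Finset.sum_sub_distrib, ← Finset.mul_sum, ← hsU]
      simp; ring
    have hvE : energy W v = energy W u := by
      refine Finset.sum_congr rfl fun i _ => Finset.sum_congr rfl fun j _ => ?_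
      by_cases hi : i ∈ U
      · by_cases hj : j ∈ U
        · simp only [v, hi, hj, if_true]; ring
        · rw [← hW, hWU j i hj]; ring
      · rw [hWU i j hi]; ring
    have hp := hP v hv0 hvs
    rw [hvE, hv2] at hp
    have hsq : (U.card : ℝ) * s ^ 2 ≤ (∑ i ∈ U, u i) ^ 2 := by
      rw [← hsU]
      rcases Nat.eq_zero_or_pos U.card with h | h
      · simp [h]
      · have : (1 : ℝ) ≤ U.card := by exact_mod_cast h
        nlinarith [mul_nonneg (mul_nonneg (Nat.cast_nonneg (α := ℝ) U.card)
          (sub_nonneg.2 this)) (sq_nonneg s)]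
    have hnn : 0 ≤ ∑ i, v i ^ 2 := Finset.sum_nonneg fun i _ => sq_nonneg _
    rw [hv2] at hnn
    have hcn : 0 ≤ ∑ i ∈ Uᶜ, u i ^ 2 := Finset.sum_nonneg fun i _ => sq_nonneg _
    have hUs : 0 ≤ (U.card : ℝ) * s ^ 2 := by positivity
    rw [hn, hi, hBu, ← Finset.sum_add_sum_compl U]
    have hE' : c * energy W u ≤ 2 * ∑ i, u i * (flow W g (WithLp.ofLp x) i
        - flow W g (WithLp.ofLp y) i) := hE
    have m1 := mul_le_mul_of_nonneg_right (min_le_left (c * lam / 2) 1) hnn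
    have m2 := mul_le_mul_of_nonneg_right (min_le_right (c * lam / 2) 1) hUs
    have m3 := mul_le_mul_of_nonneg_right (min_le_right (c * lam / 2) 1) hcn
    have m4 := mul_le_mul_of_nonneg_left hp hc.le
    linarith
  obtain ⟨x, hx⟩ := exists_eq_of_stronglyMonotone hK hμ hmono
    (WithLp.toLp 2 (fun i => if i ∈ U then ξ i else 0))
  have hxi : ∀ i, flow W g (WithLp.ofLp x) i + B (WithLp.ofLp x) i = if i ∈ U then ξ i else 0 :=
    fun i => congrFun (congrArg WithLp.ofLp hx) i
  have hflow0 : ∀ i ∉ U, flow W g (WithLp.ofLp x) i = 0 := fun i hi =>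
    Finset.sum_eq_zero fun j _ => by rw [hWU i j hi, zero_mul]
  have hx0 : ∀ i ∉ U, x i = 0 := fun i hi => by
    have := hxi i
    simpa [hflow0 i hi, B, hi] using this
  have hsum : ∑ i ∈ U, flow W g (WithLp.ofLp x) i = 0 := by
    rw [← hg.sum_flow hW (WithLp.ofLp x), ← Finset.sum_add_sum_compl U,
      Finset.sum_eq_zero (s := Uᶜ) fun i hi => hflow0 i (Finset.mem_compl.1 hi), add_zero]
  -- Summing the equations over `U` kills the flow and the sources, leaving `U.card` times this sum.
  have hUx : ∑ i ∈ U, x i = 0 := by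
    have h : ∑ i ∈ U, (flow W g (WithLp.ofLp x) i + ∑ j ∈ U, x j) = ∑ i ∈ U, ξ i :=
      Finset.sum_congr rfl fun i hi => by simpa [B, hi] using hxi i
    rw [Finset.sum_add_distrib, hsum, hξ, zero_add, Finset.sum_const, nsmul_eq_mul] at h
    rcases mul_eq_zero.1 h with h | h
    · rw [Finset.card_eq_zero.1 (show U.card = 0 by exact_mod_cast h)]; simp
    · exact h
  refine ⟨WithLp.ofLp x, hx0, ?_, fun i hi => ?_⟩
  · rw [← Finset.sum_add_sum_compl U, hUx,
      Finset.sum_eq_zero (s := Uᶜ) fun i hi => hx0 i (Finset.mem_compl.1 hi), add_zero]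
  · have := hxi i
    simpa [B, hi, hUx] using this

end

/-! ### Cheeger's inequality on a weighted graph. -/

section

variable {V : Type*} [Fintype V]

theorem energy_nonneg {W : V → V → ℝ} (hW0 : ∀ i j, 0 ≤ W i j) (x : V → ℝ) : 0 ≤ energy W x :=
  Finset.sum_nonneg fun i _ => Finset.sum_nonneg fun j _ => mul_nonneg (hW0 i j) (sq_nonneg _)

/-- Co-area inequality: edge expansion controls the total variation of a nonnegative function
supported on at most half of the vertices. -/
theorem two_mul_sum_le_totalVariation [DecidableEq V] {W : V → V → ℝ}
    (hW : ∀ i j, W j i = W i j) {κ : ℝ}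
    (hcut : ∀ S : Finset V, 2 * S.card ≤ Fintype.card V →
      κ * S.card ≤ ∑ i ∈ S, ∑ j ∈ Sᶜ, W i j) (a : V → ℝ) (ha : ∀ i, 0 ≤ a i)
    (hsupp : 2 * (Finset.univ.filter fun i => 0 < a i).card ≤ Fintype.card V) :
    2 * κ * ∑ i, a i ≤ ∑ i, ∑ j, W i j * |a i - a j| := by
  induction hk : (Finset.univ.filter fun i => 0 < a i).card using Nat.strong_induction_on
    generalizing a with
  | _ k ih =>
  set S : Finset V := Finset.univ.filter fun i => 0 < a i with hS
  have hSm : ∀ i, i ∈ S ↔ 0 < a i := fun i => by simp [hS]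
  rcases S.eq_empty_or_nonempty with hE | hne
  · have h0 : ∀ i, a i = 0 := fun i => le_antisymm (not_lt.1 fun h => by
      have := (hSm i).2 h
      simp [hE] at this) (ha i)
    simp [h0]
  -- Peel off the lowest positive level: `a = b + μ χ` with `χ` the indicator of the support. Total
  -- variation is additive along this splitting, the cut bound handles `χ`, and `b` has smaller
  -- support.
  obtain ⟨i₀, hi₀, hmin⟩ := Finset.exists_min_image S a hne
  set μ : ℝ := a i₀ with hμ
  have hμ0 : 0 < μ := (hSm i₀).1 hi₀
  let χ : V → ℝ := fun i => if i ∈ S then 1 else 0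
  let b : V → ℝ := fun i => a i - μ * χ i
  have hnot : ∀ i, i ∉ S → a i = 0 := fun i hi =>
    le_antisymm (not_lt.1 fun h => hi ((hSm i).2 h)) (ha i)
  have hb : ∀ i, 0 ≤ b i := fun i => by
    by_cases hi : i ∈ S
    · simp only [b, χ, hi, if_true, mul_one]; linarith [hmin i hi]
    · simp [b, χ, hi, hnot i hi]
  have hsub : (Finset.univ.filter fun i => 0 < b i) ⊂ S := by
    refine Finset.ssubset_iff_subset_ne.2 ⟨fun i hi => ?_, fun h => ?_⟩
    · have h := (Finset.mem_filter.1 hi).2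
      by_contra hc
      simp [b, χ, hc, hnot i hc] at h
    · have : i₀ ∈ Finset.univ.filter fun i => 0 < b i := h ▸ hi₀
      simp [b, χ, hi₀, hμ] at this
  have hlt := Finset.card_lt_card hsub
  have hrec := ih _ (hk ▸ hlt) b hb (by omega) rfl
  have hcutS := hcut S hsupp
  have hχ : ∑ i, χ i = S.card := by simp [χ]
  have hsum : ∑ i, a i = ∑ i, b i + μ * S.card := by
    rw [← hχ, Finset.mul_sum, ← Finset.sum_add_distrib]
    exact Finset.sum_congr rfl fun i _ => by simp only [b]; ring
  have habs : ∀ i j, |a i - a j| = |b i - b j| + μ * |χ i - χ j| := fun i j => by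
    by_cases hi : i ∈ S <;> by_cases hj : j ∈ S
    · simp [b, χ, hi, hj]
    · have h1 := hb i
      simp only [b, χ, hi, hj, hnot j hj, if_true, if_false] at h1 ⊢
      rw [abs_of_nonneg (by linarith [ha i]), abs_of_nonneg (by linarith), abs_of_nonneg (by simp)]
      ring
    · have h1 := hb j
      simp only [b, χ, hi, hj, hnot i hi, if_true, if_false] at h1 ⊢
      rw [abs_of_nonpos (by linarith [ha j]), abs_of_nonpos (by linarith), abs_of_nonpos (by simp)]
      ring
    · simp [b, χ, hi, hj]
  have hcutχ : ∑ i, ∑ j, W i j * |χ i - χ j| = 2 * ∑ i ∈ S, ∑ j ∈ Sᶜ, W i j := by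
    have e1 : ∀ i ∈ S, ∑ j, W i j * |χ i - χ j| = ∑ j ∈ Sᶜ, W i j := fun i hi => by
      rw [← Finset.sum_add_sum_compl S, Finset.sum_eq_zero (s := S), zero_add]
      · exact Finset.sum_congr rfl fun j hj => by simp [χ, hi, Finset.mem_compl.1 hj]
      · intro j hj; simp [χ, hi, hj]
    have e2 : ∀ i ∈ Sᶜ, ∑ j, W i j * |χ i - χ j| = ∑ j ∈ S, W i j := fun i hi => by
      rw [← Finset.sum_add_sum_compl S, Finset.sum_eq_zero (s := Sᶜ), add_zero]
      · exact Finset.sum_congr rfl fun j hj => by simp [χ, hj, Finset.mem_compl.1 hi]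
      · intro j hj; simp [χ, Finset.mem_compl.1 hi, Finset.mem_compl.1 hj]
    rw [← Finset.sum_add_sum_compl S, Finset.sum_congr rfl e1, Finset.sum_congr rfl e2,
      Finset.sum_comm (s := Sᶜ), two_mul]
    congr 1
    exact Finset.sum_congr rfl fun i _ => Finset.sum_congr rfl fun j _ => hW _ _
  have hTV : ∑ i, ∑ j, W i j * |a i - a j|
      = ∑ i, ∑ j, W i j * |b i - b j| + μ * ∑ i, ∑ j, W i j * |χ i - χ j| := by
    rw [Finset.mul_sum, ← Finset.sum_add_distrib]
    refine Finset.sum_congr rfl fun i _ => ?_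
    rw [Finset.mul_sum, ← Finset.sum_add_distrib]
    exact Finset.sum_congr rfl fun j _ => by rw [habs]; ring
  rw [hTV, hcutχ, hsum]
  have := mul_le_mul_of_nonneg_left hcutS hμ0.le
  linarith

/-- Every real function on a finite type has a median. -/
theorem exists_median [Nonempty V] (x : V → ℝ) : ∃ c : ℝ,
    2 * (Finset.univ.filter fun i => c < x i).card ≤ Fintype.card V ∧
    2 * (Finset.univ.filter fun i => x i < c).card ≤ Fintype.card V := by
  classical
  let Z : Finset V := Finset.univ.filter fun i =>
    2 * (Finset.univ.filter fun j => x i < x j).card ≤ Fintype.card V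
  have hZ : Z.Nonempty := by
    obtain ⟨i, -, hi⟩ := Finset.exists_max_image Finset.univ x Finset.univ_nonempty
    refine ⟨i, Finset.mem_filter.2 ⟨Finset.mem_univ _, ?_⟩⟩
    rw [Finset.filter_eq_empty_iff.2 fun j _ => not_lt.2 (hi j (Finset.mem_univ j))]
    simp
  obtain ⟨i, hiZ, hi⟩ := Finset.exists_min_image Z x hZ
  refine ⟨x i, (Finset.mem_filter.1 hiZ).2, ?_⟩
  -- Otherwise more than half of the points lie below `x i`. With `x j` the largest value there,
  -- more than half also lie above `x j` by minimality of `x i`, and these two sets are disjoint.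
  by_contra! hlt
  have hne : (Finset.univ.filter fun j => x j < x i).Nonempty := by
    rw [← Finset.card_pos]; omega
  obtain ⟨j, hj, hjmax⟩ := Finset.exists_max_image _ x hne
  have hjlt := (Finset.mem_filter.1 hj).2
  have hjZ : j ∉ Z := fun h => absurd (hi j h) (not_le.2 hjlt)
  have hj2 : Fintype.card V < 2 * (Finset.univ.filter fun k => x j < x k).card := by
    by_contra! h
    exact hjZ (Finset.mem_filter.2 ⟨Finset.mem_univ _, h⟩)
  have hdis : Disjoint (Finset.univ.filter fun k => x k < x i)
      (Finset.univ.filter fun k => x j < x k) := by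
    refine Finset.disjoint_left.2 fun k hk hk' => ?_
    exact absurd (hjmax k hk) (not_le.2 (Finset.mem_filter.1 hk').2)
  have := Finset.card_union_of_disjoint hdis
  have h2 := Finset.card_le_univ ((Finset.univ.filter fun k => x k < x i) ∪
      (Finset.univ.filter fun k => x j < x k))
  omega

/-- Apply the co-area inequality to `h ^ 2`, factor `h i ^ 2 - h j ^ 2` and use Cauchy–Schwarz. The
factor with `h i + h j` costs at most `4 * D * ∑ i, h i ^ 2`. -/
theorem cheeger_of_supp [DecidableEq V] {W : V → V → ℝ}
    (hW : ∀ i j, W j i = W i j) (hW0 : ∀ i j, 0 ≤ W i j) {κ D : ℝ} (hκ : 0 ≤ κ)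
    (hcut : ∀ S : Finset V, 2 * S.card ≤ Fintype.card V →
      κ * S.card ≤ ∑ i ∈ S, ∑ j ∈ Sᶜ, W i j) (hdeg : ∀ i, ∑ j, W i j ≤ D)
    (h : V → ℝ) (hh : ∀ i, 0 ≤ h i)
    (hsupp : 2 * (Finset.univ.filter fun i => 0 < h i).card ≤ Fintype.card V) :
    κ ^ 2 * ∑ i, h i ^ 2 ≤ D * energy W h := by
  have hco := two_mul_sum_le_totalVariation hW hcut (fun i => h i ^ 2)
    (fun i => sq_nonneg _) (by
      have : (Finset.univ.filter fun i => 0 < h i ^ 2) = Finset.univ.filter fun i => 0 < h i :=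
        Finset.filter_congr fun i _ => ⟨fun hi => lt_of_le_of_ne (hh i) fun h0 => by
          simp [← h0] at hi, fun hi => by positivity⟩
      rwa [this])
  set A : ℝ := ∑ i, h i ^ 2 with hA
  have hA0 : 0 ≤ A := Finset.sum_nonneg fun i _ => sq_nonneg _
  have hCS : (∑ i, ∑ j, W i j * |h i ^ 2 - h j ^ 2|) ^ 2
      ≤ energy W h * ∑ i, ∑ j, W i j * (h i + h j) ^ 2 := by
    simp only [energy, ← Finset.sum_product']
    have := Finset.sum_sq_le_sum_mul_sum_of_sq_le_mul
      (s := (Finset.univ : Finset V) ×ˢ (Finset.univ : Finset V))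
      (r := fun q : V × V => W q.1 q.2 * |h q.1 ^ 2 - h q.2 ^ 2|)
      (f := fun q : V × V => W q.1 q.2 * (h q.1 - h q.2) ^ 2)
      (g := fun q : V × V => W q.1 q.2 * (h q.1 + h q.2) ^ 2)
      (fun q _ => mul_nonneg (hW0 _ _) (sq_nonneg _))
      (fun q _ => mul_nonneg (hW0 _ _) (sq_nonneg _))
      (fun q _ => le_of_eq (by rw [mul_pow, sq_abs]; ring))
    exact this
  have hplus : ∑ i, ∑ j, W i j * (h i + h j) ^ 2 ≤ 4 * D * A := by
    have h1 : ∑ i, ∑ j, W i j * (h i + h j) ^ 2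
        ≤ ∑ i, ∑ j, (2 * (W i j * h i ^ 2) + 2 * (W i j * h j ^ 2)) :=
      Finset.sum_le_sum fun i _ => Finset.sum_le_sum fun j _ => by
        nlinarith [mul_nonneg (hW0 i j) (sq_nonneg (h i - h j))]
    have h2 : ∑ i, ∑ j, W i j * h i ^ 2 ≤ D * A := by
      rw [hA, Finset.mul_sum]
      refine Finset.sum_le_sum fun i _ => ?_
      rw [← Finset.sum_mul]
      exact mul_le_mul_of_nonneg_right (hdeg i) (sq_nonneg _)
    have h3 : ∑ i, ∑ j, W i j * h j ^ 2 = ∑ i, ∑ j, W i j * h i ^ 2 := by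
      rw [Finset.sum_comm]
      exact Finset.sum_congr rfl fun i _ => Finset.sum_congr rfl fun j _ => by rw [hW]
    simp only [Finset.sum_add_distrib, ← Finset.mul_sum] at h1
    rw [h3] at h1
    linarith
  have hE := energy_nonneg hW0 h
  have h4 : (2 * κ * A) ^ 2 ≤ energy W h * (4 * D * A) :=
    (pow_le_pow_left₀ (by positivity) hco 2).trans
      (hCS.trans (mul_le_mul_of_nonneg_left hplus hE))
  rcases hA0.eq_or_lt with h0 | h0
  · rw [← h0, mul_zero]
    rcases isEmpty_or_nonempty V with hV | ⟨⟨i⟩⟩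
    · simp [energy]
    · have : 0 ≤ D := (Finset.sum_nonneg fun j _ => hW0 i j).trans (hdeg i)
      positivity
  · have : 4 * A * (κ ^ 2 * A) ≤ 4 * A * (D * energy W h) := by nlinarith
    exact le_of_mul_le_mul_left this (by positivity)

/-- Cheeger's inequality: edge expansion and a degree bound give a Poincaré inequality. -/
theorem cheeger [DecidableEq V] {W : V → V → ℝ}
    (hW : ∀ i j, W j i = W i j) (hW0 : ∀ i j, 0 ≤ W i j) {κ D : ℝ} (hκ : 0 ≤ κ) (hD : 0 ≤ D)
    (hcut : ∀ S : Finset V, 2 * S.card ≤ Fintype.card V →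
      κ * S.card ≤ ∑ i ∈ S, ∑ j ∈ Sᶜ, W i j) (hdeg : ∀ i, ∑ j, W i j ≤ D)
    (x : V → ℝ) (hx : ∑ i, x i = 0) :
    κ ^ 2 * ∑ i, x i ^ 2 ≤ D * energy W x := by
  rcases isEmpty_or_nonempty V with hV | hV
  · simp [energy]
  obtain ⟨c, hc1, hc2⟩ := exists_median x
  -- Both parts of `x - c` are supported on at most half of the vertices because `c` is a median.
  have hp := cheeger_of_supp hW hW0 hκ hcut hdeg (fun i => max (x i - c) 0)
    (fun i => le_max_right _ _) (by simpa using hc1)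
  have hm := cheeger_of_supp hW hW0 hκ hcut hdeg (fun i => max (c - x i) 0)
    (fun i => le_max_right _ _) (by simpa using hc2)
  have hE : energy W (fun i => max (x i - c) 0) + energy W (fun i => max (c - x i) 0)
      ≤ energy W x := by
    simp only [energy, ← Finset.sum_add_distrib]
    refine Finset.sum_le_sum fun i _ => Finset.sum_le_sum fun j _ => ?_
    rw [← mul_add]
    refine mul_le_mul_of_nonneg_left ?_ (hW0 i j)
    rcases le_total (x i) c with h1 | h1 <;> rcases le_total (x j) c with h2 | h2
    · rw [max_eq_right (by linarith), max_eq_right (by linarith), max_eq_left (by linarith),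
        max_eq_left (by linarith)]; nlinarith
    · rw [max_eq_right (by linarith), max_eq_left (by linarith), max_eq_left (by linarith),
        max_eq_right (by linarith)]; nlinarith [mul_nonneg (sub_nonneg.2 h1) (sub_nonneg.2 h2)]
    · rw [max_eq_left (by linarith), max_eq_right (by linarith), max_eq_right (by linarith),
        max_eq_left (by linarith)]; nlinarith [mul_nonneg (sub_nonneg.2 h1) (sub_nonneg.2 h2)]
    · rw [max_eq_left (by linarith), max_eq_left (by linarith), max_eq_right (by linarith),
        max_eq_right (by linarith)]; nlinarith
  -- As `x` is centered, subtracting a constant can only increase its `ℓ²` norm.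
  have hS : ∑ i, x i ^ 2 ≤ ∑ i, max (x i - c) 0 ^ 2 + ∑ i, max (c - x i) 0 ^ 2 := by
    have e : ∀ i, max (x i - c) 0 ^ 2 + max (c - x i) 0 ^ 2 = x i ^ 2 - 2 * c * x i + c ^ 2 := by
      intro i
      rcases le_total (x i) c with h1 | h1
      · rw [max_eq_right (by linarith), max_eq_left (by linarith)]; ring
      · rw [max_eq_left (by linarith), max_eq_right (by linarith)]; ring
    rw [← Finset.sum_add_distrib, Finset.sum_congr rfl fun i _ => e i, Finset.sum_add_distrib,
      Finset.sum_sub_distrib, ← Finset.mul_sum, hx]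
    have : (0 : ℝ) ≤ ∑ i : V, c ^ 2 := Finset.sum_nonneg fun i _ => sq_nonneg _
    linarith
  calc κ ^ 2 * ∑ i, x i ^ 2 ≤ κ ^ 2 * (∑ i, max (x i - c) 0 ^ 2 + ∑ i, max (c - x i) 0 ^ 2) :=
        mul_le_mul_of_nonneg_left hS (sq_nonneg _)
    _ ≤ D * (energy W (fun i => max (x i - c) 0) + energy W (fun i => max (c - x i) 0)) := by
        linarith
    _ ≤ D * energy W x := mul_le_mul_of_nonneg_left hE hD

end

/-! ### Deletion of a vertex and leave-one-out stability. -/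

section

variable {V : Type*}

theorem sq_mul_sum_sq_le [Fintype V] {a : ℝ} (ha : 0 ≤ a) (y ζ : V → ℝ)
    (h : a * ∑ i, y i ^ 2 ≤ 2 * ∑ i, y i * ζ i) : a ^ 2 * ∑ i, y i ^ 2 ≤ 4 * ∑ i, ζ i ^ 2 := by
  set A : ℝ := ∑ i, y i ^ 2
  have hA : 0 ≤ A := Finset.sum_nonneg fun i _ => sq_nonneg _
  have hB : 0 ≤ ∑ i, ζ i ^ 2 := Finset.sum_nonneg fun i _ => sq_nonneg _
  have hCS := Finset.sum_mul_sq_le_sq_mul_sq Finset.univ y ζ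
  have h2 : (a * A) ^ 2 ≤ 4 * (A * ∑ i, ζ i ^ 2) := by
    calc (a * A) ^ 2 ≤ (2 * ∑ i, y i * ζ i) ^ 2 := pow_le_pow_left₀ (by positivity) h 2
      _ = 4 * (∑ i, y i * ζ i) ^ 2 := by ring
      _ ≤ _ := by linarith
  rcases hA.eq_or_lt with h0 | h0
  · rw [← h0]; linarith
  · refine le_of_mul_le_mul_left ?_ h0
    linarith [h2, show (a * A) ^ 2 = A * (a ^ 2 * A) by ring]

/-- The network with all edges at the vertex `m` removed. -/
def isolate [DecidableEq V] (W : V → V → ℝ) (m i j : V) : ℝ := if i = m ∨ j = m then 0 else W i j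

section isolate

variable [DecidableEq V]

theorem isolate_symm {W : V → V → ℝ} (hW : ∀ i j, W j i = W i j) (m i j : V) :
    isolate W m j i = isolate W m i j := by
  simp only [isolate, hW i j, or_comm]

theorem isolate_nonneg {W : V → V → ℝ} (hW0 : ∀ i j, 0 ≤ W i j) (m i j : V) :
    0 ≤ isolate W m i j := by
  unfold isolate; split_ifs; exacts [le_rfl, hW0 i j]

theorem isolate_self (W : V → V → ℝ) (m j : V) : isolate W m m j = 0 := by simp [isolate]

theorem sum_isolate_mul [Fintype V] (W : V → V → ℝ) {m i : V} (hi : i ≠ m) (f : V → ℝ) :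
    ∑ j, isolate W m i j * f j = ∑ j, W i j * f j - W i m * f m := by
  rw [eq_sub_iff_add_eq, ← Finset.sum_erase_add _ _ (Finset.mem_univ m),
    ← Finset.sum_erase_add Finset.univ (fun j => W i j * f j) (Finset.mem_univ m)]
  have : isolate W m i m = 0 := by simp [isolate]
  rw [this, zero_mul, add_zero]
  congr 1
  refine Finset.sum_congr rfl fun j hj => ?_
  simp [isolate, hi, Finset.ne_of_mem_erase hj]

/-- Since `x m = 0`, a deleted edge `{i, m}` carries energy at most `x i ^ 2` in each orientation,
so deletion costs only `2` in the Poincaré constant. -/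
theorem poincare_isolate [Fintype V] {W : V → V → ℝ} (hW0 : ∀ i j, 0 ≤ W i j)
    (hW1 : ∀ i j, W i j ≤ 1) {lam : ℝ}
    (hP : ∀ x : V → ℝ, ∑ i, x i = 0 → lam * ∑ i, x i ^ 2 ≤ energy W x) (m : V)
    (x : V → ℝ) (hm : x m = 0) (hx : ∑ i, x i = 0) :
    (lam - 2) * ∑ i, x i ^ 2 ≤ energy (isolate W m) x := by
  have h1 : energy W x ≤ energy (isolate W m) x + 2 * ∑ i, x i ^ 2 := by
    have key : ∀ i j, W i j * (x i - x j) ^ 2 ≤ isolate W m i j * (x i - x j) ^ 2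
        + ((if i = m then x j ^ 2 else 0) + (if j = m then x i ^ 2 else 0)) := fun i j => by
      by_cases hi : i = m
      · subst hi
        rw [isolate_self, hm, if_pos rfl]
        have : W i j * (0 - x j) ^ 2 ≤ 1 * x j ^ 2 := by
          rw [zero_sub, neg_sq]; exact mul_le_mul_of_nonneg_right (hW1 i j) (sq_nonneg _)
        have h2 : 0 ≤ if j = i then (0 : ℝ) ^ 2 else 0 := by split_ifs <;> norm_num
        linarith
      · by_cases hj : j = m
        · subst hj
          rw [hm, if_neg hi, if_pos rfl]
          have : W i j * (x i - 0) ^ 2 ≤ 1 * x i ^ 2 := by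
            rw [sub_zero]; exact mul_le_mul_of_nonneg_right (hW1 i j) (sq_nonneg _)
          have h2 := mul_nonneg (isolate_nonneg hW0 j i j) (sq_nonneg (x i - 0))
          linarith
        · simp [isolate, hi, hj]
    calc energy W x ≤ ∑ i, ∑ j, (isolate W m i j * (x i - x j) ^ 2
        + ((if i = m then x j ^ 2 else 0) + (if j = m then x i ^ 2 else 0))) :=
          Finset.sum_le_sum fun i _ => Finset.sum_le_sum fun j _ => key i j
      _ = energy (isolate W m) x + 2 * ∑ i, x i ^ 2 := by
          simp only [Finset.sum_add_distrib, energy]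
          rw [Finset.sum_comm (f := fun i j => if i = m then x j ^ 2 else 0)]
          simp only [Finset.sum_ite_eq', Finset.mem_univ, if_true]
          ring
  have h2 := hP x hx
  linarith

end isolate

/-- Test the equation with `y` itself: monotonicity against the zero potential and Poincaré give `c
* lam * ‖y‖² ≤ 2 ⟨y, ζ⟩`. -/
theorem sum_sq_le_of_flow_isolate [Fintype V] [DecidableEq V] {c : ℝ} (hc : 0 < c)
    {g : V → V → ℝ → ℝ} (hg : IsLink c g) {W : V → V → ℝ} (hW : ∀ i j, W j i = W i j)
    (hW0 : ∀ i j, 0 ≤ W i j) {lam : ℝ} (hlam : 0 ≤ lam) {m : V}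
    (hP : ∀ x : V → ℝ, x m = 0 → ∑ i, x i = 0 →
      lam * ∑ i, x i ^ 2 ≤ energy (isolate W m) x)
    {y ζ : V → ℝ} (hym : y m = 0) (hy0 : ∑ i, y i = 0)
    (hy : ∀ i, i ≠ m → flow (isolate W m) g y i = ζ i) {b : ℝ} (hζ : ∀ i, |ζ i| ≤ b) :
    (c * lam) ^ 2 * ∑ i, y i ^ 2 ≤ 4 * (Fintype.card V * b ^ 2) := by
  have h1 := hg.mul_energy_le (isolate_symm hW m) (isolate_nonneg hW0 m) y 0
  have h2 : ∀ i, (y i - (0 : V → ℝ) i) *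
      (flow (isolate W m) g y i - flow (isolate W m) g 0 i) = y i * ζ i := fun i => by
    by_cases hi : i = m
    · simp [hi, hym]
    · have : flow (isolate W m) g 0 i = 0 :=
        Finset.sum_eq_zero fun j _ => by simp [hg.map_zero]
      rw [this, hy i hi]; simp
  rw [Finset.sum_congr rfl fun i _ => h2 i, sub_zero] at h1
  have h3 := mul_le_mul_of_nonneg_left (hP y hym hy0) hc.le
  refine (sq_mul_sum_sq_le (by positivity) y ζ (by linarith)).trans ?_
  have h4 : ∑ i, ζ i ^ 2 ≤ ∑ _i : V, b ^ 2 := Finset.sum_le_sum fun i _ => by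
    rw [← sq_abs]; exact pow_le_pow_left₀ (abs_nonneg _) (hζ i) 2
  simp only [Finset.sum_const, nsmul_eq_mul, Finset.card_univ] at h4
  linarith

/-- Away from `m`, deleting `m` changes the potential by a constant and an `ℓ²`-small vector. -/
theorem sum_sq_sub_le_of_flow_isolate [Fintype V] [DecidableEq V] {c : ℝ} (hc : 0 < c)
    {g : V → V → ℝ → ℝ} (hg : IsLink c g) {W : V → V → ℝ} (hW : ∀ i j, W j i = W i j)
    (hW01 : ∀ i j, W i j = 0 ∨ W i j = 1) (hn : 2 ≤ Fintype.card V)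
    {lam D : ℝ} (hlam : 0 ≤ lam) {m : V} (hdeg : ∑ j, W m j ≤ D)
    (hP : ∀ x : V → ℝ, x m = 0 → ∑ i, x i = 0 →
      lam * ∑ i, x i ^ 2 ≤ energy (isolate W m) x)
    {ε : V → V → ℝ} {δ y : V → ℝ} (hδ0 : ∑ i, δ i = 0)
    (hδ : ∀ i, flow W g δ i = ∑ j, W i j * ε i j)
    (hym : y m = 0) (hy0 : ∑ i, y i = 0)
    (hy : ∀ i, i ≠ m → flow (isolate W m) g y i = ∑ j, isolate W m i j * ε i j)
    {b M : ℝ} (hb : ∀ i j, |ε i j| ≤ b) (hM : ∀ i, |δ i| ≤ M) :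
    ∃ (s : ℝ) (v : V → ℝ), |s| ≤ 2 * M / Fintype.card V ∧ (∀ i, i ≠ m → δ i = y i + v i + s) ∧
      (c * lam) ^ 2 * ∑ i, v i ^ 2 ≤ 4 * (D * (b + 2 * M) ^ 2) := by
  have hW0 : ∀ i j, 0 ≤ W i j := fun i j => by rcases hW01 i j with h | h <;> simp [h]
  have hn' : (2 : ℝ) ≤ Fintype.card V := by exact_mod_cast hn
  have hM0 : 0 ≤ M := (abs_nonneg _).trans (hM m)
  have hb0 : 0 ≤ b := (abs_nonneg _).trans (hb m m)
  set n : ℝ := (Fintype.card V : ℝ) with hnd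
  -- The mean of `δ` over the vertices other than `m`, because `δ` sums to zero. Subtracting it
  -- makes `v` centered.
  let s : ℝ := -δ m / (n - 1)
  let v : V → ℝ := fun i => if i = m then 0 else δ i - y i - s
  let h : V → ℝ := fun i => flow (isolate W m) g δ i - flow (isolate W m) g y i
  have hm0 : ∀ x : V → ℝ, flow (isolate W m) g x m = 0 := fun x =>
    Finset.sum_eq_zero fun j _ => by rw [isolate_self, zero_mul]
  have hhm : h m = 0 := by simp only [h, hm0, sub_self]
  have hsum : ∑ i, h i = 0 := by
    simp only [h, Finset.sum_sub_distrib, hg.sum_flow (isolate_symm hW m), sub_self]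
  -- The two deleted flows differ only by what the edge to `m` contributed, so `h` lives on the
  -- neighbours of `m` and `∑ i, h i ^ 2` is at most degree times `(b + 2 * M) ^ 2`.
  have hhi : ∀ i, i ≠ m → h i = W i m * (ε i m - g i m (δ i - δ m)) := fun i hi => by
    simp only [h]
    rw [hy i hi, flow, sum_isolate_mul W hi (fun j => g i j (δ i - δ j)),
      sum_isolate_mul W hi (fun j => ε i j)]
    have := hδ i
    rw [flow] at this
    rw [this]; ring
  have hvm : v m = 0 := by simp [v]
  have hvs : ∑ i, v i = 0 := by
    have e : ∀ i, v i = δ i - y i - s + if i = m then s - δ m else 0 := fun i => by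
      by_cases hi : i = m
      · subst hi; simp [v, hym]
      · simp [v, hi]
    rw [Finset.sum_congr rfl fun i _ => e i, Finset.sum_add_distrib, Finset.sum_sub_distrib,
      Finset.sum_sub_distrib, hδ0, hy0]
    simp only [Finset.sum_const, nsmul_eq_mul, Finset.card_univ, Finset.sum_ite_eq',
      Finset.mem_univ, if_true, ← hnd, s]
    have : n - 1 ≠ 0 := by linarith
    field_simp
    ring
  have hvE : energy (isolate W m) v = energy (isolate W m) (δ - y) := by
    refine Finset.sum_congr rfl fun i _ => Finset.sum_congr rfl fun j _ => ?_
    by_cases hi : i = m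
    · simp [isolate, hi]
    · by_cases hj : j = m
      · simp [isolate, hj]
      · simp only [v, hi, hj, if_false, Pi.sub_apply]; ring
  have h1 := hg.mul_energy_le (isolate_symm hW m) (isolate_nonneg hW0 m) δ y
  have h2 : ∑ i, (δ i - y i) * h i = ∑ i, v i * h i := by
    have e : ∀ i, (δ i - y i) * h i = v i * h i + s * h i := fun i => by
      by_cases hi : i = m
      · simp [hi, hhm]
      · simp only [v, hi, if_false]; ring
    rw [Finset.sum_congr rfl fun i _ => e i, Finset.sum_add_distrib, ← Finset.mul_sum, hsum]
    ring
  have h3 := mul_le_mul_of_nonneg_left (hP v hvm hvs) hc.le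
  have h1' : c * energy (isolate W m) v ≤ 2 * ∑ i, v i * h i := by rw [hvE, ← h2]; exact h1
  refine ⟨s, v, ?_, fun i hi => by simp only [v, hi, if_false]; ring, ?_⟩
  · rw [abs_div, abs_neg, abs_of_pos (by linarith : 0 < n - 1),
      div_le_div_iff₀ (by linarith) (by linarith)]
    nlinarith [hM m]
  refine (sq_mul_sum_sq_le (by positivity) v h (by linarith)).trans ?_
  refine mul_le_mul_of_nonneg_left ?_ (by norm_num)
  have h4 : ∀ i, h i ^ 2 ≤ W m i * (b + 2 * M) ^ 2 := fun i => by
    by_cases hi : i = m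
    · subst hi
      rw [hhm]; nlinarith [mul_nonneg (hW0 i i) (sq_nonneg (b + 2 * M))]
    · rw [hhi i hi, hW m i, mul_pow]
      have h5 : |ε i m - g i m (δ i - δ m)| ≤ b + 2 * M := by
        refine (abs_sub _ _).trans ?_
        have h6 := hg.abs_le hc.le i m (δ i - δ m)
        have h7 := abs_sub (δ i) (δ m)
        linarith [hb i m, hM i, hM m]
      have h8 : (ε i m - g i m (δ i - δ m)) ^ 2 ≤ (b + 2 * M) ^ 2 := by
        rw [← sq_abs]; exact pow_le_pow_left₀ (abs_nonneg _) h5 2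
      rcases hW01 m i with h | h <;> rw [h] <;> simp
      exact h8
  refine (Finset.sum_le_sum fun i _ => h4 i).trans ?_
  rw [← Finset.sum_mul]
  exact mul_le_mul_of_nonneg_right hdeg (sq_nonneg _)

/-- On each edge compare the response at `δ m - δ j` with that at `-δ j`: the difference is at least
`c * |δ m|` in the direction of `δ m`, and the latter is at most `|δ j|` in size. -/
theorem IsLink.mul_degree_mul_abs_le [Fintype V] {c : ℝ} {g : V → V → ℝ → ℝ}
    (hg : IsLink c g) (hc : 0 ≤ c) {W : V → V → ℝ} (hW0 : ∀ i j, 0 ≤ W i j) (δ : V → ℝ) (m : V) :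
    c * (∑ j, W m j) * |δ m| ≤ |flow W g δ m| + ∑ j, W m j * |δ j| := by
  rw [flow]
  rcases le_total 0 (δ m) with hp | hp
  · have : c * (∑ j, W m j) * |δ m| - ∑ j, W m j * |δ j| ≤ ∑ j, W m j * g m j (δ m - δ j) := by
      rw [abs_of_nonneg hp, mul_comm c, mul_assoc, Finset.sum_mul,
        ← Finset.sum_sub_distrib]
      refine Finset.sum_le_sum fun j _ => ?_
      rw [← mul_sub]
      refine mul_le_mul_of_nonneg_left ?_ (hW0 m j)
      have h1 := hg.le_slope m j (-δ j) (δ m - δ j) (by linarith)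
      have h2 := (_root_.abs_le.1 (hg.abs_le hc m j (-δ j))).1
      rw [abs_neg] at h2
      linarith [show c * (δ m - δ j - -δ j) = c * δ m by ring]
    linarith [le_abs_self (∑ j, W m j * g m j (δ m - δ j))]
  · have : c * (∑ j, W m j) * |δ m| - ∑ j, W m j * |δ j| ≤ -∑ j, W m j * g m j (δ m - δ j) := by
      rw [abs_of_nonpos hp, mul_comm c, mul_assoc, Finset.sum_mul,
        ← Finset.sum_sub_distrib, ← Finset.sum_neg_distrib]
      refine Finset.sum_le_sum fun j _ => ?_
      rw [← mul_sub, ← mul_neg]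
      refine mul_le_mul_of_nonneg_left ?_ (hW0 m j)
      have h1 := hg.le_slope m j (δ m - δ j) (-δ j) (by linarith)
      have h2 := (_root_.abs_le.1 (hg.abs_le hc m j (-δ j))).2
      rw [abs_neg] at h2
      linarith [show c * (-δ j - (δ m - δ j)) = c * -δ m by ring]
    linarith [neg_abs_le (∑ j, W m j * g m j (δ m - δ j))]

set_option maxHeartbeats 1000000 in
/-- Leave-one-out stability: for a network on an expander, if each potential obtained by deleting a
vertex `m` behaves along the deleted edges as if it were independent of them, then the potential
with flow `∑ j, W i j * ε i j` is uniformly small. -/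
theorem abs_le_of_leaveOneOut [Fintype V] [DecidableEq V] {c : ℝ} (hc : 0 < c) (hc1 : c ≤ 1)
    {g : V → V → ℝ → ℝ} (hg : IsLink c g) {W : V → V → ℝ} (hW : ∀ i j, W j i = W i j)
    (hW01 : ∀ i j, W i j = 0 ∨ W i j = 1) (hWd : ∀ i, W i i = 0) {N K R ℓ : ℝ}
    (hn : 2 ≤ Fintype.card V) (hNn : N ≤ Fintype.card V)
    (hN : 4 * (1536 / c) ^ 2 ≤ N) (hK : 0 ≤ K) (hR : 0 ≤ R) (hℓ : 96 * ℓ ≤ c * N)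
    (hdeg : ∀ i, ∑ j, W i j ≤ 3 * N) (hdeg' : ∀ i, N / 8 ≤ ∑ j, W i j)
    (hP : ∀ x : V → ℝ, ∑ i, x i = 0 → N / 192 * ∑ i, x i ^ 2 ≤ energy W x)
    {ε : V → V → ℝ} (hε : ∀ i j, |ε i j| ≤ K * √N * R)
    (hξ : ∀ i, |∑ j, W i j * ε i j| ≤ K * N * R)
    {δ : V → ℝ} (hδ0 : ∑ i, δ i = 0) (hδ : ∀ i, flow W g δ i = ∑ j, W i j * ε i j)
    (hloo : ∀ m, ∃ y : V → ℝ, y m = 0 ∧ ∑ i, y i = 0 ∧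
      (∀ i, i ≠ m → flow (isolate W m) g y i = ∑ j, isolate W m i j * ε i j) ∧
      ∀ B, (∀ j, |y j| ≤ B) →
        ∑ j, W m j * |y j| ≤ 2 * (N / Fintype.card V) * ∑ j, |y j| + ℓ * B) (i : V) :
    |δ i| ≤ 16 * K / c * (1 + 5 * (1536 / c)) * R := by
  -- `1536 = 4 * 384`: the monotonicity constant after deletion is `c * (N / 384)`, so `a / N` is
  -- four times its inverse.
  set a : ℝ := 1536 / c with ha
  have hac : a * c = 1536 := by rw [ha]; field_simp
  have ha0 : 1536 ≤ a := by rw [ha, le_div_iff₀ hc]; linarith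
  have hN0 : 0 < N := lt_of_lt_of_le (by positivity) hN
  have ha2 : (1536 : ℝ) ^ 2 ≤ a ^ 2 := pow_le_pow_left₀ (by norm_num) ha0 2
  have hN1 : 1 ≤ N := by linarith
  have hsN : 0 < √N := Real.sqrt_pos.2 hN0
  have hsq : √N ^ 2 = N := Real.sq_sqrt hN0.le
  have hsN1 : 1 ≤ √N := by rw [Real.one_le_sqrt]; exact hN1
  have hsNN : √N ≤ N := (le_self_pow₀ hsN1 two_ne_zero).trans hsq.le
  have h2a : 2 * a ≤ √N := by
    refine Real.le_sqrt_of_sq_le ?_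
    linarith [hN, show (2 * a) ^ 2 = 4 * a ^ 2 by ring]
  have hW0 : ∀ i j, 0 ≤ W i j := fun i j => by rcases hW01 i j with h | h <;> simp [h]
  have hW1 : ∀ i j, W i j ≤ 1 := fun i j => by rcases hW01 i j with h | h <;> simp [h]
  set n : ℝ := (Fintype.card V : ℝ) with hnd
  have hn' : (2 : ℝ) ≤ n := by rw [hnd]; exact_mod_cast hn
  have hN768 : 768 ≤ N := by linarith
  obtain ⟨m, -, hm⟩ := Finset.exists_max_image Finset.univ (fun i => |δ i|) ⟨i, Finset.mem_univ i⟩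
  set M : ℝ := |δ m| with hMd
  have hM : ∀ i, |δ i| ≤ M := fun i => hm i (Finset.mem_univ i)
  have hM0 : 0 ≤ M := abs_nonneg _
  refine (hM i).trans ?_
  -- The loss of `2` is affordable because `N / 192 - 2 ≥ N / 384` once `N ≥ 768`.
  have hP' : ∀ x : V → ℝ, x m = 0 → ∑ i, x i = 0 →
      N / 384 * ∑ i, x i ^ 2 ≤ energy (isolate W m) x := fun x hx hx0 => by
    refine le_trans ?_ (poincare_isolate hW0 hW1 hP m x hx hx0)
    refine mul_le_mul_of_nonneg_right ?_ (Finset.sum_nonneg fun i _ => sq_nonneg _)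
    linarith
  obtain ⟨y, hym, hy0, hy, hrow⟩ := hloo m
  have hcl : (c * (N / 384)) ^ 2 * (16 * a ^ 2) = (4 * 4 * N) ^ 2 := by
    have : c * (N / 384) * (4 * a) = 4 * 4 * N := by
      calc c * (N / 384) * (4 * a) = a * c * N / 96 := by ring
        _ = _ := by rw [hac]; ring
    rw [← this]; ring
  have hclpos : 0 < (c * (N / 384)) ^ 2 := by positivity
  -- the `ℓ¹` norm of the leave-one-out potential
  have hyl1 : ∑ j, |y j| ≤ n * (K * a * R) := by
    have hζ : ∀ i, |(fun i => if i = m then 0 else ∑ j, isolate W m i j * ε i j) i|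
        ≤ 2 * K * N * R := fun i => by
      have hKNR : 0 ≤ K * N * R := by positivity
      by_cases hi : i = m
      · simp only [hi, if_true, abs_zero]; linarith
      · simp only [hi, if_false]
        rw [sum_isolate_mul W hi]
        refine (abs_sub _ _).trans ?_
        have h1 : |W i m * ε i m| ≤ K * N * R := by
          rw [abs_mul, abs_of_nonneg (hW0 i m)]
          calc W i m * |ε i m| ≤ 1 * |ε i m| :=
                mul_le_mul_of_nonneg_right (hW1 _ _) (abs_nonneg _)
            _ ≤ K * √N * R := by rw [one_mul]; exact hε i m
            _ ≤ K * N * R := by gcongr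
        linarith [hξ i]
    have h1 := sum_sq_le_of_flow_isolate hc hg hW hW0 (by positivity) hP' hym hy0
      (ζ := fun i => if i = m then 0 else ∑ j, isolate W m i j * ε i j)
      (fun i hi => by simp only [hi, if_false]; exact hy i hi) hζ
    have h2 : ∑ i, y i ^ 2 ≤ n * (K * a * R) ^ 2 := by
      refine le_of_mul_le_mul_left (h1.trans ?_) hclpos
      have : (c * (N / 384)) ^ 2 * (n * (K * a * R) ^ 2)
          = n * (K * R) ^ 2 * ((c * (N / 384)) ^ 2 * (16 * a ^ 2)) / 16 := by ring
      rw [this, hcl]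
      refine le_of_eq ?_
      ring
    have h3 : (∑ j, |y j|) ^ 2 ≤ n * ∑ j, |y j| ^ 2 := by
      have := sq_sum_le_card_mul_sum_sq (s := Finset.univ) (f := fun j => |y j|)
      simpa [hnd, Finset.card_univ] using this
    simp only [sq_abs] at h3
    refine le_of_sq_le_sq ?_ (by positivity)
    have h4 := mul_le_mul_of_nonneg_left h2 (by linarith : 0 ≤ n)
    linarith [show (n * (K * a * R)) ^ 2 = n * (n * (K * a * R) ^ 2) by ring]
  obtain ⟨s, v, hs, hdec, hv⟩ := sum_sq_sub_le_of_flow_isolate hc hg hW hW01 hn (by positivity)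
    (hdeg m) hP' hδ0 hδ hym hy0 hy hε hM
  have hv2 : N * ∑ i, v i ^ 2 ≤ (a * (K * √N * R + 2 * M)) ^ 2 := by
    refine le_of_mul_le_mul_left ?_ hclpos
    have e : (c * (N / 384)) ^ 2 * (a * (K * √N * R + 2 * M)) ^ 2
        = (K * √N * R + 2 * M) ^ 2 * ((c * (N / 384)) ^ 2 * (16 * a ^ 2)) / 16 := by ring
    rw [e, hcl]
    have h1 := mul_le_mul_of_nonneg_left hv hN0.le
    have h2 : 0 ≤ (N * (K * √N * R + 2 * M)) ^ 2 := by positivity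
    linarith
  have hvi : ∀ i, √N * |v i| ≤ a * (K * √N * R + 2 * M) := fun i => by
    refine le_of_sq_le_sq ?_ (by positivity)
    rw [mul_pow, hsq, sq_abs]
    refine le_trans (mul_le_mul_of_nonneg_left ?_ hN0.le) hv2
    exact Finset.single_le_sum (f := fun i => v i ^ 2) (fun i _ => sq_nonneg _)
      (Finset.mem_univ i)
  have hvi' : ∀ i, |v i| ≤ a * K * R + M := fun i => by
    refine le_of_mul_le_mul_left ((hvi i).trans ?_) hsN
    have := mul_le_mul_of_nonneg_right h2a hM0
    linarith
  -- Cauchy–Schwarz over the at most `3N` neighbours of `m`; the factor `√N` it costs is offset by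
  -- the `ℓ²` smallness of `v`.
  have hvrow : ∑ j, W m j * |v j| ≤ 2 * (a * (K * √N * R + 2 * M)) := by
    have hCS := Finset.sum_sq_le_sum_mul_sum_of_sq_le_mul (Finset.univ : Finset V)
      (r := fun j => W m j * |v j|) (f := fun j => W m j) (g := fun j => v j ^ 2)
      (fun j _ => hW0 m j) (fun j _ => sq_nonneg _) (fun j _ => by
        rw [mul_pow, sq_abs]
        rcases hW01 m j with h | h <;> rw [h] <;> simp)
    refine le_of_sq_le_sq ?_ (by positivity)
    have hv0 : 0 ≤ ∑ i, v i ^ 2 := Finset.sum_nonneg fun i _ => sq_nonneg _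
    have h1 := mul_le_mul_of_nonneg_right (hdeg m) hv0
    have h2 : 0 ≤ (a * (K * √N * R + 2 * M)) ^ 2 := sq_nonneg _
    linarith [show (2 * (a * (K * √N * R + 2 * M))) ^ 2
      = 4 * (a * (K * √N * R + 2 * M)) ^ 2 by ring]
  have hs' : |s| ≤ M := hs.trans (by
    rw [div_le_iff₀ (by linarith)]; linarith [mul_le_mul_of_nonneg_left hn' hM0])
  have hyB : ∀ j, |y j| ≤ 3 * M + a * K * R := fun j => by
    by_cases hj : j = m
    · rw [hj, hym, abs_zero]; positivity
    · have e : y j = δ j - v j - s := by rw [hdec j hj]; ring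
      rw [e]
      have h1 := abs_sub (δ j - v j) s
      have h2 := abs_sub (δ j) (v j)
      linarith [hM j, hvi' j]
  have hrow' := hrow _ hyB
  have hδrow : ∑ j, W m j * |δ j| ≤ ∑ j, W m j * |y j| + ∑ j, W m j * |v j|
      + (∑ j, W m j) * |s| := by
    rw [Finset.sum_mul, ← Finset.sum_add_distrib, ← Finset.sum_add_distrib]
    refine Finset.sum_le_sum fun j _ => ?_
    by_cases hj : j = m
    · rw [hj, hWd]; simp
    · rw [hdec j hj, ← mul_add, ← mul_add]
      refine mul_le_mul_of_nonneg_left ?_ (hW0 m j)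
      exact (abs_add_le _ _).trans (add_le_add_left (abs_add_le _ _) _)
  -- the balance of flow at `m`
  have hbal : c * (N / 8) * M ≤ K * N * R + ∑ j, W m j * |δ j| := by
    have hA := hg.mul_degree_mul_abs_le hc.le hW0 δ m
    rw [hδ m] at hA
    have h1 : c * (N / 8) * M ≤ c * (∑ j, W m j) * M := by
      have := hdeg' m
      gcongr
    linarith [hξ m]
  have hp1 : 2 * (N / n) * ∑ j, |y j| ≤ 2 * N * (K * a * R) := by
    calc 2 * (N / n) * ∑ j, |y j| ≤ 2 * (N / n) * (n * (K * a * R)) := by gcongr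
      _ = _ := by field_simp
  have hsr : (∑ j, W m j) * |s| ≤ 6 * M := by
    calc (∑ j, W m j) * |s| ≤ (3 * N) * (2 * M / n) := by
          have := hdeg m
          gcongr
      _ = 6 * M * (N / n) := by ring
      _ ≤ 6 * M * 1 := by
          gcongr
          rw [div_le_one (by linarith)]; exact hNn
      _ = _ := by ring
  have hℓN : ℓ ≤ N := by linarith [mul_le_mul_of_nonneg_right hc1 hN0.le]
  have hKaR : 0 ≤ a * K * R := by positivity
  have hℓ' : ℓ * (3 * M + a * K * R) ≤ c * N / 32 * M + N * (a * K * R) := by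
    have h1 := mul_le_mul_of_nonneg_right hℓ hM0
    have h2 := mul_le_mul_of_nonneg_right hℓN hKaR
    linarith
  have hvr : 2 * (a * (K * √N * R + 2 * M)) ≤ 2 * (a * K * R) * N + 4 * a * M := by
    have := mul_le_mul_of_nonneg_left hsNN hKaR
    linarith
  -- Absorption of `M`: the terms from `ℓ`, from `v` and from `s` are `c * N / 32`, `4 * a` and `6`
  -- times `M`, together at most half of the `c * N / 8` on the left.
  have hcN : 4 * a + 6 ≤ c * N / 32 := by
    have : c * (4 * a ^ 2) ≤ c * N := mul_le_mul_of_nonneg_left hN hc.le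
    have e : c * (4 * a ^ 2) = 6144 * a := by
      calc c * (4 * a ^ 2) = 4 * (a * c) * a := by ring
        _ = _ := by rw [hac]; ring
    linarith
  have hcNM := mul_le_mul_of_nonneg_right hcN hM0
  have hfin : c * N / 16 * M ≤ N * (K * R + 5 * (a * K * R)) := by linarith
  have : M ≤ 16 / c * (K * R + 5 * (a * K * R)) := by
    refine le_of_mul_le_mul_left ?_ (by positivity : 0 < c * N / 16)
    refine hfin.trans (le_of_eq ?_)
    field_simp
  refine this.trans (le_of_eq ?_)
  ring

end

/-! ### The logistic function -/

theorem sigmoid_mul_one_sub_le (x : ℝ) : Real.sigmoid x * (1 - Real.sigmoid x) ≤ 1 / 4 := by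
  nlinarith [sq_nonneg (Real.sigmoid x - 1 / 2)]

theorem exp_neg_div_four_le {B x : ℝ} (hx : |x| ≤ B) :
    Real.exp (-B) / 4 ≤ Real.sigmoid x * (1 - Real.sigmoid x) := by
  have key : ∀ z : ℝ, 0 ≤ z → z ≤ B →
      Real.exp (-B) / 4 ≤ Real.sigmoid z * (1 - Real.sigmoid z) := by
    intro z hz hzB
    have hE : Real.exp (-B) ≤ Real.exp (-z) := Real.exp_le_exp.2 (by linarith)
    have hE1 : Real.exp (-z) ≤ 1 := Real.exp_le_one_iff.2 (by linarith)
    have hp := Real.exp_pos (-z)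
    rw [← Real.sigmoid_neg, ← Real.sigmoid_mul_rexp_neg, Real.sigmoid_def]
    set t := Real.exp (-z)
    have : (1 + t)⁻¹ * ((1 + t)⁻¹ * t) = t / (1 + t) ^ 2 := by field_simp
    rw [this, div_le_div_iff₀ (by norm_num) (by positivity)]
    nlinarith [mul_nonneg hp.le (sub_nonneg.2 hE1)]
  rcases le_total 0 x with h | h
  · exact key x h (by rwa [abs_of_nonneg h] at hx)
  · have := key (-x) (by linarith) (by rwa [abs_of_nonpos h] at hx)
    rw [Real.sigmoid_neg] at this
    linarith

theorem le_sigmoid_sub {B s t : ℝ} (hs : -B ≤ s) (ht : t ≤ B) (hst : s ≤ t) :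
    Real.exp (-B) / 4 * (t - s) ≤ Real.sigmoid t - Real.sigmoid s := by
  refine (convex_Icc (-B) B).mul_sub_le_image_sub_of_le_deriv
    _root_.continuous_sigmoid.continuousOn _root_.differentiable_sigmoid.differentiableOn
    (fun x hx => ?_) s ⟨hs, hst.trans ht⟩ t ⟨hs.trans hst, ht⟩ hst
  rw [interior_Icc] at hx
  rw [Real.deriv_sigmoid]
  exact exp_neg_div_four_le (abs_le.2 ⟨hx.1.le, hx.2.le⟩)

theorem sigmoid_sub_le {s t : ℝ} (hst : s ≤ t) :
    Real.sigmoid t - Real.sigmoid s ≤ t - s := by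
  have := convex_univ.image_sub_le_mul_sub_of_deriv_le (C := 1 / 4)
    _root_.continuous_sigmoid.continuousOn _root_.differentiable_sigmoid.differentiableOn
    (fun x _ => by rw [Real.deriv_sigmoid]; exact sigmoid_mul_one_sub_le x) s trivial t trivial hst
  linarith

/-- Strict convexity of the softplus function `log (1 + exp x)`, with derivative the sigmoid. -/
theorem softplus_add_lt {x x' : ℝ} (h : x' ≠ x) :
    Real.log (1 + Real.exp x) + Real.sigmoid x * (x' - x) < Real.log (1 + Real.exp x') := by
  set q := Real.sigmoid x with hq
  have hx := Real.exp_pos x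
  have hq' : q * (1 + Real.exp x) = Real.exp x := by
    rw [hq, Real.sigmoid_def, Real.exp_neg]; field_simp; ring
  -- Strict convexity of `exp` between `0` and `x' - x` with weights `1 - q` and `q`. Multiplying by
  -- `1 + exp x` and taking logarithms gives the tangent inequality.
  have hc := strictConvexOn_exp.2 (Set.mem_univ 0) (Set.mem_univ (x' - x))
    (sub_ne_zero.2 h).symm (sub_pos.2 (Real.sigmoid_lt_one x)) (Real.sigmoid_pos x) (by ring)
  simp only [smul_eq_mul, mul_zero, zero_add, Real.exp_zero, mul_one, ← hq] at hc
  have h1 : (1 + Real.exp x) * Real.exp (q * (x' - x)) < 1 + Real.exp x' := by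
    calc (1 + Real.exp x) * Real.exp (q * (x' - x))
        < (1 + Real.exp x) * (1 - q + q * Real.exp (x' - x)) :=
          mul_lt_mul_of_pos_left hc (by positivity)
      _ = 1 + Real.exp x - q * (1 + Real.exp x)
          + q * (1 + Real.exp x) * Real.exp (x' - x) := by ring
      _ = 1 + Real.exp x' := by rw [hq', ← Real.exp_add]; ring_nf
  rw [← Real.log_exp (q * (x' - x)), ← Real.log_mul (by positivity) (by positivity)]
  exact Real.log_lt_log (by positivity) h1

theorem exp_div_eq_sigmoid (a b : ℝ) :
    Real.exp a / (Real.exp a + Real.exp b) = Real.sigmoid (a - b) := by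
  rw [Real.sigmoid_def, neg_sub, Real.exp_sub]
  field_simp

theorem winProb_eq {n : ℕ} (θ : Fin n → ℝ) (i j : Fin n) :
    (winProb θ i j : ℝ) = Real.sigmoid (θ i - θ j) := exp_div_eq_sigmoid _ _

/-! ### The truncated logistic link -/

/-- The increment of the sigmoid at `x`, continued linearly with slope `c` outside `[-1, 1]`. -/
def truncLink {V : Type*} (c : ℝ) (θ : V → ℝ) (i j : V) (t : ℝ) : ℝ :=
  Real.sigmoid (θ i - θ j + max (-1) (min t 1)) - Real.sigmoid (θ i - θ j)
    + c * (t - max (-1) (min t 1))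

theorem clamp_sub_mem {s t : ℝ} (h : s ≤ t) :
    max (-1) (min s 1) ≤ max (-1) (min t 1) ∧
      max (-1) (min t 1) - max (-1) (min s 1) ≤ t - s := by
  constructor
  · exact max_le_max le_rfl (min_le_min h le_rfl)
  · rcases max_cases (-1) (min t 1) with ⟨h1, h1'⟩ | ⟨h1, h1'⟩ <;>
    rcases max_cases (-1) (min s 1) with ⟨h2, h2'⟩ | ⟨h2, h2'⟩ <;>
    rcases min_cases t 1 with ⟨h3, h3'⟩ | ⟨h3, h3'⟩ <;>
    rcases min_cases s 1 with ⟨h4, h4'⟩ | ⟨h4, h4'⟩ <;> linarith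

/-- The clamp keeps the argument of the sigmoid in `[-(b + 1), b + 1]`, where its derivative is at
least `exp (-(b + 1)) / 4`; outside, the linear continuation has exactly this slope. -/
theorem isLink_truncLink {V : Type*} {b : ℝ} {θ : V → ℝ} (hθ : ∀ i j, |θ i - θ j| ≤ b) :
    IsLink (Real.exp (-(b + 1)) / 4) (truncLink (Real.exp (-(b + 1)) / 4) θ) where
  antisymm i j t := by
    have hcl : max (-1) (min (-t) 1) = -max (-1) (min t 1) := by
      rcases max_cases (-1) (min (-t) 1) with ⟨h1, h1'⟩ | ⟨h1, h1'⟩ <;>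
      rcases max_cases (-1) (min t 1) with ⟨h2, h2'⟩ | ⟨h2, h2'⟩ <;>
      rcases min_cases (-t) 1 with ⟨h3, h3'⟩ | ⟨h3, h3'⟩ <;>
      rcases min_cases t 1 with ⟨h4, h4'⟩ | ⟨h4, h4'⟩ <;> linarith
    simp only [truncLink, hcl]
    have e1 : θ j - θ i + -max (-1) (min t 1) = -(θ i - θ j + max (-1) (min t 1)) := by ring
    have e2 : θ j - θ i = -(θ i - θ j) := by ring
    rw [e1, e2, Real.sigmoid_neg, Real.sigmoid_neg]
    ring
  map_zero i j := by simp [truncLink]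
  le_slope i j s t h := by
    obtain ⟨h1, h2⟩ := clamp_sub_mem h
    have hb := abs_le.1 (hθ i j)
    have h3 : max (-1) (min t 1) ≤ 1 := max_le (by norm_num) (min_le_right _ _)
    have h4 : -1 ≤ max (-1) (min s 1) := le_max_left _ _
    have := le_sigmoid_sub (B := b + 1) (s := θ i - θ j + max (-1) (min s 1))
      (t := θ i - θ j + max (-1) (min t 1)) (by linarith) (by linarith) (by linarith)
    simp only [truncLink]
    linarith
  slope_le i j s t h := by
    obtain ⟨h1, h2⟩ := clamp_sub_mem h
    have := sigmoid_sub_le (s := θ i - θ j + max (-1) (min s 1))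
      (t := θ i - θ j + max (-1) (min t 1)) (by linarith)
    have hb := (abs_nonneg _).trans (hθ i i)
    have hc : Real.exp (-(b + 1)) / 4 ≤ 1 := by
      have := Real.exp_le_one_iff.2 (by linarith : -(b + 1) ≤ 0)
      linarith
    have := mul_le_mul_of_nonneg_right hc (sub_nonneg.2 h2)
    simp only [truncLink]
    linarith

theorem truncLink_of_abs_le {V : Type*} (c : ℝ) (θ : V → ℝ) (i j : V) {t : ℝ} (ht : |t| ≤ 1) :
    truncLink c θ i j t = Real.sigmoid (θ i - θ j + t) - Real.sigmoid (θ i - θ j) := by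
  obtain ⟨h1, h2⟩ := abs_le.1 ht
  rw [truncLink, min_eq_left h2, max_eq_right h1]
  ring

/-! ### Functions on pairs -/

/-- The antisymmetric extension of a function on pairs. -/
def altExt {n : ℕ} (f : ItemPair n → ℝ) (i j : Fin n) : ℝ :=
  if h : j < i then f ⟨(i, j), h⟩ else if h : i < j then -f ⟨(j, i), h⟩ else 0

theorem altExt_antisymm {n : ℕ} (f : ItemPair n → ℝ) (i j : Fin n) :
    altExt f j i = -altExt f i j := by
  rcases lt_trichotomy i j with h | h | h
  · simp [altExt, h, h.not_gt]
  · subst h; simp [altExt]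
  · simp [altExt, h, h.not_gt]

theorem altExt_pair {n : ℕ} (f : ItemPair n → ℝ) (e : ItemPair n) :
    altExt f e.1.1 e.1.2 = f e := by simp [altExt, e.2]

theorem abs_altExt_le {n : ℕ} {f : ItemPair n → ℝ} {b : ℝ} (hb : 0 ≤ b) (hf : ∀ e, |f e| ≤ b)
    (i j : Fin n) : |altExt f i j| ≤ b := by
  unfold altExt
  split_ifs
  · exact hf _
  · rw [abs_neg]; exact hf _
  · simpa using hb

theorem sum_itemPair {n : ℕ} (h : Fin n → Fin n → ℝ) :
    ∑ e : ItemPair n, h e.1.1 e.1.2 = ∑ i, ∑ j, if j < i then h i j else 0 := by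
  rw [← Finset.sum_product' (f := fun i j => if j < i then h i j else 0), ← Finset.sum_filter]
  rw [← Finset.sum_subtype (Finset.univ.filter fun q : Fin n × Fin n => q.2 < q.1)
    (p := fun q => q.2 < q.1) (by simp) (fun q => h q.1 q.2)]
  rfl

theorem two_mul_sum_itemPair {n : ℕ} (h : Fin n → Fin n → ℝ) (hs : ∀ i j, h j i = h i j)
    (hd : ∀ i, h i i = 0) : 2 * ∑ e : ItemPair n, h e.1.1 e.1.2 = ∑ i, ∑ j, h i j := by
  have e1 : ∑ e : ItemPair n, h e.1.1 e.1.2 = ∑ i, ∑ j, if i < j then h i j else 0 := by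
    rw [sum_itemPair, Finset.sum_comm]
    exact Finset.sum_congr rfl fun i _ => Finset.sum_congr rfl fun j _ => by rw [hs]
  rw [two_mul]
  nth_rewrite 1 [sum_itemPair]
  rw [e1, ← Finset.sum_add_distrib]
  refine Finset.sum_congr rfl fun i _ => ?_
  rw [← Finset.sum_add_distrib]
  refine Finset.sum_congr rfl fun j _ => ?_
  rcases lt_trichotomy i j with h | h | h
  · simp [h, h.not_gt]
  · subst h; simp [hd]
  · simp [h, h.not_gt]

/-! ### The maximum likelihood estimate -/

/-- The average of the outcomes at a pair. -/
def meanOutcome {n L : ℕ} (y : ItemPair n → Fin L → Bool) (e : ItemPair n) : ℝ :=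
  1 / (L : ℝ) * ∑ l, if y e l then 1 else 0

/-- The centered average outcome, extended antisymmetrically. -/
def noise {n L : ℕ} (θ : Fin n → ℝ) (y : ItemPair n → Fin L → Bool) : Fin n → Fin n → ℝ :=
  altExt fun e => meanOutcome y e - Real.sigmoid (θ e.1.1 - θ e.1.2)

open Classical in
/-- The real adjacency matrix. -/
def adjW {n : ℕ} (G : SimpleGraph (Fin n)) (i j : Fin n) : ℝ := if G.Adj i j then 1 else 0

theorem adjW_symm {n : ℕ} (G : SimpleGraph (Fin n)) (i j : Fin n) : adjW G j i = adjW G i j := by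
  by_cases h : G.Adj i j
  · simp [adjW, h, h.symm]
  · simp [adjW, h, mt SimpleGraph.Adj.symm h]

theorem adjW_zero_or_one {n : ℕ} (G : SimpleGraph (Fin n)) (i j : Fin n) :
    adjW G i j = 0 ∨ adjW G i j = 1 := by
  unfold adjW; split_ifs <;> simp

theorem adjW_nonneg {n : ℕ} (G : SimpleGraph (Fin n)) (i j : Fin n) : 0 ≤ adjW G i j := by
  rcases adjW_zero_or_one G i j with h | h <;> simp [h]

theorem adjW_self {n : ℕ} (G : SimpleGraph (Fin n)) (i : Fin n) : adjW G i i = 0 := by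
  simp [adjW]

theorem negLogLik_observe {n L : ℕ} (hL : 1 ≤ L) (ω : Sample n L) (θ : Fin n → ℝ) :
    negLogLik (observe ω) θ = ∑ e : ItemPair n, adjW ω.1 e.1.1 e.1.2 *
      (Real.log (1 + Real.exp (θ e.1.1 - θ e.1.2))
        - meanOutcome ω.2 e * (θ e.1.1 - θ e.1.2)) := by
  have hL' : (L : ℝ) ≠ 0 := by positivity
  rw [negLogLik, Finset.mul_sum]
  refine Finset.sum_congr rfl fun e _ => ?_
  by_cases h : ω.1.Adj e.1.1 e.1.2
  · simp only [observe, adjW, h, if_true, Option.elim_some]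
    set a := θ e.1.1
    set b := θ e.1.2
    have hl : ∀ l, Real.log (if ω.2 e l then Real.exp a / (Real.exp a + Real.exp b)
        else Real.exp b / (Real.exp a + Real.exp b))
        = (if ω.2 e l then 1 else 0) * (a - b) - Real.log (1 + Real.exp (a - b)) := fun l => by
      have hs : Real.exp a + Real.exp b = Real.exp b * (1 + Real.exp (a - b)) := by
        rw [mul_add, ← Real.exp_add]; ring_nf
      have h1 : Real.log (Real.exp a + Real.exp b) = b + Real.log (1 + Real.exp (a - b)) := by
        rw [hs, Real.log_mul (Real.exp_pos b).ne' (by positivity), Real.log_exp]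
      split_ifs
      · rw [Real.log_div (Real.exp_pos a).ne' (by positivity), Real.log_exp, h1]; ring
      · rw [Real.log_div (Real.exp_pos b).ne' (by positivity), Real.log_exp, h1]; ring
    rw [Finset.sum_congr rfl fun l _ => hl l, Finset.sum_sub_distrib, ← Finset.sum_mul,
      meanOutcome]
    simp only [Finset.sum_const, Finset.card_univ, Fintype.card_fin, nsmul_eq_mul]
    field_simp
    ring
  · simp [observe, adjW, h]

/-- A centered solution of the score equations on a connected comparison graph is the unique
maximum likelihood estimate. -/
theorem isMLE_of_score_eq {n L : ℕ} (hL : 1 ≤ L) (ω : Sample n L) {θ θhat : Fin n → ℝ}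
    (h0 : ∑ i, θhat i = 0)
    (hscore : ∀ i, ∑ j, adjW ω.1 i j *
      (Real.sigmoid (θhat i - θhat j) - Real.sigmoid (θ i - θ j))
        = ∑ j, adjW ω.1 i j * noise θ ω.2 i j)
    (hconn : ∀ x : Fin n → ℝ, ∑ i, x i = 0 → energy (adjW ω.1) x = 0 → x = 0) :
    IsMLE (observe ω) θhat ∧ ∀ θ', IsMLE (observe ω) θ' → θ' = θhat := by
  set W := adjW ω.1 with hWd
  -- The Bregman divergence of softplus on the pair `e`: nonnegative, and zero only if `θ'` and
  -- `θhat` have the same difference there.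
  let gap : (Fin n → ℝ) → ItemPair n → ℝ := fun θ' e =>
    Real.log (1 + Real.exp (θ' e.1.1 - θ' e.1.2))
      - Real.log (1 + Real.exp (θhat e.1.1 - θhat e.1.2))
      - Real.sigmoid (θhat e.1.1 - θhat e.1.2)
        * ((θ' e.1.1 - θ' e.1.2) - (θhat e.1.1 - θhat e.1.2))
  have hgap0 : ∀ θ' e, 0 ≤ gap θ' e := fun θ' e => by
    by_cases h : θ' e.1.1 - θ' e.1.2 = θhat e.1.1 - θhat e.1.2
    · simp [gap, h]
    · have := softplus_add_lt h
      simp only [gap]; linarith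
  have hkey : ∀ θ', negLogLik (observe ω) θ' - negLogLik (observe ω) θhat
      = ∑ e : ItemPair n, W e.1.1 e.1.2 * gap θ' e := fun θ' => by
    -- The edgewise residual of the score equations is antisymmetric with zero row sums, so the
    -- first-order term of the likelihood at `θhat` vanishes after integration by parts.
    let H : Fin n → Fin n → ℝ := fun i j => W i j *
      (Real.sigmoid (θhat i - θhat j) - Real.sigmoid (θ i - θ j) - noise θ ω.2 i j)
    have hH : ∀ i j, H j i = -H i j := fun i j => by
      simp only [H]
      rw [hWd, adjW_symm, noise, altExt_antisymm, ← neg_sub (θhat i), ← neg_sub (θ i),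
        Real.sigmoid_neg, Real.sigmoid_neg]
      ring
    have hrow : ∀ i, ∑ j, H i j = 0 := fun i => by
      simp only [H, mul_sub, Finset.sum_sub_distrib]
      have := hscore i
      simp only [mul_sub, Finset.sum_sub_distrib] at this
      linarith
    have h1 := two_mul_sum_mul_antisymm (fun i => θ' i - θhat i) H hH
    simp only [hrow, mul_zero, Finset.sum_const_zero] at h1
    have h2 := two_mul_sum_itemPair
      (fun i j => H i j * ((θ' i - θhat i) - (θ' j - θhat j)))
      (fun i j => by rw [hH]; ring) (fun i => by ring)
    rw [← h1] at h2
    have h3 : ∑ e : ItemPair n, H e.1.1 e.1.2 *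
      ((θ' e.1.1 - θhat e.1.1) - (θ' e.1.2 - θhat e.1.2)) = 0 := by linarith
    rw [negLogLik_observe hL, negLogLik_observe hL, ← Finset.sum_sub_distrib,
      ← add_zero (∑ e : ItemPair n, W e.1.1 e.1.2 * gap θ' e), ← h3, ← Finset.sum_add_distrib]
    refine Finset.sum_congr rfl fun e _ => ?_
    simp only [H, gap, noise, altExt_pair, hWd]
    ring
  have hWn : ∀ i j, 0 ≤ W i j := adjW_nonneg ω.1
  refine ⟨⟨h0, fun θ' _ => ?_⟩, fun θ' hθ' => ?_⟩
  · have h1 := hkey θ'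
    have h2 : 0 ≤ ∑ e : ItemPair n, W e.1.1 e.1.2 * gap θ' e :=
      Finset.sum_nonneg fun e _ => mul_nonneg (hWn _ _) (hgap0 θ' e)
    linarith
  · have h1 := hkey θ'
    have h2 := hθ'.2 θhat h0
    have h3 : ∑ e : ItemPair n, W e.1.1 e.1.2 * gap θ' e = 0 :=
      le_antisymm (by linarith) (Finset.sum_nonneg fun e _ => mul_nonneg (hWn _ _) (hgap0 θ' e))
    have h4 := (Finset.sum_eq_zero_iff_of_nonneg
      (fun e _ => mul_nonneg (hWn _ _) (hgap0 θ' e))).1 h3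
    have h5 : ∀ e : ItemPair n, W e.1.1 e.1.2 *
        ((θ' - θhat) e.1.1 - (θ' - θhat) e.1.2) ^ 2 = 0 := fun e => by
      rcases mul_eq_zero.1 (h4 e (Finset.mem_univ e)) with h | h
      · rw [h, zero_mul]
      · have : θ' e.1.1 - θ' e.1.2 = θhat e.1.1 - θhat e.1.2 := by
          by_contra hne
          have := softplus_add_lt hne
          simp only [gap] at h
          linarith
        simp only [Pi.sub_apply]
        rw [show θ' e.1.1 - θhat e.1.1 - (θ' e.1.2 - θhat e.1.2) = 0 by linarith]
        simp
    have h6 : energy W (θ' - θhat) = 0 := by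
      rw [energy, ← two_mul_sum_itemPair
        (fun i j => W i j * ((θ' - θhat) i - (θ' - θhat) j) ^ 2)
        (fun i j => by rw [hWd, adjW_symm]; ring) (fun i => by simp),
        Finset.sum_eq_zero fun e _ => h5 e, mul_zero]
    have h7 := hconn (θ' - θhat) (by
      simp only [Pi.sub_apply, Finset.sum_sub_distrib, h0, hθ'.1, sub_self]) h6
    exact sub_eq_zero.1 h7

theorem sum_sum_antisymm {V : Type*} [Fintype V] (h : V → V → ℝ) (hh : ∀ i j, h j i = -h i j) :
    ∑ i, ∑ j, h i j = 0 := by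
  simpa using two_mul_sum_mul_antisymm (fun _ => (1 : ℝ)) h hh

/-- `x` solves the truncated score equations at the vertices other than `m`, for the network `A`
from which `m` has been removed. -/
def IsLooPotential {n L : ℕ} (c : ℝ) (θ : Fin n → ℝ) (y : ItemPair n → Fin L → Bool) (m : Fin n)
    (A : Fin n → Fin n → ℝ) (x : Fin n → ℝ) : Prop :=
  x m = 0 ∧ ∑ i, x i = 0 ∧
    ∀ i, i ≠ m → flow A (truncLink c θ) x i = ∑ j, A i j * noise θ y i j

open Classical in
/-- A choice of leave-one-out potential, zero if there is none. -/
def looPotential {n L : ℕ} (c : ℝ) (θ : Fin n → ℝ) (y : ItemPair n → Fin L → Bool) (m : Fin n)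
    (A : Fin n → Fin n → ℝ) : Fin n → ℝ :=
  if h : ∃ x, IsLooPotential c θ y m A x then h.choose else 0

theorem isLooPotential_looPotential {n L : ℕ} {c : ℝ} {θ : Fin n → ℝ}
    {y : ItemPair n → Fin L → Bool} {m : Fin n} {A : Fin n → Fin n → ℝ}
    (h : ∃ x, IsLooPotential c θ y m A x) :
    IsLooPotential c θ y m A (looPotential c θ y m A) := by
  rw [looPotential, dif_pos h]
  exact h.choose_spec

/-- The deterministic half of the upper bound: everything random has been moved into the hypotheses
from `hdeg` to `hrow`. -/
theorem exists_mle_of_good_sample {n L : ℕ} (hL : 1 ≤ L) (hn : 2 ≤ n) (ω : Sample n L)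
    {θ : Fin n → ℝ} (hθ0 : ∑ i, θ i = 0) {b c : ℝ} (hθ : ∀ i j, |θ i - θ j| ≤ b)
    (hcb : c = Real.exp (-(b + 1)) / 4) {N K R ℓ : ℝ} (hNn : N ≤ n)
    (hN : 4 * (1536 / c) ^ 2 ≤ N) (hK : 0 ≤ K) (hR : 0 ≤ R) (hℓ : 96 * ℓ ≤ c * N)
    (hsmall : 16 * K / c * (1 + 5 * (1536 / c)) * R ≤ 1 / 2)
    (hdeg : ∀ i, ∑ j, adjW ω.1 i j ≤ 3 * N)
    (hcut : ∀ S : Finset (Fin n), 2 * S.card ≤ n →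
      N / 8 * S.card ≤ ∑ i ∈ S, ∑ j ∈ Sᶜ, adjW ω.1 i j)
    (hε : ∀ e, |meanOutcome ω.2 e - Real.sigmoid (θ e.1.1 - θ e.1.2)| ≤ K * √N * R)
    (hξ : ∀ i, |∑ j, adjW ω.1 i j * noise θ ω.2 i j| ≤ K * N * R)
    (hrow : ∀ m B, (∀ j, |looPotential c θ ω.2 m (isolate (adjW ω.1) m) j| ≤ B) →
      ∑ j, adjW ω.1 m j * |looPotential c θ ω.2 m (isolate (adjW ω.1) m) j|
        ≤ 2 * (N / n) * ∑ j, |looPotential c θ ω.2 m (isolate (adjW ω.1) m) j| + ℓ * B) :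
    ∃ θhat : Fin n → ℝ, IsMLE (observe ω) θhat ∧
      (∀ θ' : Fin n → ℝ, IsMLE (observe ω) θ' → θ' = θhat) ∧
      ‖θhat - θ‖ ≤ 16 * K / c * (1 + 5 * (1536 / c)) * R := by
  have hc : 0 < c := by rw [hcb]; positivity
  have hb : 0 ≤ b := (abs_nonneg _).trans (hθ ⟨0, by omega⟩ ⟨0, by omega⟩)
  have hc1 : c ≤ 1 := by
    have := Real.exp_le_one_iff.2 (by linarith : -(b + 1) ≤ 0)
    rw [hcb]; linarith
  have hg : IsLink c (truncLink c θ) := by rw [hcb]; exact isLink_truncLink hθ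
  have hN0 : 0 < N := lt_of_lt_of_le (by positivity) hN
  have hN768 : 768 ≤ N := by
    have h1 : (1536 : ℝ) ≤ 1536 / c := by rw [le_div_iff₀ hc]; linarith
    have h2 : (1536 : ℝ) ^ 2 ≤ (1536 / c) ^ 2 := pow_le_pow_left₀ (by norm_num) h1 2
    linarith
  set W := adjW ω.1 with hWd
  have hW : ∀ i j, W j i = W i j := adjW_symm ω.1
  have hW0 : ∀ i j, 0 ≤ W i j := adjW_nonneg ω.1
  have hW01 : ∀ i j, W i j = 0 ∨ W i j = 1 := adjW_zero_or_one ω.1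
  have hW1 : ∀ i j, W i j ≤ 1 := fun i j => by rcases hW01 i j with h | h <;> simp [h]
  -- Cheeger's constant is `(N / 8) ^ 2 / (3 * N) = N / 192`.
  have hP : ∀ x : Fin n → ℝ, ∑ i, x i = 0 → N / 192 * ∑ i, x i ^ 2 ≤ energy W x := fun x hx => by
    have h := cheeger hW hW0 (κ := N / 8) (D := 3 * N) (by positivity) (by positivity)
      (by simpa using hcut) hdeg x hx
    refine le_of_mul_le_mul_left ?_ (by positivity : 0 < 3 * N)
    refine le_trans (le_of_eq ?_) h
    ring
  have hdeg' : ∀ i, N / 8 ≤ ∑ j, W i j := fun i => by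
    have h := hcut {i} (by simpa using hn)
    simp only [Finset.card_singleton, Nat.cast_one, mul_one, Finset.sum_singleton] at h
    exact h.trans (Finset.sum_le_sum_of_subset_of_nonneg (Finset.subset_univ _)
      fun j _ _ => hW0 i j)
  have hnoise : ∀ i j, noise θ ω.2 j i = -noise θ ω.2 i j := altExt_antisymm _
  obtain ⟨δ, -, hδ0, hδ⟩ := exists_flow_eq hc hg hW hW0 Finset.univ (fun i j hi => by simp at hi)
    (by positivity : 0 < N / 192) (fun x _ hx => hP x hx) (fun i => ∑ j, W i j * noise θ ω.2 i j)
    (sum_sum_antisymm _ fun i j => by rw [hW, hnoise]; ring)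
  have hloo : ∀ m, ∃ x, IsLooPotential c θ ω.2 m (isolate W m) x := fun m => by
    obtain ⟨x, hx0, hxs, hx⟩ := exists_flow_eq hc hg (isolate_symm hW m) (isolate_nonneg hW0 m)
      (Finset.univ.erase m) (fun i j hi => by
        have : i = m := by simpa using hi
        rw [this, isolate_self]) (by linarith : 0 < N / 192 - 2)
      (fun x hx hxs => poincare_isolate hW0 hW1 hP m x (hx m (by simp)) hxs)
      (fun i => ∑ j, isolate W m i j * noise θ ω.2 i j) (by
        rw [Finset.sum_erase (f := fun i => ∑ j, isolate W m i j * noise θ ω.2 i j) _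
          (Finset.sum_eq_zero fun j _ => by rw [isolate_self, zero_mul])]
        exact sum_sum_antisymm _ fun i j => by rw [isolate_symm hW, hnoise]; ring)
    exact ⟨x, hx0 m (by simp), hxs, fun i hi => hx i (by simp [hi])⟩
  have hbound : ∀ i, |δ i| ≤ 16 * K / c * (1 + 5 * (1536 / c)) * R :=
    abs_le_of_leaveOneOut hc hc1 hg hW hW01 (adjW_self ω.1) (by simpa using hn)
      (by simpa using hNn) hN hK hR hℓ hdeg hdeg' hP
      (abs_altExt_le (by positivity) hε) hξ hδ0 (fun i => hδ i (Finset.mem_univ i)) fun m => by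
        obtain ⟨h1, h2, h3⟩ := isLooPotential_looPotential (hloo m)
        exact ⟨_, h1, h2, h3, fun B hB => by simpa using hrow m B hB⟩
  have hmle := isMLE_of_score_eq hL ω (θ := θ) (θhat := θ + δ)
    (by simp [Finset.sum_add_distrib, hθ0, hδ0])
    (fun i => by
      rw [← hδ i (Finset.mem_univ i), flow]
      refine Finset.sum_congr rfl fun j _ => ?_
      -- Differences of `δ` are at most `1/2 + 1/2 = 1` by `hsmall`, so the truncated response is
      -- the true one.
      rw [truncLink_of_abs_le]
      · simp only [Pi.add_apply, hWd]
        ring_nf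
      · have := abs_sub (δ i) (δ j)
        linarith [hbound i, hbound j])
    (fun x hx hE => by
      have h1 := hP x hx
      rw [← hWd] at hE
      rw [hE] at h1
      have h2 : ∑ i, x i ^ 2 = 0 := le_antisymm
        (nonpos_of_mul_nonpos_right h1 (by positivity)) (Finset.sum_nonneg fun i _ => sq_nonneg _)
      have h3 := (Finset.sum_eq_zero_iff_of_nonneg fun i _ => sq_nonneg (x i)).1 h2
      funext i
      exact pow_eq_zero_iff two_ne_zero |>.1 (h3 i (Finset.mem_univ i)))
  refine ⟨θ + δ, hmle.1, hmle.2, ?_⟩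
  rw [add_sub_cancel_left]
  exact (pi_norm_le_iff_of_nonneg (by positivity)).2 fun i => hbound i

section

/-! ### Exponential moments on finite product spaces -/

section product

variable {ι : Type*} [Fintype ι]

/-- The law of independent Bernoulli bits. -/
def bitLaw (ι : Type*) [Fintype ι] (p : unitInterval) : Measure (ι → Bool) :=
  Measure.pi fun _ => bernoulliMeasure true false p

instance (p : unitInterval) : IsProbabilityMeasure (bitLaw ι p) := by
  unfold bitLaw; infer_instance

theorem integral_exp_bits (p : unitInterval) (s : ι → ℝ) :
    ∫ b, Real.exp (∑ e, if b e then s e else 0) ∂bitLaw ι p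
      = ∏ e, ((p : ℝ) * Real.exp (s e) + (1 - p)) := by
  simp_rw [Real.exp_sum]
  rw [bitLaw, integral_fintype_prod_eq_prod (fun e (b : Bool) => Real.exp (if b then s e else 0))]
  refine Finset.prod_congr rfl fun e _ => ?_
  rw [integral_bernoulliMeasure]
  simp

theorem integral_exp_bits_le (p : unitInterval) (s : ι → ℝ) :
    ∫ b, Real.exp (∑ e, if b e then s e else 0) ∂bitLaw ι p
      ≤ Real.exp (p * ∑ e, (Real.exp (s e) - 1)) := by
  rw [integral_exp_bits, Finset.mul_sum, Real.exp_sum]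
  have hp := p.2.1
  have hp' := p.2.2
  refine Finset.prod_le_prod (fun e _ => ?_) fun e _ => ?_
  · have := mul_nonneg hp (Real.exp_pos (s e)).le
    linarith
  · have := Real.add_one_le_exp ((p : ℝ) * (Real.exp (s e) - 1))
    linarith

theorem measureReal_le_of_integral_exp_le {α : Type*} [MeasurableSpace α] [Finite α]
    [MeasurableSingletonClass α] (μ : Measure α) [IsProbabilityMeasure μ] (f : α → ℝ) {A t : ℝ}
    (h : ∫ x, Real.exp (f x) ∂μ ≤ Real.exp A) : μ.real {x | t ≤ f x} ≤ Real.exp (A - t) := by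
  have h1 := mul_meas_ge_le_integral_of_nonneg (μ := μ) (f := fun x => Real.exp (f x))
    (Filter.Eventually.of_forall fun x => (Real.exp_pos _).le) Integrable.of_finite (Real.exp t)
  have h2 : {x | Real.exp t ≤ Real.exp (f x)} = {x | t ≤ f x} := by
    ext x; simp
  rw [h2] at h1
  rw [Real.exp_sub, le_div_iff₀ (Real.exp_pos _)]
  linarith

/-- A Chernoff bound for a weighted sum of bits whose weights do not depend on these bits. -/
theorem bitLaw_row_le [DecidableEq ι] (p : unitInterval) (T : Finset ι) (F : (ι → Bool) → ι → ℝ)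
    (hF0 : ∀ b e, 0 ≤ F b e) (hF1 : ∀ b e, F b e ≤ 1)
    (hF : ∀ b b', (∀ e ∉ T, b e = b' e) → F b = F b') (t : ℝ) :
    (bitLaw ι p).real {b | 2 * p * ∑ e ∈ T, F b e + t ≤ ∑ e ∈ T, if b e then F b e else 0}
      ≤ Real.exp (-t) := by
  have hp := p.2.1
  let f : (ι → Bool) → ℝ := fun b =>
    (∑ e ∈ T, if b e then F b e else 0) - 2 * p * ∑ e ∈ T, F b e
  have hset : {b | 2 * p * ∑ e ∈ T, F b e + t ≤ ∑ e ∈ T, if b e then F b e else 0}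
      = {b | t ≤ f b} := by
    ext b; simp only [Set.mem_ofPred_eq, f]; constructor <;> intro h <;> linarith
  rw [hset, ← zero_sub]
  refine measureReal_le_of_integral_exp_le _ f ?_
  rw [Real.exp_zero]
  have hmp := measurePreserving_piEquivPiSubtypeProd
    (fun _ : ι => bernoulliMeasure true false p) (fun e => e ∈ T)
  set E := MeasurableEquiv.piEquivPiSubtypeProd (fun _ : ι => Bool) (fun e => e ∈ T)
  have hint : ∫ b, Real.exp (f b) ∂bitLaw ι p = ∫ z, Real.exp (f (E.symm z))
      ∂((Measure.pi fun _ : {e // e ∈ T} => bernoulliMeasure true false p).prod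
        (Measure.pi fun _ : {e // e ∉ T} => bernoulliMeasure true false p)) := by
    have h := hmp.integral_comp E.measurableEmbedding (fun z => Real.exp (f (E.symm z)))
    simp only [MeasurableEquiv.symm_apply_apply] at h
    rw [bitLaw, h]
    congr!
  rw [hint, integral_prod_symm _ Integrable.of_finite]
  -- Given the bits off `T` the weights are frozen, and `exp a - 1 ≤ 2 * a` on `[0, 1]` shows that
  -- the exponential moment is compensated by the term with `2 * p`.
  have hinner : ∀ z : {e // e ∉ T} → Bool,
      ∫ x, Real.exp (f (E.symm (x, z)))
        ∂(Measure.pi fun _ : {e // e ∈ T} => bernoulliMeasure true false p) ≤ 1 := by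
    intro z
    let a : {e // e ∈ T} → ℝ := fun e => F (E.symm (fun _ => true, z)) e
    have hFa : ∀ x, F (E.symm (x, z)) = F (E.symm (fun _ => true, z)) := fun x =>
      hF _ _ fun e he => by
        simp [E, MeasurableEquiv.piEquivPiSubtypeProd, Equiv.piEquivPiSubtypeProd, he]
    have hx : ∀ (x : {e // e ∈ T} → Bool) (e : {e // e ∈ T}), E.symm (x, z) e = x e := by
      intro x e
      simp [E, MeasurableEquiv.piEquivPiSubtypeProd, Equiv.piEquivPiSubtypeProd]
    have hf : ∀ x, Real.exp (f (E.symm (x, z)))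
        = Real.exp (∑ e, if x e then a e else 0) * Real.exp (-(2 * p * ∑ e, a e)) := by
      intro x
      rw [← Real.exp_add]
      congr 1
      simp only [f]
      rw [← Finset.sum_coe_sort T (fun e => if E.symm (x, z) e then F (E.symm (x, z)) e else 0),
        ← Finset.sum_coe_sort T (fun e => F (E.symm (x, z)) e)]
      simp only [hx, hFa x, a]
      ring
    simp_rw [hf]
    rw [integral_mul_const]
    have h1 := integral_exp_bits_le p a
    have h2 : (p : ℝ) * ∑ e, (Real.exp (a e) - 1) ≤ 2 * p * ∑ e, a e := by
      rw [mul_comm 2 (p : ℝ), mul_assoc]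
      refine mul_le_mul_of_nonneg_left ?_ hp
      rw [Finset.mul_sum]
      refine Finset.sum_le_sum fun e _ => ?_
      have ha0 : 0 ≤ a e := hF0 _ _
      have := Real.abs_exp_sub_one_le (x := a e) (by rw [abs_of_nonneg ha0]; exact hF1 _ _)
      rw [abs_of_nonneg ha0] at this
      exact (le_abs_self _).trans this
    calc _ ≤ Real.exp (2 * p * ∑ e, a e) * Real.exp (-(2 * p * ∑ e, a e)) :=
          mul_le_mul_of_nonneg_right (h1.trans (Real.exp_le_exp.2 h2)) (Real.exp_pos _).le
      _ = 1 := by rw [← Real.exp_add]; simp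
  calc _ ≤ ∫ _z : {e // e ∉ T} → Bool, (1 : ℝ)
        ∂(Measure.pi fun _ : {e // e ∉ T} => bernoulliMeasure true false p) :=
        integral_mono Integrable.of_finite Integrable.of_finite hinner
    _ = 1 := by simp

/-- The lower Chernoff bound for a sum of bits. -/
theorem bitLaw_lower_le [DecidableEq ι] (p : unitInterval) (T : Finset ι) :
    (bitLaw ι p).real {b | (∑ e ∈ T, if b e then (1 : ℝ) else 0) ≤ p * T.card / 4}
      ≤ Real.exp (-(p * T.card / 4)) := by
  have hp := p.2.1
  have h1 := integral_exp_bits_le p (fun e : ι => if e ∈ T then (-1 : ℝ) else 0)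
  have h2 : (p : ℝ) * ∑ e, (Real.exp (if e ∈ T then (-1 : ℝ) else 0) - 1) ≤ -(p * T.card / 2) := by
    have e1 : ∀ e : ι, Real.exp (if e ∈ T then (-1 : ℝ) else 0) - 1
        = if e ∈ T then Real.exp (-1) - 1 else 0 := fun e => by split_ifs <;> simp
    rw [Finset.sum_congr rfl fun e _ => e1 e]
    simp only [Finset.sum_ite_mem, Finset.univ_inter, Finset.sum_const, nsmul_eq_mul]
    have h3 : Real.exp (-1) - 1 ≤ -(1 / 2) := by
      have := Real.exp_neg_one_lt_half
      linarith
    have := mul_le_mul_of_nonneg_left h3 (by positivity : (0 : ℝ) ≤ p * T.card)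
    linarith
  have h4 := measureReal_le_of_integral_exp_le (bitLaw ι p) _ (t := -(p * T.card / 4))
    (h1.trans (Real.exp_le_exp.2 h2))
  refine le_trans (le_of_eq ?_) (h4.trans (le_of_eq ?_))
  · congr 1
    ext b
    have : (∑ e, if b e then (if e ∈ T then (-1 : ℝ) else 0) else 0)
        = -∑ e ∈ T, if b e then (1 : ℝ) else 0 := by
      have e1 : ∀ e, (if b e then (if e ∈ T then (-1 : ℝ) else 0) else 0)
          = if e ∈ T then -(if b e then (1 : ℝ) else 0) else 0 := fun e => by
        split_ifs <;> simp
      rw [Finset.sum_congr rfl fun e _ => e1 e, Finset.sum_ite_mem, Finset.univ_inter,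
        Finset.sum_neg_distrib]
    simp only [Set.mem_ofPred_eq, this, neg_le_neg_iff]
  · congr 1; ring

end product

/-! ### Hoeffding's inequality for the outcomes -/

/-- The law of all potential outcomes, the pair `e` having win probability `q e`. -/
def outLaw {ι : Type*} [Fintype ι] (L : ℕ) (q : ι → unitInterval) : Measure (ι → Fin L → Bool) :=
  Measure.pi fun e => Measure.pi fun _ : Fin L => bernoulliMeasure true false (q e)

instance {ι : Type*} [Fintype ι] (L : ℕ) (q : ι → unitInterval) :
    IsProbabilityMeasure (outLaw L q) := by unfold outLaw; infer_instance

theorem integral_exp_bernoulli_le (q : unitInterval) (s : ℝ) :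
    ∫ b, Real.exp (s * ((if b then (1 : ℝ) else 0) - q)) ∂bernoulliMeasure true false q
      ≤ Real.exp (s ^ 2 / 8) := by
  have h := (hasSubgaussianMGF_of_mem_Icc_of_integral_eq_zero (a := -(q : ℝ)) (b := 1 - q)
    (μ := bernoulliMeasure true false q) (X := fun b : Bool => (if b then (1 : ℝ) else 0) - q)
    (Measurable.of_discrete.aemeasurable)
    (Filter.Eventually.of_forall fun b => by
      have h1 := q.2.1
      have h2 := q.2.2
      cases b
      · simp
      · simp)
    (by rw [integral_bernoulliMeasure]; simp; ring)).mgf_le s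
  refine h.trans (le_of_eq ?_)
  congr 1
  have : ((‖1 - (q : ℝ) - -(q : ℝ)‖₊ : NNReal) : ℝ) = 1 := by simp
  push_cast
  rw [coe_nnnorm] at *
  simp
  ring

theorem integral_exp_outLaw_le {ι : Type*} [Fintype ι] {L : ℕ} (hL : 1 ≤ L)
    (q : ι → unitInterval) (s : ι → ℝ) :
    ∫ y, Real.exp (∑ e, s e * (1 / (L : ℝ) * (∑ l, if y e l then 1 else 0) - q e)) ∂outLaw L q
      ≤ Real.exp (1 / (8 * L) * ∑ e, s e ^ 2) := by
  have hL' : (L : ℝ) ≠ 0 := by positivity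
  have e1 : ∀ (e : ι) (y : Fin L → Bool),
      Real.exp (s e * (1 / (L : ℝ) * (∑ l, if y l then 1 else 0) - q e))
        = ∏ l, Real.exp (s e / L * ((if y l then (1 : ℝ) else 0) - q e)) := fun e y => by
    rw [← Real.exp_sum, ← Finset.mul_sum, Finset.sum_sub_distrib]
    simp only [Finset.sum_const, Finset.card_univ, Fintype.card_fin, nsmul_eq_mul]
    congr 1
    field_simp
  simp_rw [Real.exp_sum, e1]
  rw [outLaw, integral_fintype_prod_eq_prod (fun e (y : Fin L → Bool) =>
    ∏ l, Real.exp (s e / L * ((if y l then (1 : ℝ) else 0) - q e))), Finset.mul_sum, Real.exp_sum]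
  refine Finset.prod_le_prod (fun e _ => integral_nonneg fun y =>
    Finset.prod_nonneg fun l _ => (Real.exp_pos _).le) fun e _ => ?_
  rw [integral_fintype_prod_eq_prod (fun _ (b : Bool) =>
    Real.exp (s e / L * ((if b then (1 : ℝ) else 0) - q e)))]
  refine (Finset.prod_le_prod (fun l _ => integral_nonneg fun b => (Real.exp_pos _).le)
    fun l _ => integral_exp_bernoulli_le (q e) (s e / L)).trans (le_of_eq ?_)
  rw [Finset.prod_const, Finset.card_univ, Fintype.card_fin, ← Real.exp_nat_mul]
  congr 1
  field_simp

theorem outLaw_abs_ge_le {ι : Type*} [Fintype ι] {L : ℕ} (hL : 1 ≤ L) (q : ι → unitInterval)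
    (a : ι → ℝ) {v t : ℝ} (hv : 0 < v) (ha : ∑ e, a e ^ 2 ≤ v) (ht : 0 ≤ t) :
    (outLaw L q).real {y | t < |∑ e, a e * (1 / (L : ℝ) * (∑ l, if y e l then 1 else 0) - q e)|}
      ≤ 2 * Real.exp (-(2 * L * t ^ 2 / v)) := by
  have hL' : (0 : ℝ) < L := by positivity
  set X : (ι → Fin L → Bool) → ℝ := fun y =>
    ∑ e, a e * (1 / (L : ℝ) * (∑ l, if y e l then 1 else 0) - q e) with hX
  have one_side : ∀ σ : ℝ, σ ^ 2 = 1 →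
      (outLaw L q).real {y | t ≤ σ * X y} ≤ Real.exp (-(2 * L * t ^ 2 / v)) := by
    intro σ hσ
    -- The minimizer of the Chernoff exponent `s ^ 2 * v / (8 * L) - s * t`.
    set s : ℝ := 4 * L * t / v with hs
    have hs0 : 0 ≤ s := by positivity
    have h1 := integral_exp_outLaw_le hL q (fun e => s * σ * a e)
    have h2 : ∀ y, ∑ e, s * σ * a e * (1 / (L : ℝ) * (∑ l, if y e l then 1 else 0) - q e)
        = s * (σ * X y) := fun y => by
      rw [hX, Finset.mul_sum, Finset.mul_sum]
      exact Finset.sum_congr rfl fun e _ => by ring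
    simp_rw [h2] at h1
    have h3 : 1 / (8 * L) * ∑ e, (s * σ * a e) ^ 2 ≤ 2 * L * t ^ 2 / v := by
      have e1 : ∀ e, (s * σ * a e) ^ 2 = s ^ 2 * a e ^ 2 := fun e => by
        rw [mul_pow, mul_pow, hσ, mul_one]
      rw [Finset.sum_congr rfl fun e _ => e1 e, ← Finset.mul_sum]
      calc 1 / (8 * L) * (s ^ 2 * ∑ e, a e ^ 2) ≤ 1 / (8 * L) * (s ^ 2 * v) := by gcongr
        _ = 2 * L * t ^ 2 / v := by rw [hs]; field_simp; ring
    have h4 := measureReal_le_of_integral_exp_le (outLaw L q) _ (t := s * t)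
      (h1.trans (Real.exp_le_exp.2 h3))
    refine (measureReal_mono fun y (hy : t ≤ σ * X y) => ?_).trans (h4.trans (le_of_eq ?_))
    · exact mul_le_mul_of_nonneg_left hy hs0
    · congr 1; rw [hs]; field_simp; ring
  have hsub : {y | t < |X y|} ⊆ {y | t ≤ 1 * X y} ∪ {y | t ≤ -1 * X y} := by
    intro y (hy : t < |X y|)
    rcases lt_abs.1 hy with h | h
    · left; simp only [Set.mem_ofPred_eq]; linarith
    · right; simp only [Set.mem_ofPred_eq]; linarith
  have h1 := one_side 1 (by norm_num)
  have h2 := one_side (-1) (by norm_num)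
  have h3 := measureReal_mono (μ := outLaw L q) hsub
  have h4 := measureReal_union_le (μ := outLaw L q) {y | t ≤ 1 * X y} {y | t ≤ -1 * X y}
  linarith

end

section

/-! ### The comparison graph as a family of independent bits -/

/-- The graph whose edges are the pairs with bit `true`. -/
def ofBits {n : ℕ} (b : ItemPair n → Bool) : SimpleGraph (Fin n) where
  Adj i j := (∃ h : j < i, b ⟨(i, j), h⟩ = true) ∨ ∃ h : i < j, b ⟨(j, i), h⟩ = true
  symm := ⟨fun _ _ h => h.symm⟩
  loopless := ⟨fun i h => by simp at h⟩

theorem ofBits_adj_pair {n : ℕ} (b : ItemPair n → Bool) (e : ItemPair n) :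
    (ofBits b).Adj e.1.1 e.1.2 ↔ b e = true := by
  have h : ¬ e.1.1 < e.1.2 := e.2.not_gt
  simp [ofBits, e.2, h]

theorem adjW_ofBits_pair {n : ℕ} (b : ItemPair n → Bool) (e : ItemPair n) :
    adjW (ofBits b) e.1.1 e.1.2 = if b e then 1 else 0 := by
  simp [adjW, ofBits_adj_pair]

open Classical in
theorem ofBits_adj {n : ℕ} (G : SimpleGraph (Fin n)) :
    ofBits (fun e : ItemPair n => decide (G.Adj e.1.1 e.1.2)) = G := by
  ext i j
  rcases lt_trichotomy i j with h | h | h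
  · simp [ofBits, h, h.not_gt, G.adj_comm i j]
  · subst h; simp [ofBits]
  · simp [ofBits, h, h.not_gt]

theorem ofBits_injective {n : ℕ} : Function.Injective (ofBits (n := n)) := fun b b' h => by
  funext e
  have h1 := ofBits_adj_pair b e
  rw [h, ofBits_adj_pair b' e] at h1
  exact (Bool.eq_iff_iff.2 h1).symm

theorem ncard_edgeSet_ofBits {n : ℕ} (b : ItemPair n → Bool) :
    (ofBits b).edgeSet.ncard = (Finset.univ.filter fun e => b e = true).card := by
  have h1 : (ofBits b).edgeSet
      = (fun e : ItemPair n => s(e.1.1, e.1.2)) '' ↑(Finset.univ.filter fun e => b e = true) := by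
    ext x
    induction x using Sym2.ind with
    | _ i j =>
    simp only [SimpleGraph.mem_edgeSet, Set.mem_image, Finset.coe_filter, Finset.mem_univ,
      true_and, Set.mem_ofPred_eq]
    constructor
    · rintro (⟨h, hb⟩ | ⟨h, hb⟩)
      · exact ⟨_, hb, rfl⟩
      · exact ⟨_, hb, Sym2.eq_swap⟩
    · rintro ⟨e, he, hx⟩
      rw [← SimpleGraph.mem_edgeSet, ← hx, SimpleGraph.mem_edgeSet]
      exact (ofBits_adj_pair b e).2 he
  rw [h1, Set.ncard_image_of_injective, Set.ncard_coe_finset]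
  rintro ⟨⟨i, j⟩, h⟩ ⟨⟨i', j'⟩, h'⟩ he
  simp only [Sym2.eq_iff] at he
  rcases he with ⟨rfl, rfl⟩ | ⟨rfl, rfl⟩
  · rfl
  · exact absurd h (not_lt.2 (le_of_lt h'))

theorem card_itemPair (n : ℕ) : Fintype.card (ItemPair n) = n.choose 2 := by
  classical
  have h := ncard_edgeSet_ofBits (n := n) fun _ => true
  have htop : ofBits (n := n) (fun _ => true) = ⊤ := by
    ext i j
    simp only [ofBits, SimpleGraph.top_adj, exists_prop, and_true]
    rw [ne_iff_lt_or_gt, or_comm]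
  rw [htop] at h
  have h2 := SimpleGraph.card_edgeFinset_top_eq_card_choose_two (V := Fin n)
  rw [← SimpleGraph.coe_edgeFinset, Set.ncard_coe_finset, h2] at h
  simpa using h.symm

instance {n : ℕ} : MeasurableSingletonClass (SimpleGraph (Fin n)) where
  measurableSet_singleton G := by
    have : ({G} : Set (SimpleGraph (Fin n))) = SimpleGraph.edgeSet ⁻¹' {G.edgeSet} := by
      ext H; simp
    rw [this]
    exact SimpleGraph.measurable_edgeSet (measurableSet_singleton _)

/-- Both laws give a graph with `k` edges the mass `p ^ k * (1 - p) ^ (n.choose 2 - k)`. This makes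
the Chernoff bounds for bits available for the graph. -/
theorem binomialRandom_eq_map_ofBits (n : ℕ) (p : unitInterval) :
    SimpleGraph.binomialRandom (Fin n) p = (bitLaw (ItemPair n) p).map ofBits := by
  classical
  refine Measure.ext_of_singleton fun G => ?_
  obtain ⟨b, rfl⟩ : ∃ b, ofBits b = G := ⟨_, ofBits_adj G⟩
  rw [Measure.map_apply Measurable.of_discrete (measurableSet_singleton _),
    SimpleGraph.binomialRandom_singleton]
  have h1 : ofBits ⁻¹' {ofBits b} = {b} := by
    ext b'; simp [ofBits_injective.eq_iff]
  rw [h1, bitLaw, Measure.pi_singleton, ncard_edgeSet_ofBits]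
  have h2 : ∀ e, bernoulliMeasure true false p {b e}
      = if b e = true then (unitInterval.toNNReal p : ENNReal)
        else unitInterval.toNNReal (unitInterval.symm p) := fun e => by
    cases b e <;> simp
  rw [Finset.prod_congr rfl fun e _ => h2 e, Finset.prod_ite, Finset.prod_const, Finset.prod_const]
  congr 2
  have h3 := Finset.card_filter_add_card_filter_not (s := (Finset.univ : Finset (ItemPair n)))
    (fun e => b e = true)
  rw [Finset.card_univ, card_itemPair] at h3
  rw [Nat.card_eq_fintype_card, Fintype.card_fin]
  omega

theorem sampleLaw_real {n : ℕ} (L : ℕ) (p : unitInterval) (θ : Fin n → ℝ) (S : Set (Sample n L)) :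
    (sampleLaw L p θ).real S = ((bitLaw (ItemPair n) p).prod
      (outLaw L fun e : ItemPair n => winProb θ e.1.1 e.1.2)).real
        {z | (ofBits z.1, z.2) ∈ S} := by
  have h : sampleLaw L p θ = ((bitLaw (ItemPair n) p).prod
      (outLaw L fun e : ItemPair n => winProb θ e.1.1 e.1.2)).map (Prod.map ofBits id) := by
    rw [← Measure.map_prod_map _ _ Measurable.of_discrete measurable_id, Measure.map_id,
      ← binomialRandom_eq_map_ofBits]
    rfl
  rw [h, map_measureReal_apply Measurable.of_discrete (Set.toFinite S).measurableSet]
  rfl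

section fubini

variable {α β : Type*} [MeasurableSpace α] [MeasurableSpace β] [Finite α] [Finite β]
  [MeasurableSingletonClass α] [MeasurableSingletonClass β] (μ : Measure α) (ν : Measure β)
  [IsProbabilityMeasure μ] [IsProbabilityMeasure ν]

theorem prod_real_eq_integral (A : Set (α × β)) :
    (μ.prod ν).real A = ∫ x, ν.real {y | (x, y) ∈ A} ∂μ := by
  have h := integral_prod (μ := μ) (ν := ν) (A.indicator fun _ => (1 : ℝ)) Integrable.of_finite
  rw [integral_indicator_const _ (Set.toFinite A).measurableSet] at h
  simp only [smul_eq_mul, mul_one] at h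
  rw [h]
  refine integral_congr_ae (Filter.Eventually.of_forall fun x => ?_)
  have : (fun y => A.indicator (fun _ => (1 : ℝ)) (x, y))
      = Set.indicator {y | (x, y) ∈ A} fun _ => (1 : ℝ) := by
    funext y; simp [Set.indicator]
  simp only [this]
  rw [integral_indicator_const _ (Set.toFinite _).measurableSet]
  simp

theorem prod_real_le_of_forall_left {A : Set (α × β)} {t : ℝ}
    (h : ∀ x, ν.real {y | (x, y) ∈ A} ≤ t) : (μ.prod ν).real A ≤ t := by
  rw [prod_real_eq_integral]
  refine (integral_mono Integrable.of_finite (integrable_const t) h).trans ?_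
  simp

theorem prod_real_le_of_forall_right {A : Set (α × β)} {t : ℝ}
    (h : ∀ y, μ.real {x | (x, y) ∈ A} ≤ t) : (μ.prod ν).real A ≤ t := by
  have h1 := prod_real_le_of_forall_left ν μ (A := Prod.swap ⁻¹' A) (t := t) h
  rw [← Measure.prod_swap (μ := ν) (ν := μ),
    map_measureReal_apply measurable_swap (Set.toFinite _).measurableSet]
  exact h1

end fubini

/-! ### Sums over the pairs at an item and over the pairs crossing a cut -/

/-- The pairs containing the item `m`. -/
def row {n : ℕ} (m : Fin n) : Finset (ItemPair n) :=
  Finset.univ.filter fun e => e.1.1 = m ∨ e.1.2 = m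

theorem sum_row {n : ℕ} (m : Fin n) (φ : Fin n → Fin n → ℝ) :
    ∑ e ∈ row m, φ e.1.1 e.1.2
      = ∑ j, if j < m then φ m j else if m < j then φ j m else 0 := by
  rw [row, Finset.sum_filter,
    sum_itemPair (fun i j => if i = m ∨ j = m then φ i j else 0)]
  have key : ∀ i j : Fin n, (if j < i then (if i = m ∨ j = m then φ i j else 0) else 0)
      = (if i = m then (if j < m then φ m j else 0) else 0)
        + (if j = m then (if m < i then φ i m else 0) else 0) := fun i j => by
    by_cases hi : i = m
    · subst hi
      by_cases hj : j = i
      · subst hj; simp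
      · simp [hj]
    · by_cases hj : j = m
      · subst hj; simp [hi]
      · simp [hi, hj]
  simp_rw [key, Finset.sum_add_distrib]
  rw [Finset.sum_comm (f := fun i j => if i = m then (if j < m then φ m j else 0) else 0)]
  simp only [Finset.sum_ite_eq', Finset.mem_univ, if_true]
  rw [← Finset.sum_add_distrib]
  refine Finset.sum_congr rfl fun j _ => ?_
  rcases lt_trichotomy j m with h | h | h
  · simp [h, h.not_gt]
  · subst h; simp
  · simp [h, h.not_gt]

theorem sum_adjW_mul {n : ℕ} (b : ItemPair n → Bool) (m : Fin n) (a : Fin n → ℝ) :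
    ∑ j, adjW (ofBits b) m j * a j
      = ∑ e ∈ row m, if b e then a (if e.1.1 = m then e.1.2 else e.1.1) else 0 := by
  have h := sum_row m fun i j => adjW (ofBits b) i j * a (if i = m then j else i)
  have h1 : ∀ e : ItemPair n, (if b e then a (if e.1.1 = m then e.1.2 else e.1.1) else 0)
      = adjW (ofBits b) e.1.1 e.1.2 * a (if e.1.1 = m then e.1.2 else e.1.1) := fun e => by
    rw [adjW_ofBits_pair, ite_mul, one_mul, zero_mul]
  rw [Finset.sum_congr rfl fun e _ => h1 e, h]
  refine Finset.sum_congr rfl fun j _ => ?_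
  rcases lt_trichotomy j m with h | h | h
  · simp [h]
  · subst h; simp [adjW_self]
  · simp [h, h.not_gt, h.ne', adjW_symm]

theorem sum_row_other_le {n : ℕ} (m : Fin n) {a : Fin n → ℝ} (ha : ∀ j, 0 ≤ a j) :
    ∑ e ∈ row m, a (if e.1.1 = m then e.1.2 else e.1.1) ≤ ∑ j, a j := by
  rw [sum_row m fun i j => a (if i = m then j else i)]
  refine Finset.sum_le_sum fun j _ => ?_
  rcases lt_trichotomy j m with h | h | h
  · simp [h]
  · subst h; simp [ha]
  · simp [h, h.not_gt, h.ne']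

/-- Brings the source at `m` into the form treated by `outLaw_abs_ge_le`; the sign records the
orientation of the pair. -/
theorem sum_adjW_mul_noise {n L : ℕ} (b : ItemPair n → Bool) (θ : Fin n → ℝ)
    (y : ItemPair n → Fin L → Bool) (m : Fin n) :
    ∑ j, adjW (ofBits b) m j * noise θ y m j
      = ∑ e, (if e ∈ row m ∧ b e then (if e.1.1 = m then 1 else -1) else 0) *
        (1 / (L : ℝ) * (∑ l, if y e l then 1 else 0) - winProb θ e.1.1 e.1.2) := by
  have h := sum_row m fun i j => adjW (ofBits b) i j * ((if i = m then 1 else -1) * noise θ y i j)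
  have h1 : ∀ e : ItemPair n, (if e ∈ row m ∧ b e then (if e.1.1 = m then (1 : ℝ) else -1) else 0) *
        (1 / (L : ℝ) * (∑ l, if y e l then 1 else 0) - winProb θ e.1.1 e.1.2)
      = if e ∈ row m then adjW (ofBits b) e.1.1 e.1.2 *
        ((if e.1.1 = m then 1 else -1) * noise θ y e.1.1 e.1.2) else 0 := fun e => by
    rw [adjW_ofBits_pair, noise, altExt_pair, meanOutcome, winProb_eq]
    by_cases h1 : e ∈ row m <;> by_cases h2 : b e = true <;> simp [h1, h2]
  rw [Finset.sum_congr rfl fun e _ => h1 e, Finset.sum_ite_mem, Finset.univ_inter, h]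
  refine Finset.sum_congr rfl fun j _ => ?_
  rcases lt_trichotomy j m with h | h | h
  · simp [h]
  · subst h; simp [adjW_self]
  · simp only [h.not_gt, h, if_false, if_true, h.ne']
    rw [adjW_symm, noise, altExt_antisymm]
    ring

/-- The pairs with exactly one item in `S`. -/
def crossing {n : ℕ} (S : Finset (Fin n)) : Finset (ItemPair n) :=
  Finset.univ.filter fun e => ¬(e.1.1 ∈ S ↔ e.1.2 ∈ S)

theorem sum_crossing {n : ℕ} (S : Finset (Fin n)) (h : Fin n → Fin n → ℝ)
    (hs : ∀ i j, h j i = h i j) :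
    ∑ e ∈ crossing S, h e.1.1 e.1.2 = ∑ i ∈ S, ∑ j ∈ Sᶜ, h i j := by
  have h1 := two_mul_sum_itemPair (fun i j => if ¬(i ∈ S ↔ j ∈ S) then h i j else 0)
    (fun i j => by simp only [hs i j, iff_comm]) (fun i => by simp)
  rw [crossing, Finset.sum_filter]
  have h2 : ∑ i, ∑ j, (if ¬(i ∈ S ↔ j ∈ S) then h i j else 0)
      = 2 * ∑ i ∈ S, ∑ j ∈ Sᶜ, h i j := by
    have e1 : ∀ i ∈ S, ∑ j, (if ¬(i ∈ S ↔ j ∈ S) then h i j else 0) = ∑ j ∈ Sᶜ, h i j :=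
      fun i hi => by
        rw [← Finset.univ_inter Sᶜ, ← Finset.sum_ite_mem]
        exact Finset.sum_congr rfl fun j _ => by simp [hi]
    have e2 : ∀ i ∈ Sᶜ, ∑ j, (if ¬(i ∈ S ↔ j ∈ S) then h i j else 0) = ∑ j ∈ S, h i j :=
      fun i hi => by
        rw [← Finset.univ_inter S, ← Finset.sum_ite_mem]
        exact Finset.sum_congr rfl fun j _ => by simp [Finset.mem_compl.1 hi]
    rw [← Finset.sum_add_sum_compl S, Finset.sum_congr rfl e1, Finset.sum_congr rfl e2,
      Finset.sum_comm (s := Sᶜ), two_mul]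
    congr 1
    exact Finset.sum_congr rfl fun i _ => Finset.sum_congr rfl fun j _ => hs _ _
  linarith

end

theorem measureReal_exists_le {ι α : Type*} [Fintype ι] [MeasurableSpace α] (μ : Measure α)
    [IsProbabilityMeasure μ] (P : ι → α → Prop) (t : ι → ℝ) (h : ∀ i, μ.real {x | P i x} ≤ t i) :
    μ.real {x | ∃ i, P i x} ≤ ∑ i, t i := by
  have : {x | ∃ i, P i x} = ⋃ i, {x | P i x} := by ext; simp
  rw [this]
  exact (measureReal_iUnion_fintype_le _).trans (Finset.sum_le_sum fun i _ => h i)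

theorem card_row_le {n : ℕ} (m : Fin n) : ((row m).card : ℝ) ≤ n := by
  simpa using sum_row_other_le m (a := fun _ => 1) (fun _ => zero_le_one)

/-! ### Probabilities of the exceptional events -/

theorem bitLaw_degree_le {n : ℕ} (p : unitInterval) {t : ℝ} (ht : t ≤ n * p) :
    (bitLaw (ItemPair n) p).real {b | ∃ i, 3 * ((n : ℝ) * p) < ∑ j, adjW (ofBits b) i j}
      ≤ n * Real.exp (-t) := by
  have hp := p.2.1
  refine (measureReal_exists_le _ _ (fun _ => Real.exp (-t)) fun i => ?_).trans (by simp)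
  refine (measureReal_mono fun b hb => ?_).trans
    (bitLaw_row_le p (row i) (fun _ _ => 1) (fun _ _ => zero_le_one) (fun _ _ => le_rfl)
      (fun _ _ _ => rfl) t)
  have h1 := sum_adjW_mul b i fun _ => 1
  simp only [mul_one] at h1
  simp only [Set.mem_ofPred_eq] at hb ⊢
  rw [← h1]
  simp only [Finset.sum_const, nsmul_eq_mul, mul_one]
  have := mul_le_mul_of_nonneg_left (card_row_le i) hp
  linarith

/-- At most half of the vertices, `S`, have at least `n * S.card / 2` crossing pairs, so the lower
Chernoff bound fails with probability at most `x ^ S.card`, `x = exp (-t)`. The union bound over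
nonempty `S` is the binomial sum `(1 + x) ^ n - 1 ≤ exp (n * x) - 1 ≤ 2 * n * x`. -/
theorem bitLaw_cut_le {n : ℕ} (p : unitInterval) {t : ℝ} (ht : 8 * t ≤ n * p)
    (hnt : n * Real.exp (-t) ≤ 1) :
    (bitLaw (ItemPair n) p).real {b | ∃ S : Finset (Fin n), 2 * S.card ≤ n ∧
      ∑ i ∈ S, ∑ j ∈ Sᶜ, adjW (ofBits b) i j < n * p / 8 * S.card}
      ≤ 2 * (n * Real.exp (-t)) := by
  have hp := p.2.1
  set x := Real.exp (-t) with hx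
  have hx0 : 0 < x := Real.exp_pos _
  refine (measureReal_exists_le _ _
    (fun S : Finset (Fin n) => if S = ∅ then 0 else x ^ S.card) fun S => ?_).trans ?_
  · rcases S.eq_empty_or_nonempty with rfl | hS
    · simp
    rw [if_neg hS.ne_empty]
    by_cases hcard : 2 * S.card ≤ n
    swap
    · simp only [hcard, false_and]
      simp only [Set.ofPred_false, measureReal_empty]
      positivity
    have hcr : ((crossing S).card : ℝ) = S.card * (n - S.card) := by
      have := sum_crossing S (fun _ _ => (1 : ℝ)) (fun _ _ => rfl)
      simp only [Finset.sum_const, nsmul_eq_mul, mul_one, Finset.card_compl,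
        Fintype.card_fin] at this
      rw [this, Nat.cast_sub (by omega)]
    have hcard' : (2 : ℝ) * S.card ≤ n := by exact_mod_cast hcard
    have hlow : (n : ℝ) * p / 8 * S.card ≤ p * (crossing S).card / 4 := by
      rw [hcr]
      have : (0 : ℝ) ≤ p * S.card * (n - 2 * S.card) :=
        mul_nonneg (by positivity) (by linarith)
      linarith
    refine (measureReal_mono fun b hb => ?_).trans
      ((bitLaw_lower_le p (crossing S)).trans ?_)
    · simp only [Set.mem_ofPred_eq] at hb ⊢
      have h1 := sum_crossing S (adjW (ofBits b)) (adjW_symm _)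
      rw [← h1] at hb
      simp only [adjW_ofBits_pair] at hb
      linarith [hb.2]
    · rw [hx, ← Real.exp_nat_mul]
      refine Real.exp_le_exp.2 ?_
      have := mul_le_mul_of_nonneg_right ht (Nat.cast_nonneg (α := ℝ) S.card)
      linarith
  · have h1 := Finset.sum_pow_mul_eq_add_pow x 1 (Finset.univ : Finset (Fin n))
    simp only [Finset.powerset_univ, one_pow, mul_one, Finset.card_univ, Fintype.card_fin] at h1
    have h2 : ∑ S : Finset (Fin n), (if S = ∅ then 0 else x ^ S.card) = (x + 1) ^ n - 1 := by
      rw [← h1, ← Finset.sum_erase_add _ _ (Finset.mem_univ (∅ : Finset (Fin n))),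
        ← Finset.sum_erase_add (f := fun S : Finset (Fin n) => x ^ S.card) _ (Finset.mem_univ ∅)]
      simp only [if_true, Finset.card_empty, pow_zero, add_zero, add_sub_cancel_right]
      exact Finset.sum_congr rfl fun S hS => by rw [if_neg (Finset.ne_of_mem_erase hS)]
    rw [h2]
    have h3 : (x + 1) ^ n ≤ Real.exp (n * x) := by
      rw [Real.exp_nat_mul]
      exact pow_le_pow_left₀ (by positivity) (Real.add_one_le_exp x) n
    have hnx : 0 ≤ n * x := by positivity
    have h4 := Real.abs_exp_sub_one_le (x := n * x) (by rwa [abs_of_nonneg hnx])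
    rw [abs_of_nonneg hnx] at h4
    linarith [le_abs_self (Real.exp (n * x) - 1)]

theorem isolate_ofBits_congr {n : ℕ} {m : Fin n} {b b' : ItemPair n → Bool}
    (h : ∀ e ∉ row m, b e = b' e) :
    isolate (adjW (ofBits b)) m = isolate (adjW (ofBits b')) m := by
  have hlt : ∀ i j : Fin n, j < i → i ≠ m → j ≠ m →
      adjW (ofBits b) i j = adjW (ofBits b') i j := fun i j hij hi hj => by
    have h1 := adjW_ofBits_pair b ⟨(i, j), hij⟩
    have h2 := adjW_ofBits_pair b' ⟨(i, j), hij⟩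
    rw [h ⟨(i, j), hij⟩ (by simp [row, hi, hj]), ← h2] at h1
    exact h1
  funext i j
  unfold isolate
  split_ifs with hij
  · rfl
  · push Not at hij
    rcases lt_trichotomy i j with hl | rfl | hl
    · rw [← adjW_symm, hlt j i hl hij.2 hij.1, adjW_symm]
    · simp [adjW_self]
    · exact hlt i j hl hij.1 hij.2

/-- With the outcomes fixed, `looPotential` is a function of the isolated matrix alone, hence does
not depend on the bits in `row m`. Divided by its sup norm it is an admissible weight in
`bitLaw_row_le`. -/
theorem bitLaw_loo_le {n L : ℕ} (p : unitInterval) (c : ℝ) (θ : Fin n → ℝ)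
    (y : ItemPair n → Fin L → Bool) {t : ℝ} (ht : 0 ≤ t) :
    (bitLaw (ItemPair n) p).real {b | ¬ ∀ m B,
      (∀ j, |looPotential c θ y m (isolate (adjW (ofBits b)) m) j| ≤ B) →
      ∑ j, adjW (ofBits b) m j * |looPotential c θ y m (isolate (adjW (ofBits b)) m) j|
        ≤ 2 * p * ∑ j, |looPotential c θ y m (isolate (adjW (ofBits b)) m) j| + t * B}
      ≤ n * Real.exp (-t) := by
  have hp := p.2.1
  simp only [not_forall]
  refine (measureReal_exists_le _ _ (fun _ => Real.exp (-t)) fun m => ?_).trans (by simp)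
  let x : (ItemPair n → Bool) → Fin n → ℝ := fun b =>
    looPotential c θ y m (isolate (adjW (ofBits b)) m)
  refine (measureReal_mono fun b hb => ?_).trans
    (bitLaw_row_le p (row m)
      (fun b e => |x b (if e.1.1 = m then e.1.2 else e.1.1)| / ‖x b‖)
      (fun b e => by positivity) (fun b e => div_le_one_of_le₀ (norm_le_pi_norm (x b) _)
        (norm_nonneg _)) (fun b b' h => by simp only [x, isolate_ofBits_congr h]) t)
  simp only [Set.mem_ofPred_eq] at hb ⊢
  obtain ⟨B, hB, hlt⟩ := hb
  rw [not_le] at hlt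
  have hxB : ‖x b‖ ≤ B := by
    have : Nonempty (Fin n) := ⟨m⟩
    exact (pi_norm_le_iff_of_nonempty _).2 hB
  have hx0 : 0 < ‖x b‖ := by
    rw [norm_pos_iff]
    intro h0
    have h1 : ∀ j, looPotential c θ y m (isolate (adjW (ofBits b)) m) j = 0 := fun j =>
      congrFun h0 j
    have hB0 : 0 ≤ B := (norm_nonneg _).trans hxB
    simp only [h1, abs_zero, mul_zero, Finset.sum_const_zero, zero_add] at hlt
    linarith [mul_nonneg ht hB0]
  have h1 := sum_adjW_mul b m fun j => |x b j|
  have h2 : ∑ e ∈ row m, (if b e then |x b (if e.1.1 = m then e.1.2 else e.1.1)| / ‖x b‖ else 0)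
      = (∑ j, adjW (ofBits b) m j * |x b j|) / ‖x b‖ := by
    rw [h1, Finset.sum_div]
    exact Finset.sum_congr rfl fun e _ => by split_ifs <;> simp
  rw [h2, ← Finset.sum_div, le_div_iff₀ hx0]
  have h3 := sum_row_other_le m (a := fun j => |x b j|) (fun j => abs_nonneg _)
  have h4 := mul_le_mul_of_nonneg_left h3 (by positivity : (0 : ℝ) ≤ 2 * p)
  have h5 := mul_le_mul_of_nonneg_left hxB ht
  have h6 : (2 * p * ((∑ e ∈ row m, |x b (if e.1.1 = m then e.1.2 else e.1.1)|) / ‖x b‖) + t)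
      * ‖x b‖ = 2 * p * (∑ e ∈ row m, |x b (if e.1.1 = m then e.1.2 else e.1.1)|) + t * ‖x b‖ := by
    field_simp
  rw [h6]
  linarith

theorem outLaw_edge_le {n L : ℕ} (hL : 1 ≤ L) (θ : Fin n → ℝ) {t : ℝ} (ht : 0 ≤ t) :
    (outLaw L fun e : ItemPair n => winProb θ e.1.1 e.1.2).real
      {y | ∃ e, t < |meanOutcome y e - Real.sigmoid (θ e.1.1 - θ e.1.2)|}
      ≤ n ^ 2 * (2 * Real.exp (-(2 * L * t ^ 2))) := by
  classical
  refine (measureReal_exists_le _ _ (fun _ => 2 * Real.exp (-(2 * L * t ^ 2))) fun e => ?_).trans ?_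
  · have h := outLaw_abs_ge_le hL (fun e : ItemPair n => winProb θ e.1.1 e.1.2)
      (Pi.single e 1) (v := 1) one_pos (by
        rw [Finset.sum_eq_single e (fun e' _ h => by simp [h]) (by simp)]; simp) ht
    rw [div_one] at h
    refine le_trans (le_of_eq ?_) h
    congr 1
    ext y
    have : ∑ e', (Pi.single e (1 : ℝ) : ItemPair n → ℝ) e' *
        (1 / (L : ℝ) * (∑ l, if y e' l then 1 else 0) - winProb θ e'.1.1 e'.1.2)
        = meanOutcome y e - Real.sigmoid (θ e.1.1 - θ e.1.2) := by
      rw [Finset.sum_eq_single e (fun e' _ h => by simp [h]) (by simp)]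
      simp [meanOutcome, winProb_eq]
    simp only [Set.mem_ofPred_eq, this]
  · rw [Finset.sum_const, nsmul_eq_mul, Finset.card_univ, card_itemPair]
    refine mul_le_mul_of_nonneg_right ?_ (by positivity)
    have : n.choose 2 ≤ n ^ 2 := Nat.choose_le_pow n 2
    exact_mod_cast this

/-- Hoeffding with the graph fixed: the coefficients are signs on the edges at `i`, so their squares
sum to the degree. -/
theorem outLaw_vertex_le {n L : ℕ} (hL : 1 ≤ L) (θ : Fin n → ℝ) (b : ItemPair n → Bool)
    {v t : ℝ} (hv : 0 < v) (hdeg : ∀ i, ∑ j, adjW (ofBits b) i j ≤ v) (ht : 0 ≤ t) :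
    (outLaw L fun e : ItemPair n => winProb θ e.1.1 e.1.2).real
      {y | ∃ i, t < |∑ j, adjW (ofBits b) i j * noise θ y i j|}
      ≤ n * (2 * Real.exp (-(2 * L * t ^ 2 / v))) := by
  refine (measureReal_exists_le _ _ (fun _ => 2 * Real.exp (-(2 * L * t ^ 2 / v)))
    fun i => ?_).trans (by simp)
  have h := outLaw_abs_ge_le hL (fun e : ItemPair n => winProb θ e.1.1 e.1.2)
    (fun e => if e ∈ row i ∧ b e then (if e.1.1 = i then (1 : ℝ) else -1) else 0) hv (by
      have h1 := sum_adjW_mul b i fun _ => 1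
      simp only [mul_one] at h1
      refine le_trans (le_of_eq ?_) (hdeg i)
      rw [h1, ← Finset.univ_inter (row i), ← Finset.sum_ite_mem]
      refine Finset.sum_congr rfl fun e _ => ?_
      by_cases h2 : e ∈ row i <;> by_cases h3 : b e = true <;> by_cases h4 : e.1.1 = i <;>
        simp [h2, h3, h4]) ht
  simp only [← sum_adjW_mul_noise] at h
  exact h

/-! ### The upper bound: from the sampling regime to the rate of the MLE. -/

theorem abs_sub_le_log_of_condNumber_le {n : ℕ} {θ : Fin n → ℝ} {κ₀ : ℝ}
    (h : condNumber θ ≤ κ₀) (i j : Fin n) : |θ i - θ j| ≤ Real.log κ₀ := by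
  have key : ∀ i j : Fin n, θ i - θ j ≤ Real.log κ₀ := fun i j => by
    have : Nonempty (Fin n) := ⟨i⟩
    obtain ⟨k, hk⟩ := exists_eq_ciInf_of_finite (f := fun i => Real.exp (θ i))
    have hpos : 0 < ⨅ i, Real.exp (θ i) := by rw [← hk]; exact Real.exp_pos _
    have h1 : Real.exp (θ i) ≤ ⨆ i, Real.exp (θ i) :=
      le_ciSup (f := fun i => Real.exp (θ i)) (Set.finite_range _).bddAbove i
    have h2 : ⨅ i, Real.exp (θ i) ≤ Real.exp (θ j) :=
      ciInf_le (f := fun i => Real.exp (θ i)) (Set.finite_range _).bddBelow j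
    have h3 : Real.exp (θ i - θ j) ≤ κ₀ := by
      rw [Real.exp_sub]
      exact (div_le_div₀ ((Real.exp_pos _).le.trans h1) h1 hpos h2).trans h
    rw [← Real.log_exp (θ i - θ j)]
    exact Real.log_le_log (Real.exp_pos _) h3
  exact abs_sub_le_iff.2 ⟨key i j, key j i⟩

theorem rate_sq {n L : ℕ} {p : unitInterval} (hn : 1 ≤ n) :
    rate n L p ^ 2 = Real.log n / ((n : ℝ) * p * L) := by
  have hp := p.2.1
  have : 0 ≤ Real.log n := Real.log_nonneg (by exact_mod_cast hn)
  exact Real.sq_sqrt (by positivity)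

/-- Consequences of the sampling regime when there are at least two items. -/
theorem Regime.bounds {C₁ C₂ : ℝ} {n L : ℕ} {p : unitInterval} (h : Regime C₁ C₂ n L p)
    (hn : 2 ≤ n) (hC₁ : 0 < C₁) (hC₂ : 0 < C₂) :
    1 / 2 ≤ Real.log n ∧ C₁ * Real.log n ≤ (n : ℝ) * p ∧ (n : ℝ) * p ≤ n ∧
      rate n L p ^ 2 ≤ 2 / C₂ := by
  obtain ⟨h1, hL, h2, h3⟩ := h
  have hp1 := p.2.2
  have hn0 : (0 : ℝ) < n := by positivity
  have hlog : 1 / 2 ≤ Real.log n := by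
    have h4 : Real.log 2 ≤ Real.log n := Real.log_le_log (by norm_num) (by exact_mod_cast hn)
    linarith [Real.log_two_gt_d9]
  have hN : C₁ * Real.log n ≤ (n : ℝ) * p := by
    have := mul_le_mul_of_nonneg_left h2 hn0.le
    refine le_trans (le_of_eq ?_) this
    field_simp
  refine ⟨hlog, hN, by nlinarith, ?_⟩
  rw [rate_sq h1]
  have hl2 : 0 < C₂ * Real.log n ^ 2 := by positivity
  rw [div_le_div_iff₀ (by linarith) hC₂]
  nlinarith [mul_nonneg hC₂.le (mul_nonneg (by linarith : 0 ≤ Real.log n)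
    (by linarith : 0 ≤ 2 * Real.log n - 1))]

theorem mle_rate {κ₀ c C₃ : ℝ} (hκ₀ : 1 ≤ κ₀) (hc : c = Real.exp (-(Real.log κ₀ + 1)) / 4)
    (hC₃ : C₃ = 16 * 6 / c * (1 + 5 * (1536 / c))) {n L : ℕ} {p : unitInterval}
    (hreg : Regime (8 * (1536 / c) ^ 2) (8 * C₃ ^ 2) n L p) {θ : Fin n → ℝ}
    (hθ : θ ∈ scoreClass n κ₀) :
    1 - 1 / (n : ℝ) ^ 10 ≤ (sampleLaw L p θ).real
      {ω | ∃ θhat : Fin n → ℝ, IsMLE (observe ω) θhat ∧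
        (∀ θ' : Fin n → ℝ, IsMLE (observe ω) θ' → θ' = θhat) ∧
        ‖θhat - θ‖ ≤ C₃ * rate n L p} := by
  obtain ⟨h1n, hL, -, -⟩ := id hreg
  rcases h1n.eq_or_lt with h1 | hn
  -- For a single item the claimed probability bound is `0`.
  · subst h1; simp
  replace hn : 2 ≤ n := hn
  have hb0 : 0 ≤ Real.log κ₀ := Real.log_nonneg hκ₀
  have hc0 : 0 < c := by rw [hc]; positivity
  have hc1 : c ≤ 1 := by
    have := Real.exp_le_one_iff.2 (by linarith : -(Real.log κ₀ + 1) ≤ 0)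
    rw [hc]; linarith
  have hC₃0 : 0 < C₃ := by rw [hC₃]; positivity
  obtain ⟨hlog, hN, hNn, hrate⟩ := hreg.bounds hn (by positivity) (by positivity)
  set Λ := Real.log n with hΛ
  set N : ℝ := (n : ℝ) * p with hNd
  set R := rate n L p with hRd
  have hR0 : 0 ≤ R := Real.sqrt_nonneg _
  have ha1 : (1536 : ℝ) ≤ 1536 / c := by rw [le_div_iff₀ hc0]; linarith
  have ha2 : (1536 : ℝ) * (1536 / c) ≤ (1536 / c) ^ 2 := by rw [sq]; gcongr
  have hac : c * (1536 / c) = 1536 := by field_simp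
  have hN4 : 4 * (1536 / c) ^ 2 ≤ N := by
    have : 8 * (1536 / c) ^ 2 * (1 / 2) ≤ 8 * (1536 / c) ^ 2 * Λ := by gcongr
    linarith
  have hN0 : 0 < N := lt_of_lt_of_le (by positivity) hN4
  -- `112 = 8 * 14`, as the cut bound is used with `t = 14 * Λ`.
  have hNΛ : 112 * Λ ≤ N := by
    refine le_trans ?_ hN
    gcongr
    linarith
  have hℓ : 96 * (13 * Λ) ≤ c * N := by
    have h1 : c * (8 * (1536 / c) ^ 2 * Λ) ≤ c * N := mul_le_mul_of_nonneg_left hN hc0.le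
    have h2 : c * (8 * (1536 / c) ^ 2 * Λ) = 12288 * (1536 / c) * Λ := by
      calc c * (8 * (1536 / c) ^ 2 * Λ) = 8 * (c * (1536 / c)) * (1536 / c) * Λ := by ring
        _ = _ := by rw [hac]; ring
    have h3 : 1248 * Λ ≤ 12288 * (1536 / c) * Λ := by
      gcongr
      linarith
    linarith
  have hsmall : C₃ * R ≤ 1 / 2 := by
    refine le_of_sq_le_sq ?_ (by norm_num)
    rw [mul_pow]
    calc C₃ ^ 2 * R ^ 2 ≤ C₃ ^ 2 * (2 / (8 * C₃ ^ 2)) := by gcongr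
      _ = (1 / 2) ^ 2 := by field_simp; norm_num
  -- This identity turns the Hoeffding exponents into multiples of `log n`: `72 * Λ` for the edges
  -- and `24 * Λ` for the vertices, with `K = 6`.
  have hLR : L * (N * R ^ 2) = Λ := by
    have hL' : (L : ℝ) ≠ 0 := by positivity
    rw [hRd, rate_sq h1n, ← hNd, ← hΛ]
    field_simp
  have hsN : √N ^ 2 = N := Real.sq_sqrt hN0.le
  set q : ItemPair n → unitInterval := fun e => winProb θ e.1.1 e.1.2 with hq
  -- the exceptional events
  set B₁ : Set ((ItemPair n → Bool) × (ItemPair n → Fin L → Bool)) :=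
    {z | ∃ i, 3 * N < ∑ j, adjW (ofBits z.1) i j} with hB₁
  set B₂ : Set ((ItemPair n → Bool) × (ItemPair n → Fin L → Bool)) :=
    {z | ∃ S : Finset (Fin n), 2 * S.card ≤ n ∧
      ∑ i ∈ S, ∑ j ∈ Sᶜ, adjW (ofBits z.1) i j < N / 8 * S.card} with hB₂
  set B₃ : Set ((ItemPair n → Bool) × (ItemPair n → Fin L → Bool)) :=
    {z | ∃ e, 6 * √N * R < |meanOutcome z.2 e - Real.sigmoid (θ e.1.1 - θ e.1.2)|} with hB₃
  -- The degree condition is part of the event, so that for every fixed graph either Hoeffding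
  -- applies with variance `3 * N` or the section is empty.
  set B₄ : Set ((ItemPair n → Bool) × (ItemPair n → Fin L → Bool)) :=
    {z | (∀ i, ∑ j, adjW (ofBits z.1) i j ≤ 3 * N) ∧
      ∃ i, 6 * N * R < |∑ j, adjW (ofBits z.1) i j * noise θ z.2 i j|} with hB₄
  set B₅ : Set ((ItemPair n → Bool) × (ItemPair n → Fin L → Bool)) :=
    {z | ¬ ∀ m B, (∀ j, |looPotential c θ z.2 m (isolate (adjW (ofBits z.1)) m) j| ≤ B) →
      ∑ j, adjW (ofBits z.1) m j * |looPotential c θ z.2 m (isolate (adjW (ofBits z.1)) m) j|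
        ≤ 2 * p * ∑ j, |looPotential c θ z.2 m (isolate (adjW (ofBits z.1)) m) j|
          + 13 * Λ * B} with hB₅
  set μ := bitLaw (ItemPair n) p with hμ
  set ν := outLaw L q with hν
  have hn0 : (0 : ℝ) < n := by positivity
  have hexp : ∀ k : ℕ, Real.exp (-(k * Λ)) = 1 / (n : ℝ) ^ k := fun k => by
    rw [Real.exp_neg, Real.exp_nat_mul, hΛ, Real.exp_log hn0, one_div]
  have hn1 : (1 : ℝ) ≤ n := by exact_mod_cast h1n
  have hle : ∀ k : ℕ, 12 ≤ k → 1 / (n : ℝ) ^ k ≤ 1 / (n : ℝ) ^ 12 := fun k hk => by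
    gcongr
  have h13 : n * Real.exp (-(13 * Λ)) = 1 / (n : ℝ) ^ 12 := by
    have := hexp 13
    push_cast at this
    rw [this]; field_simp
  have p1 : (μ.prod ν).real B₁ ≤ 1 / (n : ℝ) ^ 12 := by
    refine prod_real_le_of_forall_right μ ν fun y => ?_
    rw [← h13]
    exact bitLaw_degree_le p (by linarith)
  have p2 : (μ.prod ν).real B₂ ≤ 2 * (1 / (n : ℝ) ^ 12) := by
    refine prod_real_le_of_forall_right μ ν fun y => ?_
    have h14 : n * Real.exp (-(14 * Λ)) = 1 / (n : ℝ) ^ 13 := by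
      have := hexp 14
      push_cast at this
      rw [this]; field_simp
    refine (bitLaw_cut_le p (t := 14 * Λ) (by linarith) ?_).trans ?_
    · rw [h14]
      exact (div_le_one (by positivity)).2 (one_le_pow₀ hn1)
    · rw [h14]; linarith [hle 13 (by norm_num)]
  have p3 : (μ.prod ν).real B₃ ≤ 2 * (1 / (n : ℝ) ^ 12) := by
    refine prod_real_le_of_forall_left μ ν fun b => ?_
    refine (outLaw_edge_le hL θ (by positivity : 0 ≤ 6 * √N * R)).trans ?_
    have e1 : 2 * (L : ℝ) * (6 * √N * R) ^ 2 = 72 * Λ := by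
      calc 2 * (L : ℝ) * (6 * √N * R) ^ 2 = 72 * (L * (√N ^ 2 * R ^ 2)) := by ring
        _ = _ := by rw [hsN, hLR]
    have := hexp 72
    push_cast at this
    rw [e1, this]
    have e2 : (n : ℝ) ^ 2 * (2 * (1 / (n : ℝ) ^ 72)) = 2 * (1 / (n : ℝ) ^ 70) := by field_simp
    rw [e2]
    linarith [hle 70 (by norm_num)]
  have p4 : (μ.prod ν).real B₄ ≤ 2 * (1 / (n : ℝ) ^ 12) := by
    refine prod_real_le_of_forall_left μ ν fun b => ?_
    by_cases hb : ∀ i, ∑ j, adjW (ofBits b) i j ≤ 3 * N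
    · have h1 := outLaw_vertex_le hL θ b (by positivity : 0 < 3 * N) hb
        (by positivity : 0 ≤ 6 * N * R)
      have e1 : 2 * (L : ℝ) * (6 * N * R) ^ 2 / (3 * N) = 24 * Λ := by
        rw [← hLR]; field_simp; ring
      have := hexp 24
      push_cast at this
      rw [e1, this] at h1
      refine (measureReal_mono fun y hy => hy.2).trans (h1.trans ?_)
      have e2 : (n : ℝ) * (2 * (1 / (n : ℝ) ^ 24)) = 2 * (1 / (n : ℝ) ^ 23) := by field_simp
      rw [e2]
      linarith [hle 23 (by norm_num)]
    · have : {y | (b, y) ∈ B₄} = ∅ := by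
        ext y
        simp only [hB₄, Set.mem_ofPred_eq, hb, false_and, Set.mem_empty_iff_false]
      rw [this, measureReal_empty]
      positivity
  have p5 : (μ.prod ν).real B₅ ≤ 1 / (n : ℝ) ^ 12 := by
    refine prod_real_le_of_forall_right μ ν fun y => ?_
    rw [← h13]
    exact bitLaw_loo_le p c θ y (by positivity)
  have hbad : (μ.prod ν).real (B₁ ∪ (B₂ ∪ (B₃ ∪ (B₄ ∪ B₅)))) ≤ 8 * (1 / (n : ℝ) ^ 12) := by
    have u1 := measureReal_union_le (μ := μ.prod ν) B₁ (B₂ ∪ (B₃ ∪ (B₄ ∪ B₅)))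
    have u2 := measureReal_union_le (μ := μ.prod ν) B₂ (B₃ ∪ (B₄ ∪ B₅))
    have u3 := measureReal_union_le (μ := μ.prod ν) B₃ (B₄ ∪ B₅)
    have u4 := measureReal_union_le (μ := μ.prod ν) B₄ B₅
    linarith
  -- The regime forces `n ≥ N ≥ 8`, which pays for the union of the five events.
  have h12 : 8 * (1 / (n : ℝ) ^ 12) ≤ 1 / (n : ℝ) ^ 10 := by
    have hn8 : (8 : ℝ) ≤ n := by linarith
    have : 8 * (1 / (n : ℝ) ^ 12) = 8 / (n : ℝ) ^ 2 * (1 / (n : ℝ) ^ 10) := by field_simp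
    rw [this]
    refine mul_le_of_le_one_left (by positivity) ?_
    rw [div_le_one (by positivity)]
    nlinarith
  rw [sampleLaw_real]
  have hcompl := probReal_compl_eq_one_sub (μ := μ.prod ν)
    (Set.toFinite (B₁ ∪ (B₂ ∪ (B₃ ∪ (B₄ ∪ B₅))))).measurableSet
  have hmono : (μ.prod ν).real (B₁ ∪ (B₂ ∪ (B₃ ∪ (B₄ ∪ B₅))))ᶜ ≤ (μ.prod ν).real
      {z | (ofBits z.1, z.2) ∈ {ω : Sample n L | ∃ θhat : Fin n → ℝ, IsMLE (observe ω) θhat ∧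
        (∀ θ' : Fin n → ℝ, IsMLE (observe ω) θ' → θ' = θhat) ∧ ‖θhat - θ‖ ≤ C₃ * R}} := by
    refine measureReal_mono fun z hz => ?_
    simp only [Set.mem_compl_iff, Set.mem_union, not_or] at hz
    obtain ⟨z1, z2, z3, z4, z5⟩ := hz
    simp only [hB₁, Set.mem_ofPred_eq, not_exists, not_lt] at z1
    simp only [hB₂, Set.mem_ofPred_eq, not_exists, not_and, not_lt] at z2
    simp only [hB₃, Set.mem_ofPred_eq, not_exists, not_lt] at z3
    simp only [hB₄, Set.mem_ofPred_eq, not_exists, not_and, not_lt] at z4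
    simp only [hB₅, Set.mem_ofPred_eq, not_not] at z5
    have hpN : (p : ℝ) = N / n := by rw [hNd]; field_simp
    have := exists_mle_of_good_sample hL hn (ofBits z.1, z.2) hθ.1
      (abs_sub_le_log_of_condNumber_le hθ.2) hc hNn hN4 (by norm_num : (0 : ℝ) ≤ 6) hR0 hℓ
      (by rw [← hC₃]; exact hsmall) z1 z2 z3 (z4 z1) (by rw [← hpN]; exact z5)
    rw [← hC₃] at this
    exact this
  linarith

/-! ### The minimax lower bound -/

/-- The probability `1 / 2`. -/
def halfProb : unitInterval := ⟨1 / 2, by norm_num, by norm_num⟩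

theorem outLaw_real_singleton {ι : Type*} [Fintype ι] {L : ℕ} (q : ι → unitInterval)
    (y : ι → Fin L → Bool) :
    (outLaw L q).real {y} = ∏ e, ∏ l, if y e l then (q e : ℝ) else 1 - q e := by
  rw [measureReal_def, outLaw, Measure.pi_singleton, ENNReal.toReal_prod]
  refine Finset.prod_congr rfl fun e _ => ?_
  rw [Measure.pi_singleton, ENNReal.toReal_prod]
  refine Finset.prod_congr rfl fun l _ => ?_
  rw [← measureReal_def]
  cases y e l <;> simp

/-- A change of measure from fair coins: the `χ²`-divergence controls the probability of any
event. -/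
theorem outLaw_real_le {ι : Type*} [Fintype ι] {L : ℕ} (q : ι → unitInterval)
    (A : Set (ι → Fin L → Bool)) {lam : ℝ} (hlam : 0 < lam) :
    (outLaw L q).real A ≤ lam / 2 * ∏ e, (1 + (2 * (q e : ℝ) - 1) ^ 2) ^ L
      + 1 / (2 * lam) * (outLaw L fun _ : ι => halfProb).real A := by
  classical
  let D : (ι → Fin L → Bool) → ℝ := fun y => ∏ e, ∏ l, 2 * if y e l then (q e : ℝ) else 1 - q e
  have hD0 : ∀ y, 0 ≤ D y := fun y => Finset.prod_nonneg fun e _ => Finset.prod_nonneg fun l _ => by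
    have h1 := (q e).2.1
    have h2 := (q e).2.2
    split_ifs <;> linarith
  have hw : ∀ y, (outLaw L q).real {y} = D y * (outLaw L fun _ : ι => halfProb).real {y} := by
    intro y
    simp only [outLaw_real_singleton, D]
    rw [← Finset.prod_mul_distrib]
    refine Finset.prod_congr rfl fun e _ => ?_
    rw [← Finset.prod_mul_distrib]
    refine Finset.prod_congr rfl fun l _ => ?_
    split_ifs <;> simp [halfProb] <;> ring
  have hpt : ∀ y, (outLaw L q).real {y} ≤ lam / 2 * ((outLaw L q).real {y} * D y)
      + 1 / (2 * lam) * (outLaw L fun _ : ι => halfProb).real {y} := fun y => by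
    have h0 : 0 ≤ (outLaw L fun _ : ι => halfProb).real {y} := measureReal_nonneg
    -- The inequality of arithmetic and geometric means for the likelihood ratio `D`; the quadratic
    -- term integrates to its second moment under fair coins.
    have h1 : D y ≤ lam / 2 * (D y * D y) + 1 / (2 * lam) := by
      have h2 : lam / 2 * (D y * D y) + 1 / (2 * lam) - D y
          = (lam * D y - 1) ^ 2 / (2 * lam) := by field_simp; ring
      have h3 : 0 ≤ (lam * D y - 1) ^ 2 / (2 * lam) := by positivity
      linarith
    have h4 := mul_le_mul_of_nonneg_right h1 h0
    rw [hw]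
    linarith
  have hΓ : ∑ y, (outLaw L q).real {y} * D y = ∏ e, (1 + (2 * (q e : ℝ) - 1) ^ 2) ^ L := by
    have h1 : ∫ y, D y ∂outLaw L q = ∑ y, (outLaw L q).real {y} * D y := by
      rw [integral_fintype Integrable.of_finite]
      simp
    rw [← h1]
    simp only [D]
    rw [outLaw, integral_fintype_prod_eq_prod (fun e (y : Fin L → Bool) =>
      ∏ l, 2 * if y l then (q e : ℝ) else 1 - q e)]
    refine Finset.prod_congr rfl fun e _ => ?_
    rw [integral_fintype_prod_eq_prod (fun _ (b : Bool) => 2 * if b then (q e : ℝ) else 1 - q e)]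
    simp only [integral_bernoulliMeasure, Finset.prod_const, Finset.card_univ, Fintype.card_fin]
    congr 1
    simp
    ring
  have hsum : ∀ μ : Measure (ι → Fin L → Bool), ∀ [IsProbabilityMeasure μ],
      μ.real A = ∑ y ∈ A.toFinset, μ.real {y} := fun μ _ => by
    rw [sum_measureReal_singleton, Set.coe_toFinset]
  rw [hsum (outLaw L q), hsum (outLaw L fun _ : ι => halfProb), ← hΓ, Finset.mul_sum,
    Finset.mul_sum]
  refine (Finset.sum_le_sum fun y _ => hpt y).trans ?_
  rw [Finset.sum_add_distrib]
  refine add_le_add_left (Finset.sum_le_sum_of_subset_of_nonneg (Finset.subset_univ _)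
    fun y _ _ => ?_) _
  have := mul_nonneg (measureReal_nonneg (μ := outLaw L q) (s := {y})) (hD0 y)
  positivity

/-- Outcomes off the comparison graph may be replaced by fair coins without changing the law of
the data. -/
theorem outLaw_real_congr_off {ι : Type*} [Fintype ι] {L : ℕ} (q q' : ι → unitInterval)
    (b : ι → Bool) (hq : ∀ e, b e = true → q e = q' e) (A : Set (ι → Fin L → Bool))
    (hA : ∀ y y', (∀ e, b e = true → y e = y' e) → (y ∈ A ↔ y' ∈ A)) :
    (outLaw L q).real A = (outLaw L q').real A := by
  -- Erasing the unobserved outcomes does not affect `A` and makes the two product laws equal factor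
  -- by factor.
  let φ : ∀ e : ι, (Fin L → Bool) → Fin L → Bool := fun e y => if b e then y else fun _ => false
  have hpre : (fun (y : ι → Fin L → Bool) e => φ e (y e)) ⁻¹' A = A := by
    ext y
    exact hA _ _ fun e he => by simp [φ, he]
  have hmap : ∀ r : ι → unitInterval, (outLaw L r).real A
      = (Measure.pi fun e => (Measure.pi fun _ : Fin L =>
          bernoulliMeasure true false (r e)).map (φ e)).real A := fun r => by
    rw [← Measure.pi_map_pi (fun e => Measurable.of_discrete.aemeasurable)]
    rw [map_measureReal_apply Measurable.of_discrete (Set.toFinite A).measurableSet, hpre]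
    rfl
  rw [hmap q, hmap q']
  congr 2
  funext e
  by_cases he : b e = true
  · rw [hq e he]
  · have : φ e = fun _ => fun _ => false := by funext y; simp [φ, he]
    rw [this, Measure.map_const, Measure.map_const]
    simp

theorem observe_congr {n L : ℕ} (b : ItemPair n → Bool) {y y' : ItemPair n → Fin L → Bool}
    (h : ∀ e, b e = true → y e = y' e) :
    observe (ofBits b, y) = observe (ofBits b, y') := by
  funext e
  simp only [observe, ofBits_adj_pair]
  by_cases he : b e = true
  · simp [he, h e he]
  · simp [he]

/-- The centered score vector in which only the item `k` stands out. -/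
def spike {n : ℕ} (s : ℝ) (k : Fin n) : Fin n → ℝ := fun i => (if i = k then s else 0) - s / n

theorem spike_mem_scoreClass {n : ℕ} {s κ₀ : ℝ} (hs : 0 ≤ s) (hκ : Real.exp s ≤ κ₀) (k : Fin n) :
    spike s k ∈ scoreClass n κ₀ := by
  have : Nonempty (Fin n) := ⟨k⟩
  have hn : (n : ℝ) ≠ 0 := by
    have := k.pos
    positivity
  refine ⟨?_, ?_⟩
  · simp only [spike, Finset.sum_sub_distrib, Finset.sum_ite_eq', Finset.mem_univ, if_true,
      Finset.sum_const, Finset.card_univ, Fintype.card_fin, nsmul_eq_mul]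
    field_simp
    ring
  · have h1 : (⨆ i, Real.exp (spike s k i)) ≤ Real.exp (s - s / n) :=
      ciSup_le fun i => Real.exp_le_exp.2 (by simp only [spike]; split_ifs <;> linarith)
    have h2 : Real.exp (-(s / n)) ≤ ⨅ i, Real.exp (spike s k i) :=
      le_ciInf fun i => Real.exp_le_exp.2 (by simp only [spike]; split_ifs <;> linarith)
    refine le_trans ?_ hκ
    rw [condNumber]
    refine (div_le_div₀ (Real.exp_pos _).le h1 (Real.exp_pos _) h2).trans (le_of_eq ?_)
    rw [← Real.exp_sub]; ring_nf

theorem le_norm_spike_sub {n : ℕ} {s : ℝ} (hs : 0 ≤ s) {k l : Fin n} (hkl : k ≠ l) :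
    s ≤ ‖spike s k - spike s l‖ := by
  have := norm_le_pi_norm (spike s k - spike s l) k
  simp only [spike, Pi.sub_apply, if_true, hkl, if_false] at this
  rw [Real.norm_of_nonneg (by linarith)] at this
  linarith

theorem two_mul_sigmoid_sub_one_sq_le (x : ℝ) : (2 * Real.sigmoid x - 1) ^ 2 ≤ 4 * x ^ 2 := by
  have h0 : Real.sigmoid 0 = 1 / 2 := by rw [Real.sigmoid_zero]; norm_num
  rcases le_total 0 x with h | h
  · have h1 := sigmoid_sub_le h
    have h2 := Real.sigmoid_le h
    rw [h0] at h1 h2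
    nlinarith
  · have h1 := sigmoid_sub_le h
    have h2 := Real.sigmoid_le h
    rw [h0] at h1 h2
    nlinarith

/-- Pairs without `k` are fair under the spike, and unobserved pairs may be made fair. So only the
edges at `k` contribute to the second moment of the likelihood ratio, each at most `exp (4 * s ^ 2)`
per outcome. -/
theorem outLaw_spike_real_le {n L : ℕ} (s : ℝ) (k : Fin n) (b : ItemPair n → Bool)
    (A : Set (ItemPair n → Fin L → Bool))
    (hA : ∀ y y', (∀ e, b e = true → y e = y' e) → (y ∈ A ↔ y' ∈ A))
    {lam D : ℝ} (hlam : 0 < lam) (hD : ∑ j, adjW (ofBits b) k j ≤ D) :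
    (outLaw L fun e : ItemPair n => winProb (spike s k) e.1.1 e.1.2).real A
      ≤ lam / 2 * Real.exp (4 * s ^ 2 * L * D)
        + 1 / (2 * lam) * (outLaw L fun _ : ItemPair n => halfProb).real A := by
  let q : ItemPair n → unitInterval := fun e =>
    if b e then winProb (spike s k) e.1.1 e.1.2 else halfProb
  rw [outLaw_real_congr_off _ q b (fun e he => by simp [q, he]) A hA]
  refine (outLaw_real_le q A hlam).trans ?_
  refine add_le_add_left (mul_le_mul_of_nonneg_left ?_ (by positivity)) _
  have h1 : ∀ e, 1 + (2 * (q e : ℝ) - 1) ^ 2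
      ≤ Real.exp (4 * s ^ 2 * if e ∈ row k then (if b e then 1 else 0) else 0) := fun e => by
    refine le_trans ?_ (Real.add_one_le_exp _)
    rw [add_comm]
    refine add_le_add_left ?_ _
    by_cases hb : b e = true
    · simp only [q, hb, if_true, winProb_eq]
      refine (two_mul_sigmoid_sub_one_sq_le _).trans ?_
      by_cases hr : e ∈ row k
      · rw [if_pos hr]
        have hne : e.1.1 ≠ e.1.2 := e.2.ne'
        have hsq : (spike s k e.1.1 - spike s k e.1.2) ^ 2 ≤ s ^ 2 := by
          simp only [spike]
          split_ifs with h2 h3 h3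
          · exact absurd (h2.trans h3.symm) hne
          · refine le_of_eq ?_; ring
          · refine le_of_eq ?_; ring
          · nlinarith [sq_nonneg s]
        linarith
      · have h2 : e.1.1 ≠ k ∧ e.1.2 ≠ k := by simpa [row] using hr
        simp [spike, h2.1, h2.2, hr]
    · simp [q, hb, halfProb]
  calc ∏ e, (1 + (2 * (q e : ℝ) - 1) ^ 2) ^ L
      ≤ ∏ e, Real.exp (4 * s ^ 2 * if e ∈ row k then (if b e then 1 else 0) else 0) ^ L :=
        Finset.prod_le_prod (fun e _ => by positivity)
          fun e _ => pow_le_pow_left₀ (by positivity) (h1 e) L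
    _ = Real.exp (4 * s ^ 2 * L * ∑ j, adjW (ofBits b) k j) := by
        have h2 := sum_adjW_mul b k fun _ => 1
        simp only [mul_one] at h2
        rw [h2, Finset.prod_pow, ← Real.exp_sum, ← Real.exp_nat_mul, ← Finset.mul_sum,
          Finset.sum_ite_mem, Finset.univ_inter]
        ring_nf
    _ ≤ Real.exp (4 * s ^ 2 * L * D) := Real.exp_le_exp.2 (by gcongr)

theorem sum_measureReal_le_one {ι α : Type*} [Fintype ι] [MeasurableSpace α] [Finite α]
    [MeasurableSingletonClass α] (μ : Measure α) [IsProbabilityMeasure μ] (A : ι → Set α)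
    (hA : Pairwise fun i j => Disjoint (A i) (A j)) : ∑ i, μ.real (A i) ≤ 1 := by
  rw [← measureReal_iUnion_fintype hA fun i => (Set.toFinite _).measurableSet]
  exact measureReal_le_one

/-- Disjoint success events have total probability at most `1` under fair coins. The change of
measure costs a factor of order `√n`, so `n` spikes cannot all be found with probability above one
half. -/
theorem minimax_lower {κ₀ C₁ C₂ c : ℝ} (hκ₀ : 1 < κ₀) (hC₁ : 1024 ≤ C₁) (hC₂ : 0 < C₂)
    (hc : 0 < c) (hc1 : 96 * c ^ 2 ≤ 1) (hc2 : 8 * c ^ 2 ≤ C₂ * Real.log κ₀ ^ 2)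
    {n L : ℕ} {p : unitInterval} (hreg : Regime C₁ C₂ n L p) (est : Data n L → Fin n → ℝ) :
    ∃ θ ∈ scoreClass n κ₀, 1 / 2 ≤ (sampleLaw L p θ).real
      {ω | c * rate n L p ≤ ‖est (observe ω) - θ‖} := by
  obtain ⟨h1n, hL, -, -⟩ := id hreg
  have hlogκ : 0 < Real.log κ₀ := Real.log_pos hκ₀
  rcases h1n.eq_or_lt with h1 | hn
  · subst h1
    refine ⟨spike 0 0, spike_mem_scoreClass le_rfl (by simpa using hκ₀.le) 0, ?_⟩
    have : {ω : Sample 1 L | c * rate 1 L p ≤ ‖est (observe ω) - spike 0 0‖} = Set.univ := by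
      ext ω
      simp [rate]
    rw [sampleLaw_real, this]
    simp
    norm_num
  replace hn : 2 ≤ n := hn
  obtain ⟨hlog, hN, hNn, hrate⟩ := hreg.bounds hn (by linarith) hC₂
  set Λ := Real.log n with hΛ
  set N : ℝ := (n : ℝ) * p with hNd
  set R := rate n L p with hRd
  have hR0 : 0 ≤ R := Real.sqrt_nonneg _
  have hn0 : (0 : ℝ) < n := by positivity
  have hN1 : 1024 * Λ ≤ N := le_trans (by gcongr) hN
  have hN0 : 0 < N := by linarith
  have hLR : L * (N * R ^ 2) = Λ := by
    have hL' : (L : ℝ) ≠ 0 := by positivity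
    rw [hRd, rate_sq h1n, ← hNd, ← hΛ]
    field_simp
  -- Twice the target accuracy, so that balls of radius `c * R` around different spikes are
  -- disjoint. The hypothesis `hc2` keeps the spikes in the score class.
  set s : ℝ := 2 * c * R with hs
  have hs0 : 0 ≤ s := by positivity
  have hsκ : Real.exp s ≤ κ₀ := by
    rw [← Real.le_log_iff_exp_le (by linarith)]
    refine le_of_sq_le_sq ?_ hlogκ.le
    calc s ^ 2 = 4 * c ^ 2 * R ^ 2 := by rw [hs]; ring
      _ ≤ 4 * c ^ 2 * (2 / C₂) := by gcongr
      _ = 8 * c ^ 2 / C₂ := by ring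
      _ ≤ Real.log κ₀ ^ 2 := by rw [div_le_iff₀ hC₂]; linarith
  by_contra! hcon
  -- each spike would be found with probability more than one half
  set μ := bitLaw (ItemPair n) p with hμ
  let A : Fin n → Set ((ItemPair n → Bool) × (ItemPair n → Fin L → Bool)) := fun k =>
    {z | ‖est (observe (ofBits z.1, z.2)) - spike s k‖ < c * R}
  let ν : Fin n → Measure (ItemPair n → Fin L → Bool) := fun k =>
    outLaw L fun e : ItemPair n => winProb (spike s k) e.1.1 e.1.2
  have hνp : ∀ k, IsProbabilityMeasure (ν k) := fun k => by simp only [ν]; infer_instance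
  have hbig : ∀ k, 1 / 2 ≤ (μ.prod (ν k)).real (A k) := fun k => by
    have h1 := hcon _ (spike_mem_scoreClass hs0 hsκ k)
    rw [sampleLaw_real] at h1
    have h2 := probReal_compl_eq_one_sub (μ := μ.prod (ν k)) (Set.toFinite (A k)).measurableSet
    have h3 : (A k)ᶜ = {z | (ofBits z.1, z.2) ∈
        {ω : Sample n L | c * R ≤ ‖est (observe ω) - spike s k‖}} := by
      ext z
      simp [A]
    rw [h3] at h2
    linarith
  have hdis : ∀ b, Pairwise fun k l : Fin n =>
      Disjoint {y | (b, y) ∈ A k} {y | (b, y) ∈ A l} := fun b k l hkl => by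
    refine Set.disjoint_left.2 fun y hk hl => ?_
    have h1 := le_norm_spike_sub hs0 hkl
    have hk' : ‖est (observe (ofBits b, y)) - spike s k‖ < c * R := hk
    have hl' : ‖est (observe (ofBits b, y)) - spike s l‖ < c * R := hl
    have h2 := norm_sub_le_norm_sub_add_norm_sub (spike s k) (est (observe (ofBits b, y)))
      (spike s l)
    rw [norm_sub_rev (spike s k) (est _)] at h2
    linarith
  set G : ℝ := Real.exp (Λ / 2) with hG
  have hG0 : 0 < G := Real.exp_pos _
  have hG2 : G ^ 2 = n := by
    rw [hG, ← Real.exp_nat_mul, hΛ]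
    rw [show ((2 : ℕ) : ℝ) * (Real.log n / 2) = Real.log n by push_cast; ring, Real.exp_log hn0]
  have hG16 : 16 ≤ G := by
    refine le_of_sq_le_sq ?_ hG0.le
    rw [hG2]; linarith
  let bad : Set (ItemPair n → Bool) := {b | ∃ i, 3 * N < ∑ j, adjW (ofBits b) i j}
  have hpt : ∀ b, ∑ k, (ν k).real {y | (b, y) ∈ A k}
      ≤ n / 4 + n * bad.indicator (fun _ => (1 : ℝ)) b := fun b => by
    by_cases hb : b ∈ bad
    · rw [Set.indicator_of_mem hb]
      have : ∑ k, (ν k).real {y | (b, y) ∈ A k} ≤ ∑ _k : Fin n, (1 : ℝ) :=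
        Finset.sum_le_sum fun k _ => measureReal_le_one
      simp only [Finset.sum_const, Finset.card_univ, Fintype.card_fin, nsmul_eq_mul] at this
      linarith
    · rw [Set.indicator_of_notMem hb]
      have hdeg : ∀ i, ∑ j, adjW (ofBits b) i j ≤ 3 * N := by
        simpa [bad] using hb
      -- `96 * c ^ 2 ≤ 1` is what keeps the second moment below `G = √n`.
      have hexp : 4 * s ^ 2 * L * (3 * N) ≤ Λ / 2 := by
        calc 4 * s ^ 2 * L * (3 * N) = 48 * c ^ 2 * (L * (N * R ^ 2)) := by rw [hs]; ring
          _ = 48 * c ^ 2 * Λ := by rw [hLR]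
          _ ≤ 1 / 2 * Λ := by gcongr; linarith
          _ = Λ / 2 := by ring
      have hk : ∀ k, (ν k).real {y | (b, y) ∈ A k} ≤ 1 / 8
          + 2 * G * (outLaw L fun _ : ItemPair n => halfProb).real {y | (b, y) ∈ A k} := fun k => by
        have h1 := outLaw_spike_real_le (L := L) s k b {y | (b, y) ∈ A k} (fun y y' hy => by
          simp only [A, Set.mem_ofPred_eq, observe_congr b hy])
          -- This `lam` turns the second-moment term into `1 / 8`. The remaining terms sum over `k`
          -- to at most `2 * G ≤ n / 8`.
          (by positivity : 0 < 1 / (4 * G)) (hdeg k)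
        refine h1.trans ?_
        have h2 : 1 / (4 * G) / 2 * Real.exp (4 * s ^ 2 * L * (3 * N)) ≤ 1 / 8 := by
          calc 1 / (4 * G) / 2 * Real.exp (4 * s ^ 2 * L * (3 * N)) ≤ 1 / (4 * G) / 2 * G := by
                gcongr
                exact Real.exp_le_exp.2 hexp
            _ = 1 / 8 := by field_simp; norm_num
        have h3 : 1 / (2 * (1 / (4 * G))) = 2 * G := by field_simp; norm_num
        rw [h3]
        linarith
      have h1 := sum_measureReal_le_one (outLaw L fun _ : ItemPair n => halfProb)
        (fun k => {y | (b, y) ∈ A k}) (hdis b)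
      have h2 := Finset.sum_le_sum fun k (_ : k ∈ (Finset.univ : Finset (Fin n))) => hk k
      rw [Finset.sum_add_distrib, ← Finset.mul_sum] at h2
      simp only [Finset.sum_const, Finset.card_univ, Fintype.card_fin, nsmul_eq_mul] at h2
      have h3 := mul_le_mul_of_nonneg_left h1 (by positivity : 0 ≤ 2 * G)
      have h4 : 16 * G ≤ n := by rw [← hG2, sq]; gcongr
      linarith
  have hbadp : μ.real bad ≤ 1 / 8 := by
    refine (bitLaw_degree_le p (t := 13 * Λ) (by linarith)).trans ?_
    have h1 : Real.exp (-(13 * Λ)) = 1 / (n : ℝ) ^ 13 := by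
      rw [Real.exp_neg, show (13 : ℝ) * Λ = ((13 : ℕ) : ℝ) * Λ by norm_num, Real.exp_nat_mul, hΛ,
        Real.exp_log hn0, one_div]
    have hn8 : (8 : ℝ) ≤ n := by linarith
    rw [h1, show (n : ℝ) * (1 / (n : ℝ) ^ 13) = 1 / (n : ℝ) ^ 12 by field_simp]
    gcongr
    calc (8 : ℝ) ≤ n := hn8
      _ ≤ (n : ℝ) ^ 12 := le_self_pow₀ (by linarith) (by norm_num)
  have htot : ∑ k, (μ.prod (ν k)).real (A k) ≤ n / 4 + n * (1 / 8) := by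
    have h1 : ∑ k, (μ.prod (ν k)).real (A k)
        = ∫ b, ∑ k, (ν k).real {y | (b, y) ∈ A k} ∂μ := by
      rw [integral_finsetSum _ fun k _ => Integrable.of_finite]
      exact Finset.sum_congr rfl fun k _ => prod_real_eq_integral μ (ν k) (A k)
    rw [h1]
    refine (integral_mono Integrable.of_finite Integrable.of_finite hpt).trans ?_
    rw [integral_add Integrable.of_finite Integrable.of_finite, integral_const_mul,
      integral_indicator_const _ (Set.toFinite bad).measurableSet]
    simp only [integral_const, probReal_univ, smul_eq_mul, one_mul, mul_one]
    gcongr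
  have hlow : (n : ℝ) * (1 / 2) ≤ ∑ k, (μ.prod (ν k)).real (A k) := by
    have := Finset.sum_le_sum fun k (_ : k ∈ (Finset.univ : Finset (Fin n))) => hbig k
    simpa using this
  -- The upper bound `3 * n / 8` contradicts the lower bound `n / 2`.
  linarith

end BTL

end

/-! ### Choice of the constants. -/

theorem mainTheorem3 (κ₀ : ℝ) (hκ₀ : 1 ≤ κ₀) :
    ∃ C₁ > 0, ∃ C₂ > 0, ∃ C₃ > 0,
      -- the vanilla MLE exists, is unique and attains the rate, with high probability
      (∀ (n L : ℕ) (p : unitInterval), BTL.Regime C₁ C₂ n L p →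
        ∀ θstar ∈ BTL.scoreClass n κ₀,
          1 - 1 / (n : ℝ) ^ 10 ≤ (BTL.sampleLaw L p θstar).real
            {ω | ∃ θhat : Fin n → ℝ, BTL.IsMLE (BTL.observe ω) θhat ∧
              (∀ θ' : Fin n → ℝ, BTL.IsMLE (BTL.observe ω) θ' → θ' = θhat) ∧
              ‖θhat - θstar‖ ≤ C₃ * BTL.rate n L p}) ∧
      -- no estimator does better than the rate, up to a constant
      (1 < κ₀ → ∃ c > 0, ∀ (n L : ℕ) (p : unitInterval), BTL.Regime C₁ C₂ n L p →
        ∀ est : BTL.Data n L → Fin n → ℝ, ∃ θstar ∈ BTL.scoreClass n κ₀,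
          1 / 2 ≤ (BTL.sampleLaw L p θstar).real
            {ω | c * BTL.rate n L p ≤ ‖est (BTL.observe ω) - θstar‖}) := by
  have hlog : 0 ≤ Real.log κ₀ := Real.log_nonneg hκ₀
  set c : ℝ := Real.exp (-(Real.log κ₀ + 1)) / 4 with hc
  have hc0 : 0 < c := by positivity
  have hc1 : c ≤ 1 := by
    have := Real.exp_le_one_iff.2 (by linarith : -(Real.log κ₀ + 1) ≤ 0)
    rw [hc]; linarith
  set C₃ : ℝ := 16 * 6 / c * (1 + 5 * (1536 / c)) with hC₃
  have hC₃0 : 0 < C₃ := by positivity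
  have hC₁ : 1024 ≤ 8 * (1536 / c) ^ 2 := by
    have h1 : (1536 : ℝ) ≤ 1536 / c := by rw [le_div_iff₀ hc0]; linarith
    have h2 : (1536 : ℝ) ^ 2 ≤ (1536 / c) ^ 2 := pow_le_pow_left₀ (by norm_num) h1 2
    linarith
  -- As `log n ≥ 1/2` for `n ≥ 2`, this `C₁` gives `N ≥ 4 * (1536 / c) ^ 2`, and this `C₂` gives `C₃
  -- * rate ≤ 1/2`, which makes the truncation inactive.
  refine ⟨8 * (1536 / c) ^ 2, by positivity, 8 * C₃ ^ 2, by positivity, C₃, hC₃0,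
    fun n L p hreg θ hθ => BTL.mle_rate hκ₀ hc hC₃ hreg hθ, fun hκ => ?_⟩
  have hlog0 : 0 < Real.log κ₀ := Real.log_pos hκ
  -- The first bound gives `96 * c ^ 2 ≤ 1`; the second matches `C₂ = 8 * C₃ ^ 2` in the condition
  -- that the spikes have condition number at most `κ₀`.
  refine ⟨min (1 / 10) (C₃ * Real.log κ₀), by positivity, fun n L p hreg est =>
    BTL.minimax_lower hκ hC₁ (by positivity) (by positivity) ?_ ?_ hreg est⟩
  · have h : min (1 / 10) (C₃ * Real.log κ₀) ^ 2 ≤ (1 / 10) ^ 2 :=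
      pow_le_pow_left₀ (by positivity) (min_le_left _ _) 2
    linarith
  · have h : min (1 / 10) (C₃ * Real.log κ₀) ^ 2 ≤ (C₃ * Real.log κ₀) ^ 2 :=
      pow_le_pow_left₀ (by positivity) (min_le_right _ _) 2
    linarith [show (C₃ * Real.log κ₀) ^ 2 = C₃ ^ 2 * Real.log κ₀ ^ 2 by ring]
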